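/- **Notation.** Fix $\rho>1$. Let $\mathcal W$ be the Banach algebra of functions $f(\lambda)=\sum_{i\in\mathbb Z}f_i\lambda^i$ on the unit circle with $\|f\|=\sum_i|f_i|\rho^{|i|}<\infty$; they extend holomorphically to $\rho^{-1}<|\lambda|<\rho$. Let $\mathcal W^{\ge0}$ be the subspace of those $f$ with $f_i=0$ for $i<0$. Put $f^0=f_0$, $\overline f(\lambda)=\sum_i\overline{f_i}\lambda^i$ and $\mathrm{Re}(f)=\frac12(f+\overline f)$. For a matrix group $G$, $\Lambda G$ denotes the loops $\mathbb S^1\to G$ with entries in $\mathcal W$. Let $\sigma(z)=1/\overline z$ on $\overline{\mathbb C}=\mathbb C\cup\{\infty\}$ and $D=\mathrm{diag}(i,-i)$. A DPW potential is a matrix $\xi=\begin{pmatrix}\alpha&\lambda^{-1}\beta\\ \gamma&-\alpha\end{pmatrix}$ of 1-forms in which $\alpha,\beta,\gamma$ are $\mathcal W^{\ge0}$-valued holomorphic 1-forms. It is $\sigma$-symmetric if $\overline{\sigma^*\xi}=D\xi D^{-1}$; likewise a map $\Phi$ into $\Lambda SL(2,\mathbb C)$ on the universal covering of a $\sigma$-invariant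 surface is $\sigma$-symmetric if $\overline{\sigma^*\Phi}=D\Phi D^{-1}$, for a lift of $\sigma$ to the covering. The monodromy of $\Phi$ along a closed curve $\delta$ is $\mathcal M(\Phi,\delta)=\Phi(\widetilde\delta(1))\Phi(\widetilde\delta(0))^{-1}$, where $\widetilde\delta$ is a lift of $\delta$. The Monodromy Problem for $M\in\Lambda SL(2,\mathbb C)$ is one of the following: * ($\mathbb R^3$) $M\in\Lambda SU(2)$, $M|_{\lambda=1}=\pm I_2$ and $\frac{\partial M}{\partial\lambda}|_{\lambda=1}=0$; * ($\mathbb S^3$ or $\mathbb H^3$) $M\in\Lambda SU(2)$ and $M|_{\lambda_1}=M|_{\lambda_2}=\pm I_2$ (the same sign at both points), where $\lambda_1=e^{i\theta},\lambda_2=e^{-i\theta}$ with $0<\theta<\pi$ ($\mathbb S^3$), or $\lambda_1=e^{q},\lambda_2=e^{-q}$ with $q>0$, $e^q<\rho$ ($\mathbb H^3$). **Theorem.** Let $\Omega\subset\overline{\mathbb C}$ be a $\sigma$-symmetric domain containing $0,1,\infty$ and not containing $-1$. Let $(\xi_t)_{|t|<\varepsilon}$, $t$ real, be a $C^1$ family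 of $\sigma$-symmetric DPW potentials on $\Omega\setminus\{0,\infty\}$, with entries $\alpha_t,\beta_t,\gamma_t$, such that for all $t$ 1. $\alpha_t,\beta_t$ are holomorphic in $\Omega$ and $\gamma_t$ has at most double poles at $0$ and $\infty$, 2. $\mathrm{Re}(\mathrm{Res}_0(z\gamma_t))=0$, 3. $\mathrm{Res}_0(\gamma_t^0)=0$. Assume that there exist a continuous family of $\sigma$-symmetric solutions $\Phi_t$, with values in $\Lambda SL(2,\mathbb C)$, of $d\Phi_t=\Phi_t\xi_t$ on the universal covering of $\Omega\setminus\{0,\infty\}$, and a $\sigma$-symmetric simple closed curve $\delta\subset\Omega$ which bounds a disk-type domain contained in $\Omega$ and containing $0$ and $\infty$, such that for all $t$ the monodromy $\mathcal M(\Phi_t,\delta)$ solves the Monodromy Problem (the same one for all $t$) in $\mathbb R^3$, $\mathbb S^3$ or $\mathbb H^3$. Assume further that $\Phi_0(1)$ is diagonal and that $$\xi_0=\begin{pmatrix}0&\lambda^{-1}\\0&0\end{pmatrix}\frac{k\,dz}{(z+1)^2}\qquad\text{with }k\in\mathbb R\setminus\{0\}.$$ Then for all $t$ in a neighborhood of $0$,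 $\xi_t$ is holomorphic at $0$ and $\infty$. **Dual statement.** The same conclusion holds, with the same hypotheses on $\Omega$, $\delta$, $\Phi_t$ and $k$, if in 1–3 the roles of $\beta_t$ and $\gamma_t$ are exchanged (that is, $\alpha_t,\gamma_t$ are holomorphic in $\Omega$, $\beta_t$ has at most double poles at $0$ and $\infty$, $\mathrm{Re}(\mathrm{Res}_0(z\beta_t))=0$ and $\mathrm{Res}_0(\beta_t^0)=0$) and $\xi_0=\begin{pmatrix}0&0\\1&0\end{pmatrix}\frac{k\,dz}{(z+1)^2}$. -/

import Mathlib

open Filter Topology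
open scoped ComplexConjugate OnePoint MatrixGroups

set_option linter.unusedSectionVars false

noncomputable section

/-- The coefficient sequences `(f_i)_{i ∈ ℤ}` with `∑ |f_i| ρ^{|i|} < ∞`. -/
def wienerSubmodule (ρ : ℝ) : Submodule ℂ (ℤ → ℂ) where
  carrier := {c | Summable fun i : ℤ => ‖c i‖ * ρ ^ i.natAbs}
  zero_mem' := by simp
  add_mem' := by
    intro a b ha hb
    have h1 : Summable fun i : ℤ => ‖‖a i‖ * ρ ^ i.natAbs‖ := ha.norm
    have h2 : Summable fun i : ℤ => ‖‖b i‖ * ρ ^ i.natAbs‖ := hb.norm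
    refine Summable.of_norm_bounded (h1.add h2) fun i => ?_
    simp only [Pi.add_apply, norm_mul, norm_norm]
    rw [← add_mul]
    gcongr
    exact norm_add_le _ _
  smul_mem' := by
    intro k a ha
    have h : Summable fun i : ℤ => ‖k‖ * (‖a i‖ * ρ ^ i.natAbs) := Summable.mul_left _ ha
    simpa [mul_assoc] using h

/-- The algebra `𝒲` of functions `f(λ) = ∑ f_i λ^i` on the unit circle with
`‖f‖ = ∑ |f_i| ρ^{|i|} < ∞`; such a function is represented by its Fourier coefficients. -/
def W (ρ : ℝ) : Type := wienerSubmodule ρ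

namespace W

variable {ρ : ℝ}

instance : AddCommGroup (W ρ) := inferInstanceAs (AddCommGroup (wienerSubmodule ρ))

instance : Module ℂ (W ρ) := inferInstanceAs (Module ℂ (wienerSubmodule ρ))

/-- The Fourier coefficient `f_i`. -/
def coeff (f : W ρ) (i : ℤ) : ℂ := f.1 i

/-- The element of `𝒲` with given Fourier coefficients. -/
def mk (c : ℤ → ℂ) (hc : Summable fun i : ℤ => ‖c i‖ * ρ ^ i.natAbs) : W ρ := ⟨c, hc⟩

theorem summable (f : W ρ) : Summable fun i : ℤ => ‖f.coeff i‖ * ρ ^ i.natAbs := f.2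

@[ext] theorem ext {f g : W ρ} (h : ∀ i, f.coeff i = g.coeff i) : f = g :=
  Subtype.ext (funext h)

@[simp] theorem coeff_mk (c : ℤ → ℂ) (hc : Summable fun i : ℤ => ‖c i‖ * ρ ^ i.natAbs) (i : ℤ) :
    (mk c hc).coeff i = c i := rfl

@[simp] theorem coeff_zero (i : ℤ) : (0 : W ρ).coeff i = 0 := rfl

@[simp] theorem coeff_add (f g : W ρ) (i : ℤ) : (f + g).coeff i = f.coeff i + g.coeff i := rfl

@[simp] theorem coeff_neg (f : W ρ) (i : ℤ) : (-f).coeff i = -f.coeff i := rfl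

@[simp] theorem coeff_sub (f g : W ρ) (i : ℤ) : (f - g).coeff i = f.coeff i - g.coeff i := rfl

@[simp] theorem coeff_smul (k : ℂ) (f : W ρ) (i : ℤ) : (k • f).coeff i = k * f.coeff i := rfl

variable [hρ : Fact (1 < ρ)]

theorem one_le_weight (i : ℤ) : 1 ≤ ρ ^ i.natAbs := one_le_pow₀ hρ.out.le

theorem weight_pos (i : ℤ) : 0 < ρ ^ i.natAbs := lt_of_lt_of_le one_pos (one_le_weight i)

instance : Norm (W ρ) := ⟨fun f => ∑' i : ℤ, ‖f.coeff i‖ * ρ ^ i.natAbs⟩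

theorem norm_def (f : W ρ) : ‖f‖ = ∑' i : ℤ, ‖f.coeff i‖ * ρ ^ i.natAbs := rfl

theorem term_nonneg (f : W ρ) (i : ℤ) : 0 ≤ ‖f.coeff i‖ * ρ ^ i.natAbs :=
  mul_nonneg (norm_nonneg _) (weight_pos i).le

theorem norm_coeff_mul_le (f : W ρ) (i : ℤ) : ‖f.coeff i‖ * ρ ^ i.natAbs ≤ ‖f‖ :=
  f.summable.le_tsum i fun j _ => f.term_nonneg j

theorem norm_coeff_le (f : W ρ) (i : ℤ) : ‖f.coeff i‖ ≤ ‖f‖ :=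
  (le_mul_of_one_le_right (norm_nonneg _) (one_le_weight i)).trans (f.norm_coeff_mul_le i)

theorem normCore : NormedSpace.Core ℂ (W ρ) where
  norm_nonneg f := tsum_nonneg f.term_nonneg
  norm_smul k f := by
    simp only [norm_def, coeff_smul, norm_mul, mul_assoc]
    exact tsum_mul_left
  norm_triangle f g := by
    rw [norm_def, norm_def, norm_def, ← f.summable.tsum_add g.summable]
    refine (f + g).summable.tsum_le_tsum (fun i => ?_) (f.summable.add g.summable)
    rw [← add_mul]
    exact mul_le_mul_of_nonneg_right (norm_add_le _ _) (weight_pos i).le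
  norm_eq_zero_iff f := by
    refine ⟨fun h => ext fun i => ?_, fun h => by simp [h, norm_def]⟩
    have := f.norm_coeff_le i
    rw [h] at this
    simpa using this

instance : NormedAddCommGroup (W ρ) := NormedAddCommGroup.ofCore normCore

instance : NormedSpace ℂ (W ρ) := NormedSpace.ofCore normCore

theorem summable_coeff (f : W ρ) : Summable fun i => ‖f.coeff i‖ :=
  Summable.of_nonneg_of_le (fun _ => norm_nonneg _)
    (fun i => le_mul_of_one_le_right (norm_nonneg _) (one_le_weight i)) f.summable

theorem weight_le (n k : ℤ) : ρ ^ n.natAbs ≤ ρ ^ k.natAbs * ρ ^ (n - k).natAbs := by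
  rw [← pow_add]
  exact pow_le_pow_right₀ hρ.out.le (by omega)

/-- `(n, k) ↦ (k, n - k)`. -/
def convEquiv : ℤ × ℤ ≃ ℤ × ℤ where
  toFun q := (q.2, q.1 - q.2)
  invFun q := (q.1 + q.2, q.1)
  left_inv q := by simp
  right_inv q := by simp

theorem summable_pair (f g : W ρ) : Summable fun q : ℤ × ℤ =>
    (‖f.coeff q.2‖ * ρ ^ q.2.natAbs) * (‖g.coeff (q.1 - q.2)‖ * ρ ^ (q.1 - q.2).natAbs) :=
  convEquiv.summable_iff.2
    (Summable.mul_of_nonneg f.summable g.summable f.term_nonneg g.term_nonneg)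

theorem summable_conv_norm (f g : W ρ) : Summable fun q : ℤ × ℤ =>
    ‖f.coeff q.2 * g.coeff (q.1 - q.2)‖ :=
  ((convEquiv.summable_iff (f := fun q : ℤ × ℤ => ‖f.coeff q.1‖ * ‖g.coeff q.2‖)).2
    (Summable.mul_of_nonneg f.summable_coeff g.summable_coeff
      (fun _ => norm_nonneg _) fun _ => norm_nonneg _)).congr fun q => by
        simp [convEquiv]

theorem summable_conv (f g : W ρ) (n : ℤ) :
    Summable fun k : ℤ => ‖f.coeff k * g.coeff (n - k)‖ :=
  (summable_conv_norm f g).prod_factor n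

theorem conv_term_le (f g : W ρ) (n : ℤ) :
    ‖∑' k : ℤ, f.coeff k * g.coeff (n - k)‖ * ρ ^ n.natAbs ≤
      ∑' k : ℤ, (‖f.coeff k‖ * ρ ^ k.natAbs) *
        (‖g.coeff (n - k)‖ * ρ ^ (n - k).natAbs) := by
  refine (mul_le_mul_of_nonneg_right (norm_tsum_le_tsum_norm (summable_conv f g n))
    (weight_pos n).le).trans ?_
  rw [← tsum_mul_right]
  refine ((summable_conv f g n).mul_right _).tsum_le_tsum (fun k => ?_)
    ((summable_pair f g).prod_factor n)
  rw [norm_mul, mul_mul_mul_comm]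
  exact mul_le_mul_of_nonneg_left (weight_le n k) (by positivity)

theorem summable_mul_aux (f g : W ρ) :
    Summable fun n : ℤ => ‖∑' k : ℤ, f.coeff k * g.coeff (n - k)‖ * ρ ^ n.natAbs :=
  Summable.of_nonneg_of_le (fun n => mul_nonneg (norm_nonneg _) (weight_pos n).le)
    (conv_term_le f g) (summable_pair f g).prod

instance : Mul (W ρ) :=
  ⟨fun f g => mk (fun n => ∑' k : ℤ, f.coeff k * g.coeff (n - k)) (summable_mul_aux f g)⟩

theorem coeff_mul (f g : W ρ) (n : ℤ) :
    (f * g).coeff n = ∑' k : ℤ, f.coeff k * g.coeff (n - k) := rfl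

/-- The function `λ ↦ λ^n` as an element of `𝒲`. -/
def monomial (n : ℤ) : W ρ :=
  mk (Pi.single n 1) <| summable_of_ne_finset_zero (s := {n}) fun i hi => by
    have : i ≠ n := by simpa using hi
    simp [this]

instance : One (W ρ) := ⟨monomial 0⟩

theorem coeff_monomial (n i : ℤ) : (monomial n : W ρ).coeff i = if i = n then 1 else 0 := by
  simp [monomial, Pi.single_apply]

theorem coeff_one (i : ℤ) : (1 : W ρ).coeff i = if i = 0 then 1 else 0 := coeff_monomial 0 i

theorem mul_comm_aux (f g : W ρ) : f * g = g * f := by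
  ext n
  rw [coeff_mul, coeff_mul, ← (Equiv.subLeft n).tsum_eq]
  refine tsum_congr fun k => ?_
  simp [mul_comm]

theorem one_mul_aux (f : W ρ) : 1 * f = f := by
  ext n
  rw [coeff_mul, tsum_eq_single 0]
  · simp [coeff_one]
  · intro k hk
    simp [coeff_one, hk]

theorem mul_add_aux (f g h : W ρ) : f * (g + h) = f * g + f * h := by
  ext n
  rw [coeff_add, coeff_mul, coeff_mul, coeff_mul,
    ← (summable_conv f g n).of_norm.tsum_add (summable_conv f h n).of_norm]
  exact tsum_congr fun k => by rw [coeff_add, mul_add]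

theorem mul_assoc_aux (f g h : W ρ) : f * g * h = f * (g * h) := by
  ext n
  have hs : Summable fun q : ℤ × ℤ =>
      f.coeff q.2 * g.coeff (q.1 - q.2) * h.coeff (n - q.1) := by
    refine Summable.of_norm_bounded ((summable_conv_norm f g).mul_right ‖h‖) fun q => ?_
    rw [norm_mul]
    exact mul_le_mul_of_nonneg_left (norm_coeff_le _ _) (norm_nonneg _)
  calc (f * g * h).coeff n
      = ∑' k : ℤ, ∑' j : ℤ, f.coeff j * g.coeff (k - j) * h.coeff (n - k) := by
        rw [coeff_mul]
        exact tsum_congr fun k => by rw [coeff_mul, tsum_mul_right]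
    _ = ∑' j : ℤ, ∑' k : ℤ, f.coeff j * g.coeff (k - j) * h.coeff (n - k) :=
        (Summable.tsum_comm (f := fun j k => f.coeff j * g.coeff (k - j) * h.coeff (n - k))
          ((Equiv.prodComm ℤ ℤ).summable_iff.1 hs))
    _ = (f * (g * h)).coeff n := by
        rw [coeff_mul]
        refine tsum_congr fun j => ?_
        rw [coeff_mul, ← tsum_mul_left, ← (Equiv.addRight j).tsum_eq]
        refine tsum_congr fun k => ?_
        simp only [Equiv.coe_addRight, add_sub_cancel_right, mul_assoc]
        congr 3
        ring

instance : NormedCommRing (W ρ) where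
  __ := (inferInstance : NormedAddCommGroup (W ρ))
  mul_assoc := mul_assoc_aux
  one_mul := one_mul_aux
  mul_one f := by rw [mul_comm_aux, one_mul_aux]
  left_distrib := mul_add_aux
  right_distrib f g h := by
    rw [mul_comm_aux, mul_add_aux, mul_comm_aux h f, mul_comm_aux h g]
  zero_mul f := by ext n; simp [coeff_mul]
  mul_zero f := by ext n; simp [coeff_mul]
  mul_comm := mul_comm_aux
  norm_mul_le f g := by
    have h1 := (summable_mul_aux f g).tsum_le_tsum (conv_term_le f g) (summable_pair f g).prod
    refine h1.trans (le_of_eq ?_)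
    rw [← (summable_pair f g).tsum_prod, norm_def, norm_def,
      f.summable.tsum_mul_tsum g.summable
        (Summable.mul_of_nonneg f.summable g.summable f.term_nonneg g.term_nonneg),
      ← convEquiv.tsum_eq (fun q : ℤ × ℤ => (‖f.coeff q.1‖ * ρ ^ q.1.natAbs) *
        (‖g.coeff q.2‖ * ρ ^ q.2.natAbs))]
    rfl

instance : NormedAlgebra ℂ (W ρ) where
  __ := Algebra.ofModule
    (fun k f g => by
      ext n
      simp only [coeff_mul, coeff_smul, mul_assoc]
      exact tsum_mul_left)
    (fun k f g => by
      ext n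
      simp only [coeff_mul, coeff_smul, mul_left_comm]
      exact tsum_mul_left)
  norm_smul_le k f := (norm_smul k f).le

/-- `𝒲` is isometric to `ℓ¹(ℤ)` through `f ↦ (f_i ρ^{|i|})_i`. -/
def toL1 : W ρ ≃ᵢ lp (fun _ : ℤ => ℂ) 1 where
  toFun f := ⟨fun i => f.coeff i * (ρ ^ i.natAbs : ℝ), memℓp_gen (by
    simpa [abs_of_pos (weight_pos (ρ := ρ) _), abs_of_pos (zero_lt_one.trans hρ.out)] using f.summable)⟩
  invFun c := mk (fun i => c i * ((ρ ^ i.natAbs : ℝ) : ℂ)⁻¹) (by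
    have h := (lp.memℓp c).summable (by simp)
    refine h.congr fun i => ?_
    have := (weight_pos (ρ := ρ) i).ne'
    simp [abs_of_pos (zero_lt_one.trans hρ.out)]
    field_simp)
  left_inv f := by
    ext i
    have : ((ρ ^ i.natAbs : ℝ) : ℂ) ≠ 0 := by exact_mod_cast (weight_pos (ρ := ρ) i).ne'
    simp only [coeff_mk]
    exact mul_inv_cancel_right₀ this _
  right_inv c := by
    ext i
    have : ((ρ ^ i.natAbs : ℝ) : ℂ) ≠ 0 := by exact_mod_cast (weight_pos (ρ := ρ) i).ne'
    exact inv_mul_cancel_right₀ this _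
  isometry_toFun := by
    refine Isometry.of_dist_eq fun f g => ?_
    rw [dist_eq_norm, dist_eq_norm, lp.norm_eq_tsum_rpow (by simp), norm_def]
    simp only [ENNReal.toReal_one, Real.rpow_one, div_one]
    refine tsum_congr fun i => ?_
    rw [lp.coeFn_sub, Pi.sub_apply, ← sub_mul, norm_mul, ← coeff_sub, Complex.norm_real,
      Real.norm_of_nonneg (weight_pos i).le]

instance : CompleteSpace (W ρ) := toL1.completeSpace

/-- Value at `μ` of the function `f(λ) = ∑ f_i λ^i`; the series converges absolutely for
`ρ⁻¹ ≤ |μ| ≤ ρ`. -/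
def eval (f : W ρ) (μ : ℂ) : ℂ := ∑' i : ℤ, f.coeff i * μ ^ i

/-- The conjugation `f ↦ f̄`, `f̄(λ) = ∑ conj(f_i) λ^i`. -/
def bar (f : W ρ) : W ρ :=
  mk (fun i => (starRingEnd ℂ) (f.coeff i)) (by simpa using f.summable)

/-- The real part `(f + f̄) / 2` of `f ∈ 𝒲`. -/
def re (f : W ρ) : W ρ := (1 / 2 : ℂ) • (f + f.bar)

/-- `f ∈ 𝒲^{≥ 0}`: the Fourier coefficients of negative index vanish. -/
def IsNonneg (f : W ρ) : Prop := ∀ i < 0, f.coeff i = 0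

end W

/-! ### The loop group `ΛSL(2,ℂ) = SL(2,𝒲)` -/

section Loops

variable {ρ : ℝ} [Fact (1 < ρ)]

/-- Value at `λ = μ` of a loop of matrices. -/
def evalMatrix (M : Matrix (Fin 2) (Fin 2) (W ρ)) (μ : ℂ) : Matrix (Fin 2) (Fin 2) ℂ :=
  M.map fun f => f.eval μ

/-- `M ∈ ΛSU(2)`. -/
def IsUnitaryLoop (M : SL(2, W ρ)) : Prop :=
  ∀ μ : ℂ, ‖μ‖ = 1 → evalMatrix M.1 μ ∈ Matrix.specialUnitaryGroup (Fin 2) ℂ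

/-- The three space forms, with the Sym-points `λ₁ = λ₂ = 1` for `ℝ³`, `e^{±iθ}` with
`0 < θ < π` for `𝕊³`, and `e^{±q}` with `q > 0` for `ℍ³`; in the last case the Sym-points
lie in the annulus `ρ⁻¹ < |λ| < ρ` on which the elements of `𝒲` are defined. -/
inductive SpaceForm (ρ : ℝ) : Type
  | euclidean : SpaceForm ρ
  | spherical (θ : ℝ) (h0 : 0 < θ) (hπ : θ < Real.pi) : SpaceForm ρ
  | hyperbolic (q : ℝ) (h0 : 0 < q) (hρ : Real.exp q < ρ) : SpaceForm ρ

/-- The Monodromy Problem in `ℝ³`. -/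
def MonodromyProblemEuclidean (M : SL(2, W ρ)) : Prop :=
  IsUnitaryLoop M ∧
  (evalMatrix M.1 1 = 1 ∨ evalMatrix M.1 1 = -1) ∧
  ∀ i j, deriv (fun μ : ℂ => (M.1 i j).eval μ) 1 = 0

/-- The Monodromy Problem with two distinct Sym-points `λ₁`, `λ₂`. -/
def MonodromyProblemSym (lam₁ lam₂ : ℂ) (M : SL(2, W ρ)) : Prop :=
  IsUnitaryLoop M ∧
  ((evalMatrix M.1 lam₁ = 1 ∧ evalMatrix M.1 lam₂ = 1) ∨
    (evalMatrix M.1 lam₁ = -1 ∧ evalMatrix M.1 lam₂ = -1))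

/-- The Monodromy Problem for a monodromy matrix `M`, in each of the three space forms. -/
def MonodromyProblem : SpaceForm ρ → SL(2, W ρ) → Prop
  | .euclidean, M => MonodromyProblemEuclidean M
  | .spherical θ _ _, M =>
      MonodromyProblemSym (Complex.exp (θ * Complex.I)) (Complex.exp (-(θ * Complex.I))) M
  | .hyperbolic q _ _, M =>
      MonodromyProblemSym (Complex.exp q) (Complex.exp (-q)) M

/-- The matrix `D = diag(i, -i)`. -/
def matD : Matrix (Fin 2) (Fin 2) (W ρ) :=
  !![algebraMap ℂ (W ρ) Complex.I, 0; 0, algebraMap ℂ (W ρ) (-Complex.I)]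

end Loops

/-! ### Domains in the Riemann sphere and 1-forms

A 1-form on `Ω ∖ {0, ∞}`, for `Ω` in the Riemann sphere `OnePoint ℂ`, is written `f(z) dz`
and represented by `f : ℂ → E`, of which only the values on `Ω ∖ {0, ∞}` matter. -/

/-- The inversion `σ(z) = 1 / z̄` of the Riemann sphere. -/
def sigma (z : OnePoint ℂ) : OnePoint ℂ :=
  z.elim ((0 : ℂ) : OnePoint ℂ) fun w => if w = 0 then ∞ else (((conj w)⁻¹ : ℂ) : OnePoint ℂ)

/-- `Ω ∖ {0, ∞}` as a subset of `ℂ`. -/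
def puncture (Ω : Set (OnePoint ℂ)) : Set ℂ := {z | z ≠ 0 ∧ (z : OnePoint ℂ) ∈ Ω}

section Forms

variable {E : Type*} [NormedAddCommGroup E] [NormedSpace ℂ E]

/-- `f` has at `0` at most a pole of order `n`; for `n = 0` it extends holomorphically. -/
def PoleAtMost (n : ℕ) (f : ℂ → E) : Prop :=
  ∃ g : ℂ → E, AnalyticAt ℂ g 0 ∧ ∀ᶠ z in 𝓝[≠] (0 : ℂ), f z = (z ^ n)⁻¹ • g z

/-- The 1-form `f(z) dz` in the coordinate `w = 1/z`, namely `-f(1/w) w⁻² dw`. -/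
def atInfinity (f : ℂ → E) (w : ℂ) : E := -((w ^ 2)⁻¹ • f w⁻¹)

/-- The 1-form `f(z) dz` extends holomorphically to `0` and `∞`. -/
def HolomorphicAtZeroInfty (f : ℂ → E) : Prop :=
  PoleAtMost 0 f ∧ PoleAtMost 0 (atInfinity f)

/-- The 1-form `f(z) dz` has at most double poles at `0` and `∞`. -/
def AtMostDoublePoles (f : ℂ → E) : Prop :=
  PoleAtMost 2 f ∧ PoleAtMost 2 (atInfinity f)

/-- `Res_0 (f(z) dz) = R`. -/
def HasResidueAtZero (f : ℂ → E) (R : E) : Prop :=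
  Tendsto (fun r : ℝ => (2 * Real.pi * Complex.I : ℂ)⁻¹ • ∮ z in C(0, r), f z)
    (𝓝[>] 0) (𝓝 R)

end Forms

/-- The curve `δ`, a closed curve parametrized by `[0,1]`, bounds a disk-type domain in `Ω`
containing `0` and `∞`: there is an embedding `ψ` of the closed unit disk into `Ω`, restricting
to `δ` on the unit circle, such that the image of the open disk contains `0` and `∞`. -/
def BoundsDisk (Ω : Set (OnePoint ℂ)) (δ : unitInterval → OnePoint ℂ) : Prop :=
  ∃ ψ : ℂ → OnePoint ℂ,
    ContinuousOn ψ (Metric.closedBall 0 1) ∧ Set.InjOn ψ (Metric.closedBall 0 1) ∧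
    Set.MapsTo ψ (Metric.closedBall 0 1) Ω ∧
    ((0 : ℂ) : OnePoint ℂ) ∈ ψ '' Metric.ball 0 1 ∧ ∞ ∈ ψ '' Metric.ball 0 1 ∧
    ∀ s : unitInterval, δ s = ψ (Complex.exp (2 * Real.pi * Complex.I * (s : ℝ)))

/-! ### DPW potentials -/

/-- The data `α, β, γ` of a potential `ξ = [[α, λ⁻¹ β], [γ, -α]]`, each standing for the
`𝒲`-valued 1-form `α(z) dz`, etc. -/
structure DPWPotential (ρ : ℝ) where
  α : ℂ → W ρ
  β : ℂ → W ρ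
  γ : ℂ → W ρ

namespace DPWPotential

variable {ρ : ℝ} [Fact (1 < ρ)]

/-- The matrix `ξ(z) = [[α, λ⁻¹ β], [γ, -α]]`. -/
def toMatrix (ξ : DPWPotential ρ) (z : ℂ) : Matrix (Fin 2) (Fin 2) (W ρ) :=
  !![ξ.α z, W.monomial (-1) * ξ.β z; ξ.γ z, -ξ.α z]

/-- `ξ` is a DPW potential on `U`: `α, β, γ` are `𝒲^{≥ 0}`-valued holomorphic 1-forms on `U`. -/
def IsPotentialOn (ξ : DPWPotential ρ) (U : Set ℂ) : Prop :=
  (DifferentiableOn ℂ ξ.α U ∧ DifferentiableOn ℂ ξ.β U ∧ DifferentiableOn ℂ ξ.γ U) ∧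
  ∀ z ∈ U, (ξ.α z).IsNonneg ∧ (ξ.β z).IsNonneg ∧ (ξ.γ z).IsNonneg

/-- The symmetry `conj(σ^* ξ) = D ξ D⁻¹` on `U ⊆ ℂ ∖ {0}`. For a 1-form `f(z) dz` one has
`conj(σ^* (f(z) dz)) = -z⁻² f̄(1/z̄) dz`. -/
def IsSigmaSymmetricOn (ξ : DPWPotential ρ) (U : Set ℂ) : Prop :=
  ∀ z ∈ U, (-(z ^ 2)⁻¹) • (ξ.toMatrix (conj z)⁻¹).map W.bar = matD * ξ.toMatrix z * matD⁻¹

/-- `(ξ_t)` is a `C¹` family on `U` for `t ∈ I`. -/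
def IsC1FamilyOn (ξ : ℝ → DPWPotential ρ) (I : Set ℝ) (U : Set ℂ) : Prop :=
  ContDiffOn ℝ 1 (fun q : ℝ × ℂ => (ξ q.1).α q.2) (I ×ˢ U) ∧
  ContDiffOn ℝ 1 (fun q : ℝ × ℂ => (ξ q.1).β q.2) (I ×ˢ U) ∧
  ContDiffOn ℝ 1 (fun q : ℝ × ℂ => (ξ q.1).γ q.2) (I ×ˢ U)

/-- `ξ` is holomorphic at `0` and `∞`. -/
def IsHolomorphicAtZeroInfty (ξ : DPWPotential ρ) : Prop :=
  HolomorphicAtZeroInfty ξ.α ∧ HolomorphicAtZeroInfty ξ.β ∧ HolomorphicAtZeroInfty ξ.γ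

end DPWPotential

/-- The conditions on the singular entry `ω` (which is `γ_t`, or `β_t` in the dual case):
at most double poles at `0` and `∞`, `Re(Res_0(z ω)) = 0` and `Res_0(ω^0) = 0`. -/
def SingularEntry {ρ : ℝ} [Fact (1 < ρ)] (ω : ℂ → W ρ) : Prop :=
  AtMostDoublePoles ω ∧
  (∃ R : W ρ, HasResidueAtZero (fun z => z • ω z) R ∧ R.re = 0) ∧
  HasResidueAtZero (fun z => (ω z).coeff 0) 0

/-! ### Solutions on the universal covering -/

section Solutions

variable {ρ : ℝ} [Fact (1 < ρ)] {X : Type*} [TopologicalSpace X] {U : Set ℂ}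

/-- `Φ : X → ΛSL(2,ℂ)` solves `dΦ = Φ ξ` on the covering `p : X → U`: read through any local
section `s` of `p`, it satisfies `(Φ ∘ s)'(z) = Φ(s z) ξ(z)`. -/
def IsSolution (p : X → U) (ξ : DPWPotential ρ) (Φ : X → SL(2, W ρ)) : Prop :=
  ∀ (x : X) (s : ℂ → X), s (p x) = x → ContinuousAt s (p x) →
    (∀ᶠ z in 𝓝 (p x : ℂ), (p (s z) : ℂ) = z) →
    ∀ i j, HasDerivAt (fun z => (Φ (s z)).1 i j) (((Φ x).1 * ξ.toMatrix (p x)) i j) (p x)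

/-- The symmetry `conj(σ^* Φ) = D Φ D⁻¹`, where `σ'` is a lift of `σ` to the covering. -/
def IsSigmaSymmetric (σ' : X → X) (Φ : X → SL(2, W ρ)) : Prop :=
  ∀ x, (Φ (σ' x)).1.map W.bar = matD * (Φ x).1 * matD⁻¹

/-- The monodromy `ℳ(Φ, δ) = Φ(δ̃(1)) Φ(δ̃(0))⁻¹`, where `δ̃` is a lift of `δ`. -/
def monodromy (Φ : X → SL(2, W ρ)) (δ' : unitInterval → X) : SL(2, W ρ) :=
  Φ (δ' 1) * (Φ (δ' 0))⁻¹

end Solutions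

end

noncomputable section

/-! ### The Wiener algebra: involutions, truncations, evaluations -/

namespace W

variable {ρ : ℝ} [hρ : Fact (1 < ρ)]

/-! Only the singular entry can have poles, and its principal part at `0` is `A dz/z² + B dz/z` with
`A`, `B` in `𝒲^{≥0}`, `Ā = -A` and `B_0 = 0`; the symmetry fixes the principal part at `∞`. It has
to be shown that the pair `y_t = (A_t, B_t)`, which tends to `0`, vanishes for small `t`. The
argument is an infinitesimal rigidity statement: `y_t = o(y_t)` as `t → 0`. No derivative in `t` is
taken; all expansions are relative to the size of `y_t` itself.

In the coordinate `w = 1/(z+1)` the domain lies in `ℂ` and the punctures are `w = 1` and `w = 0`.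
The potential is a regular part, holomorphic on the whole disk bounded by `δ`, plus the singular
part `g_t E₁₀`. A solution `T` for the regular part has no monodromy around `δ`, so `Z = T Φ⁻¹` runs
from `1` to the inverse monodromy and satisfies `dZ = -Z g Φ E₁₀ Φ⁻¹` (`Tube.exists_quotient`). To
first order the inverse monodromy is therefore `1 - ∮ g Φ_0 E₁₀ Φ_0⁻¹` (`Tube.isLittleO`). Since
`Φ_0` is explicit, residues give the integral (`Tube.exists_matrix_primitive`): up to `κ =
2πi·index` its entries are `±λ⁻¹R₁`, `-d²λ⁻²R₂` and `e²R₀`, where `R₀`, `R₁`, `R₂` are combinations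
of `A`, `B`, `B̄` that determine `A` and `B`.

The linear algebra is in `W.eventually_eq_zero_of_linearization`. By unitarity the diagonal term is
self-adjoint up to `o(y)`. As it lies in `𝒲^{≥0}`, it is constant up to `o(y)`, and the Sym-point
condition removes the constant. Off the diagonal, unitarity relates `e²R₀` to the adjoint of
`d²λ⁻²R₂`. A scalar Wiener–Hopf factorization `d d^* = h h^*` (`W.exists_factorization`) turns this
into a relation between an element of `λ𝒲^{≥0}` and one of `λ²𝒲^{≤0}`. Only the exponents `1` and
`2` can overlap, and the two Sym-point conditions remove these. Hence `R₀`, `R₁`, `R₂`, and with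
them `A` and `B`, are `o(y)`.

The curve is only continuous. Line integrals are replaced by primitives on a thickening `δ + r h` of
the curve, with a mean value inequality that does not use length
(`exists_norm_sub_le_of_hasDerivAlong`). That the index is nonzero comes from an antipodal homotopy
(`exists_index`). The dual statement follows by conjugation with `[[0, λ⁻¹], [1, 0]]`, which
exchanges `β` and `γ` and preserves the Monodromy Problem. -/

@[simp] theorem coeff_bar (f : W ρ) (i : ℤ) : f.bar.coeff i = conj (f.coeff i) := rfl

/-- The reflection `f(λ) ↦ f(1/λ)`. -/
def reflect (f : W ρ) : W ρ :=
  mk (fun i => f.coeff (-i)) <| by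
    simpa [Function.comp_def] using (Equiv.neg ℤ).summable_iff.2 f.summable

@[simp] theorem coeff_reflect (f : W ρ) (i : ℤ) : f.reflect.coeff i = f.coeff (-i) := rfl

/-- The adjoint `f^*(λ) = conj (f (1 / conj λ))`. -/
def adj (f : W ρ) : W ρ := f.bar.reflect

@[simp] theorem coeff_adj (f : W ρ) (i : ℤ) : f.adj.coeff i = conj (f.coeff (-i)) := rfl

theorem bar_mul (f g : W ρ) : (f * g).bar = f.bar * g.bar := by
  ext n
  simp only [coeff_bar, coeff_mul, Complex.conj_tsum, map_mul]

theorem reflect_mul (f g : W ρ) : (f * g).reflect = f.reflect * g.reflect := by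
  ext n
  rw [coeff_reflect, coeff_mul, coeff_mul, ← (Equiv.neg ℤ).tsum_eq]
  refine tsum_congr fun k => ?_
  simp only [coeff_reflect, Equiv.neg_apply]
  congr 2
  ring

theorem adj_mul (f g : W ρ) : (f * g).adj = f.adj * g.adj := by
  rw [adj, bar_mul, reflect_mul]; rfl

@[simp] theorem bar_add (f g : W ρ) : (f + g).bar = f.bar + g.bar := by ext; simp
@[simp] theorem bar_sub (f g : W ρ) : (f - g).bar = f.bar - g.bar := by ext; simp
@[simp] theorem bar_smul (k : ℂ) (f : W ρ) : (k • f).bar = conj k • f.bar := by ext; simp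
@[simp] theorem bar_bar (f : W ρ) : f.bar.bar = f := by ext; simp
@[simp] theorem bar_zero : (0 : W ρ).bar = 0 := by ext; simp
@[simp] theorem bar_monomial (n : ℤ) : (monomial n : W ρ).bar = monomial n := by
  ext i; simp only [coeff_bar, coeff_monomial]; split_ifs <;> simp

@[simp] theorem adj_add (f g : W ρ) : (f + g).adj = f.adj + g.adj := by ext; simp
@[simp] theorem adj_neg (f : W ρ) : (-f).adj = -f.adj := by ext; simp
@[simp] theorem adj_sub (f g : W ρ) : (f - g).adj = f.adj - g.adj := by ext; simp
@[simp] theorem adj_smul (k : ℂ) (f : W ρ) : (k • f).adj = conj k • f.adj := by ext; simp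
@[simp] theorem adj_adj (f : W ρ) : f.adj.adj = f := by ext; simp
@[simp] theorem adj_one : (1 : W ρ).adj = 1 := by
  ext i; simp only [coeff_adj, coeff_one, neg_eq_zero]; split_ifs <;> simp
@[simp] theorem adj_monomial (n : ℤ) : (monomial n : W ρ).adj = monomial (-n) := by
  ext i
  simp only [coeff_adj, coeff_monomial, neg_eq_iff_eq_neg]
  split_ifs <;> simp

@[simp] theorem norm_bar (f : W ρ) : ‖f.bar‖ = ‖f‖ := by simp [norm_def]

@[simp] theorem norm_adj (f : W ρ) : ‖f.adj‖ = ‖f‖ := by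
  rw [norm_def, norm_def, ← (Equiv.neg ℤ).tsum_eq]
  simp

theorem monomial_mul_monomial (m n : ℤ) :
    (monomial m : W ρ) * monomial n = monomial (m + n) := by
  ext i
  rw [coeff_mul, tsum_eq_single m]
  · simp only [coeff_monomial, if_true, one_mul, sub_eq_iff_eq_add']
  · intro k hk; simp [coeff_monomial, hk]

theorem coeff_monomial_mul (n : ℤ) (f : W ρ) (i : ℤ) :
    (monomial n * f).coeff i = f.coeff (i - n) := by
  rw [coeff_mul, tsum_eq_single n]
  · simp [coeff_monomial]
  · intro k hk; simp [coeff_monomial, hk]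

theorem monomial_zero : (monomial 0 : W ρ) = 1 := rfl

theorem monomial_mul_cancel (n : ℤ) (f : W ρ) : monomial (-n) * (monomial n * f) = f := by
  rw [← mul_assoc, monomial_mul_monomial, neg_add_cancel, monomial_zero, one_mul]

theorem norm_monomial (n : ℤ) : ‖(monomial n : W ρ)‖ = ρ ^ n.natAbs := by
  rw [norm_def, tsum_eq_single n]
  · simp [coeff_monomial]
  · intro k hk; simp [coeff_monomial, hk]

/-- The Fourier coefficient as a continuous linear functional. -/
def coeffCLM (i : ℤ) : W ρ →L[ℂ] ℂ :=
  LinearMap.mkContinuous ⟨⟨fun f => f.coeff i, fun _ _ => rfl⟩, fun _ _ => rfl⟩ 1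
    fun f => by rw [one_mul]; exact f.norm_coeff_le i

@[simp] theorem coeffCLM_apply (i : ℤ) (f : W ρ) : coeffCLM i f = f.coeff i := rfl

/-- The part of the Fourier series of `f` with exponents in `s`. -/
def trunc (s : Set ℤ) : W ρ →L[ℂ] W ρ :=
  LinearMap.mkContinuous
    { toFun := fun f => mk (s.indicator f.coeff) <|
        Summable.of_nonneg_of_le (fun i => mul_nonneg (norm_nonneg _) (weight_pos i).le)
          (fun i => mul_le_mul_of_nonneg_right (norm_indicator_le_norm_self _ _)
            (weight_pos i).le) f.summable
      map_add' := fun f g => by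
        ext i; by_cases hi : i ∈ s <;> simp [hi]
      map_smul' := fun k f => by
        ext i; by_cases hi : i ∈ s <;> simp [hi] } 1
    fun f => by
      rw [one_mul, norm_def, norm_def]
      refine Summable.tsum_le_tsum (fun i => mul_le_mul_of_nonneg_right
        (norm_indicator_le_norm_self _ _) (weight_pos i).le) (W.summable _) f.summable

theorem coeff_trunc (s : Set ℤ) (f : W ρ) (i : ℤ) :
    (trunc s f).coeff i = s.indicator f.coeff i := rfl

theorem coeff_trunc_of_mem {s : Set ℤ} {i : ℤ} (hi : i ∈ s) (f : W ρ) :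
    (trunc s f).coeff i = f.coeff i := by simp [coeff_trunc, hi]

theorem coeff_trunc_of_notMem {s : Set ℤ} {i : ℤ} (hi : i ∉ s) (f : W ρ) :
    (trunc s f).coeff i = 0 := by simp [coeff_trunc, hi]

/-- Elements of `𝒲` are the sums of their Fourier series. -/
theorem hasSum_monomial (f : W ρ) : HasSum (fun i => f.coeff i • (monomial i : W ρ)) f := by
  have hs : Summable fun i => f.coeff i • (monomial i : W ρ) :=
    Summable.of_norm (by simpa [norm_smul, norm_monomial] using f.summable)
  convert hs.hasSum
  ext i
  rw [← coeffCLM_apply i (∑' _, _), (coeffCLM i).map_tsum hs, tsum_eq_single i]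
  · simp [coeff_monomial]
  · intro k hk; simp [coeff_monomial, Ne.symm hk]

/-! #### Evaluation -/

/-- `μ` lies in the closed annulus `ρ⁻¹ ≤ |μ| ≤ ρ`. -/
def InAnnulus (ρ : ℝ) (μ : ℂ) : Prop := ‖μ‖ ≤ ρ ∧ ‖μ‖⁻¹ ≤ ρ ∧ μ ≠ 0

theorem norm_zpow_le_weight {μ : ℂ} (hμ : InAnnulus ρ μ) (i : ℤ) : ‖μ ^ i‖ ≤ ρ ^ i.natAbs := by
  obtain ⟨h1, h2, -⟩ := hμ
  obtain ⟨n, rfl | rfl⟩ := i.eq_nat_or_neg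
  · simpa using pow_le_pow_left₀ (norm_nonneg _) h1 n
  · simpa using pow_le_pow_left₀ (inv_nonneg.2 (norm_nonneg μ)) h2 n

theorem summable_eval {μ : ℂ} (hμ : InAnnulus ρ μ) (f : W ρ) :
    Summable fun i => ‖f.coeff i * μ ^ i‖ :=
  Summable.of_nonneg_of_le (fun _ => norm_nonneg _) (fun i => by
    rw [norm_mul]
    exact mul_le_mul_of_nonneg_left (norm_zpow_le_weight hμ i) (norm_nonneg _)) f.summable

/-- Evaluation at a point of the closed annulus, as a continuous linear functional. -/
def evalCLM (μ : ℂ) (hμ : InAnnulus ρ μ) : W ρ →L[ℂ] ℂ :=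
  LinearMap.mkContinuous
    { toFun := fun f => f.eval μ
      map_add' := fun f g => by
        simp only [eval, coeff_add, add_mul]
        exact (summable_eval hμ f).of_norm.tsum_add (summable_eval hμ g).of_norm
      map_smul' := fun k f => by
        simp only [eval, coeff_smul, mul_assoc, tsum_mul_left, RingHom.id_apply, smul_eq_mul] } 1
    fun f => by
      rw [one_mul, norm_def]
      refine (norm_tsum_le_tsum_norm (summable_eval hμ f)).trans
        ((summable_eval hμ f).tsum_le_tsum (fun i => ?_) f.summable)
      rw [norm_mul]
      exact mul_le_mul_of_nonneg_left (norm_zpow_le_weight hμ i) (norm_nonneg _)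

@[simp] theorem evalCLM_apply (μ : ℂ) (hμ : InAnnulus ρ μ) (f : W ρ) :
    evalCLM μ hμ f = f.eval μ := rfl

theorem eval_monomial (μ : ℂ) (n : ℤ) : (monomial n : W ρ).eval μ = μ ^ n := by
  rw [eval, tsum_eq_single n]
  · simp [coeff_monomial]
  · intro k hk; simp [coeff_monomial, hk]

/-- Two continuous linear maps on `𝒲` which agree on monomials are equal. -/
theorem clm_ext {E : Type*} [NormedAddCommGroup E] [NormedSpace ℂ E] {S T : W ρ →L[ℂ] E}
    (h : ∀ n, S (monomial n) = T (monomial n)) : S = T := by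
  ext f
  have h1 := S.hasSum f.hasSum_monomial
  have h2 := T.hasSum f.hasSum_monomial
  simp only [map_smul, h] at h1 h2
  exact h1.unique h2

/-- Both sides are continuous and linear in each factor, so by density it is enough to compare them
on monomials, one factor at a time. -/
theorem eval_mul {μ : ℂ} (hμ : InAnnulus ρ μ) (f g : W ρ) :
    (f * g).eval μ = f.eval μ * g.eval μ := by
  have key : ∀ n : ℤ, (evalCLM μ hμ).comp (ContinuousLinearMap.mul ℂ (W ρ) (monomial n)) =
      (monomial n : W ρ).eval μ • evalCLM μ hμ := fun n => clm_ext fun m => by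
    simp [monomial_mul_monomial, eval_monomial, zpow_add₀ hμ.2.2]
  have h2 : (evalCLM μ hμ).comp ((ContinuousLinearMap.mul ℂ (W ρ)).flip g) =
      g.eval μ • evalCLM μ hμ := clm_ext fun n => by
    have := congrArg (fun T => T g) (key n)
    simpa [mul_comm] using this
  have := congrArg (fun T => T f) h2
  simpa [mul_comm] using this

theorem eval_one (μ : ℂ) : (1 : W ρ).eval μ = 1 := by
  rw [← monomial_zero, eval_monomial, zpow_zero]

theorem inAnnulus_of_norm_eq_one {μ : ℂ} (hμ : ‖μ‖ = 1) : InAnnulus ρ μ :=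
  ⟨hμ ▸ hρ.out.le, by rw [hμ, inv_one]; exact hρ.out.le, by rintro rfl; simp at hμ⟩

theorem eval_adj {μ : ℂ} (hμ : ‖μ‖ = 1) (f : W ρ) : f.adj.eval μ = conj (f.eval μ) := by
  rw [eval, eval, Complex.conj_tsum, ← (Equiv.neg ℤ).tsum_eq]
  refine tsum_congr fun i => ?_
  simp only [coeff_adj, Equiv.neg_apply, neg_neg, map_mul, map_zpow₀]
  rw [zpow_neg, ← inv_zpow, Complex.inv_eq_conj hμ]

/-- An element of `𝒲` which vanishes on the unit circle is zero. -/
theorem eq_zero_of_eval {f : W ρ} (h : ∀ μ : ℂ, ‖μ‖ = 1 → f.eval μ = 0) : f = 0 := by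
  ext n
  -- `F i` is the `i`-th term of the series at `e^{iθ}` times `e^{-inθ}`. Integrating the vanishing
  -- sum termwise over a period isolates `2π f_n`.
  let F : ℤ → C(ℝ, ℂ) := fun i =>
    ⟨fun θ => f.coeff i * Complex.exp (((i - n : ℤ) * Complex.I) * θ), by fun_prop⟩
  have hF : Summable fun i => ‖(F i).restrict (⟨Set.uIcc 0 (2 * Real.pi), isCompact_uIcc⟩ :
      TopologicalSpace.Compacts ℝ)‖ := by
    refine Summable.of_nonneg_of_le (fun _ => norm_nonneg _) (fun i => ?_) f.summable_coeff
    refine (ContinuousMap.norm_le _ (norm_nonneg _)).2 fun θ => ?_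
    have : ‖Complex.exp (((i - n : ℤ) * Complex.I) * (θ : ℝ))‖ = 1 := by
      rw [Complex.norm_exp]; simp
    simp only [ContinuousMap.restrict_apply, F, ContinuousMap.coe_mk, norm_mul, this, mul_one]
    exact le_rfl
  have h1 := intervalIntegral.hasSum_intervalIntegral_of_summable_norm (a := 0) (b := 2 * Real.pi) hF
  have h2 : ∀ θ : ℝ, (∑' i, F i θ) = 0 := fun θ => by
    have h3 := h (Complex.exp (θ * Complex.I)) (by rw [Complex.norm_exp]; simp)
    rw [eval] at h3
    have : ∀ i, F i θ = (f.coeff i * Complex.exp (θ * Complex.I) ^ i) *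
        Complex.exp (-n * Complex.I * θ) := fun i => by
      simp only [F, ContinuousMap.coe_mk]
      rw [mul_assoc (f.coeff i), ← Complex.exp_int_mul, ← Complex.exp_add]
      congr 2
      push_cast
      ring
    simp only [this, tsum_mul_right, h3, zero_mul]
  have h4 : ∀ i, (∫ θ in (0 : ℝ)..(2 * Real.pi), F i θ) =
      if i = n then f.coeff n * (2 * Real.pi) else 0 := fun i => by
    split_ifs with hi
    · subst hi; simp [F, mul_comm]
    · have hc : ((i - n : ℤ) * Complex.I : ℂ) ≠ 0 :=
        mul_ne_zero (by exact_mod_cast sub_ne_zero.2 hi) Complex.I_ne_zero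
      simp only [F, ContinuousMap.coe_mk, intervalIntegral.integral_const_mul,
        integral_exp_mul_complex hc]
      have : Complex.exp ((i - n : ℤ) * Complex.I * ((2 * Real.pi : ℝ) : ℂ)) = 1 := by
        rw [← Complex.exp_int_mul_two_pi_mul_I (i - n)]
        congr 1; push_cast; ring
      rw [this]; simp
  simp only [h2, h4, intervalIntegral.integral_zero] at h1
  have h5 := h1.unique (hasSum_ite_eq n _)
  have : (2 * Real.pi : ℂ) ≠ 0 := by exact_mod_cast Real.two_pi_pos.ne'
  simpa [this] using h5.symm

theorem eq_of_eval {f g : W ρ} (h : ∀ μ : ℂ, ‖μ‖ = 1 → f.eval μ = g.eval μ) : f = g := by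
  refine sub_eq_zero.1 (eq_zero_of_eval fun μ hμ => ?_)
  have := map_sub (evalCLM μ (inAnnulus_of_norm_eq_one (ρ := ρ) hμ)) f g
  simpa [h μ hμ] using this

end W

/-! ### Factorization of invertible elements of the Wiener algebra -/

namespace W

variable {ρ : ℝ} [hρ : Fact (1 < ρ)]

/-- `𝒲^{≥ 0}` as a subalgebra. -/
def nonneg (ρ : ℝ) [Fact (1 < ρ)] : Subalgebra ℂ (W ρ) where
  carrier := {f | ∀ i < 0, f.coeff i = 0}
  mul_mem' {f g} hf hg i hi := by
    rw [coeff_mul]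
    refine (tsum_congr fun k => ?_).trans tsum_zero
    rcases lt_or_ge k 0 with hk | hk
    · rw [hf k hk, zero_mul]
    · rw [hg (i - k) (by omega), mul_zero]
  add_mem' {f g} hf hg i hi := by rw [coeff_add, hf i hi, hg i hi, add_zero]
  algebraMap_mem' k i hi := by
    rw [Algebra.algebraMap_eq_smul_one, coeff_smul, coeff_one, if_neg hi.ne, mul_zero]

/-- `𝒲^{≤ 0}` as a subalgebra. -/
def nonpos (ρ : ℝ) [Fact (1 < ρ)] : Subalgebra ℂ (W ρ) where
  carrier := {f | ∀ i > 0, f.coeff i = 0}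
  mul_mem' {f g} hf hg i hi := by
    rw [coeff_mul]
    refine (tsum_congr fun k => ?_).trans tsum_zero
    rcases lt_or_ge 0 k with hk | hk
    · rw [hf k hk, zero_mul]
    · rw [hg (i - k) (by omega), mul_zero]
  add_mem' {f g} hf hg i hi := by rw [coeff_add, hf i hi, hg i hi, add_zero]
  algebraMap_mem' k i hi := by
    rw [Algebra.algebraMap_eq_smul_one, coeff_smul, coeff_one, if_neg hi.ne', mul_zero]

theorem mem_nonneg {f : W ρ} : f ∈ nonneg ρ ↔ ∀ i < 0, f.coeff i = 0 := Iff.rfl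

theorem mem_nonpos {f : W ρ} : f ∈ nonpos ρ ↔ ∀ i > 0, f.coeff i = 0 := Iff.rfl

theorem isClosed_nonneg : IsClosed (nonneg ρ : Set (W ρ)) := by
  have : (nonneg ρ : Set (W ρ)) = ⋂ i : {i : ℤ // i < 0}, (coeffCLM (ρ := ρ) i) ⁻¹' {0} := by
    ext f; simp [mem_nonneg]
  rw [this]
  exact isClosed_iInter fun i => isClosed_singleton.preimage (coeffCLM _).continuous

theorem isClosed_nonpos : IsClosed (nonpos ρ : Set (W ρ)) := by
  have : (nonpos ρ : Set (W ρ)) = ⋂ i : {i : ℤ // 0 < i}, (coeffCLM (ρ := ρ) i) ⁻¹' {0} := by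
    ext f; simp [mem_nonpos]
  rw [this]
  exact isClosed_iInter fun i => isClosed_singleton.preimage (coeffCLM _).continuous

theorem adj_mem_nonneg {f : W ρ} (hf : f ∈ nonpos ρ) : f.adj ∈ nonneg ρ := fun i hi => by
  rw [coeff_adj, hf (-i) (by omega), map_zero]

theorem adj_mem_nonpos {f : W ρ} (hf : f ∈ nonneg ρ) : f.adj ∈ nonpos ρ := fun i hi => by
  rw [coeff_adj, hf (-i) (by omega), map_zero]

theorem bar_mem_nonneg {f : W ρ} (hf : f ∈ nonneg ρ) : f.bar ∈ nonneg ρ := fun i hi => by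
  rw [coeff_bar, hf i hi, map_zero]

/-- `d = λ^n p q` with `p` a unit of `𝒲^{≥ 0}` and `q` a unit of `𝒲^{≤ 0}`. -/
def Factorable (d : W ρ) : Prop :=
  ∃ (n : ℤ) (p p' q q' : W ρ), p ∈ nonneg ρ ∧ p' ∈ nonneg ρ ∧ q ∈ nonpos ρ ∧ q' ∈ nonpos ρ ∧
    p * p' = 1 ∧ q * q' = 1 ∧ d = monomial n * (p * q)

theorem Factorable.mul {d e : W ρ} (hd : Factorable d) (he : Factorable e) :
    Factorable (d * e) := by
  obtain ⟨n, p, p', q, q', hp, hp', hq, hq', hpp, hqq, rfl⟩ := hd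
  obtain ⟨m, r, r', s, s', hr, hr', hs, hs', hrr, hss, rfl⟩ := he
  refine ⟨n + m, p * r, p' * r', q * s, q' * s', mul_mem hp hr, mul_mem hp' hr', mul_mem hq hs,
    mul_mem hq' hs', ?_, ?_, ?_⟩
  · rw [mul_mul_mul_comm, hpp, hrr, one_mul]
  · rw [mul_mul_mul_comm, hqq, hss, one_mul]
  · rw [← monomial_mul_monomial]; ring

theorem Factorable.inv {d e : W ρ} (hd : Factorable d) (hde : d * e = 1) : Factorable e := by
  obtain ⟨n, p, p', q, q', hp, hp', hq, hq', hpp, hqq, rfl⟩ := hd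
  refine ⟨-n, p', p, q', q, hp', hp, hq', hq, by rw [mul_comm, hpp], by rw [mul_comm, hqq], ?_⟩
  have h1 : monomial n * (p * q) * (monomial (-n) * (p' * q')) = 1 := by
    have : (monomial n : W ρ) * monomial (-n) = 1 := by
      rw [monomial_mul_monomial, add_neg_cancel, monomial_zero]
    calc _ = (monomial n * monomial (-n)) * (p * p') * (q * q') := by ring
      _ = 1 := by rw [this, hpp, hqq, one_mul, one_mul]
  calc e = monomial n * (p * q) * (monomial (-n) * (p' * q')) * e := by rw [h1, one_mul]
    _ = (monomial n * (p * q) * e) * (monomial (-n) * (p' * q')) := by ring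
    _ = _ := by rw [hde, one_mul]

theorem Factorable.of_nonneg {p p' : W ρ} (hp : p ∈ nonneg ρ) (hp' : p' ∈ nonneg ρ)
    (h : p * p' = 1) : Factorable p :=
  ⟨0, p, p', 1, 1, hp, hp', one_mem _, one_mem _, h, one_mul _, by
    rw [monomial_zero, one_mul, mul_one]⟩

theorem Factorable.of_nonpos {q q' : W ρ} (hq : q ∈ nonpos ρ) (hq' : q' ∈ nonpos ρ)
    (h : q * q' = 1) : Factorable q :=
  ⟨0, 1, 1, q, q', one_mem _, one_mem _, hq, hq', one_mul _, h, by
    rw [monomial_zero, one_mul, one_mul]⟩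

theorem Factorable.monomial (n : ℤ) : Factorable (W.monomial n : W ρ) :=
  ⟨n, 1, 1, 1, 1, one_mem _, one_mem _, one_mem _, one_mem _, one_mul _, one_mul _, by
    rw [one_mul, mul_one]⟩

theorem Factorable.const {k : ℂ} (hk : k ≠ 0) : Factorable (algebraMap ℂ (W ρ) k) :=
  Factorable.of_nonneg (p' := algebraMap ℂ (W ρ) k⁻¹) (Subalgebra.algebraMap_mem _ _)
    (Subalgebra.algebraMap_mem _ _) (by rw [← map_mul, mul_inv_cancel₀ hk, map_one])

/-- Used for both `x` and `-x`, so that `exp x` is a unit of the subalgebra and not merely of `𝒲`.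
-/
theorem exp_mem_of_isClosed {s : Subalgebra ℂ (W ρ)} (hs : IsClosed (s : Set (W ρ))) {x : W ρ}
    (hx : x ∈ s) : NormedSpace.exp x ∈ s := by
  rw [NormedSpace.exp_eq_tsum ℂ]
  have := (NormedSpace.expSeries_summable' (𝕂 := ℂ) x).hasSum
  exact hs.mem_of_tendsto this (Eventually.of_forall fun t =>
    sum_mem fun n _ => s.smul_mem (pow_mem hx n) _)

/-- The exponential covers a neighbourhood of `1`, because its derivative at `0` is the identity.
Splitting the exponent into its nonnegative and negative Fourier parts splits the exponential, as
`𝒲` is commutative. -/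
theorem eventually_factorable : ∀ᶠ x in 𝓝 (1 : W ρ), Factorable x := by
  let : NormedAlgebra ℚ (W ρ) := NormedAlgebra.restrictScalars ℚ ℂ (W ρ)
  have h := (hasStrictFDerivAt_exp_zero (𝕂 := ℂ) (𝔸 := W ρ)).map_nhds_eq_of_surj
    (LinearMap.range_eq_top.2 Function.surjective_id)
  rw [NormedSpace.exp_zero] at h
  rw [← h, eventually_map]
  refine Eventually.of_forall fun y => ?_
  have hy : y = trunc (Set.Ici 0) y + trunc (Set.Iio 0) y := by
    ext i
    rcases lt_or_ge i 0 with hi | hi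
    · simp [coeff_trunc, hi]
    · simp [coeff_trunc, hi]
  rw [hy, NormedSpace.exp_add]
  have inv : ∀ u : W ρ, NormedSpace.exp u * NormedSpace.exp (-u) = 1 := fun u => by
    rw [← NormedSpace.exp_add, add_neg_cancel, NormedSpace.exp_zero]
  have h1 : trunc (Set.Ici 0) y ∈ nonneg ρ := fun i hi =>
    coeff_trunc_of_notMem (by simpa using hi) y
  have h2 : trunc (Set.Iio 0) y ∈ nonpos ρ := fun i hi =>
    coeff_trunc_of_notMem (by simpa using hi.le) y
  exact (Factorable.of_nonneg (exp_mem_of_isClosed isClosed_nonneg h1)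
    (exp_mem_of_isClosed isClosed_nonneg (neg_mem h1)) (inv _)).mul
    (Factorable.of_nonpos (exp_mem_of_isClosed isClosed_nonpos h2)
      (exp_mem_of_isClosed isClosed_nonpos (neg_mem h2)) (inv _))

theorem exists_inv_one_sub {s : Subalgebra ℂ (W ρ)} (hs : IsClosed (s : Set (W ρ))) {x : W ρ}
    (hx : x ∈ s) (h1 : ‖x‖ < 1) : ∃ y ∈ s, (1 - x) * y = 1 :=
  ⟨∑' i : ℕ, x ^ i, hs.mem_of_tendsto (summable_geometric_of_norm_lt_one h1).hasSum
    (Eventually.of_forall fun _ => sum_mem fun n _ => pow_mem hx n), mul_neg_geom_series x h1⟩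

theorem monomial_mem_nonneg {n : ℤ} (hn : 0 ≤ n) : (monomial n : W ρ) ∈ nonneg ρ :=
  fun i hi => by rw [coeff_monomial, if_neg (by omega)]

theorem monomial_mem_nonpos {n : ℤ} (hn : n ≤ 0) : (monomial n : W ρ) ∈ nonpos ρ :=
  fun i hi => by rw [coeff_monomial, if_neg (by omega)]

/-- Write `λ - a` as `λ(1 - aλ⁻¹)` if `|a| < ρ⁻¹` and as `-a(1 - a⁻¹λ)` if `|a| > ρ`. In both cases
the Neumann series of the bracket stays on one side of the Fourier expansion. -/
theorem Factorable.linear {a : ℂ} (ha : ¬ InAnnulus ρ a) :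
    Factorable (W.monomial 1 - algebraMap ℂ (W ρ) a) := by
  rcases eq_or_ne a 0 with rfl | h0
  · simpa using Factorable.monomial (ρ := ρ) 1
  have hρ0 : 0 < ρ := one_pos.trans hρ.out
  by_cases h1 : ‖a‖ ≤ ρ
  · have h2 : ρ < ‖a‖⁻¹ := not_le.1 fun h => ha ⟨h1, h, h0⟩
    have hx : a • (W.monomial (-1) : W ρ) ∈ nonpos ρ :=
      Subalgebra.smul_mem _ (monomial_mem_nonpos (by omega)) _
    obtain ⟨y, hy, hxy⟩ := exists_inv_one_sub isClosed_nonpos hx (by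
      rw [norm_smul, norm_monomial]
      have := (lt_inv_comm₀ hρ0 (norm_pos_iff.2 h0)).1 h2
      calc ‖a‖ * ρ ^ (-1 : ℤ).natAbs = ‖a‖ * ρ := by simp
        _ < ρ⁻¹ * ρ := mul_lt_mul_of_pos_right this hρ0
        _ = 1 := inv_mul_cancel₀ hρ0.ne')
    have := (Factorable.monomial (ρ := ρ) 1).mul
      (Factorable.of_nonpos (sub_mem (one_mem _) hx) hy hxy)
    convert this using 1
    rw [mul_sub, mul_smul_comm, monomial_mul_monomial, mul_one, Algebra.algebraMap_eq_smul_one]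
    rfl
  · rw [not_le] at h1
    have hx : a⁻¹ • (W.monomial 1 : W ρ) ∈ nonneg ρ :=
      Subalgebra.smul_mem _ (monomial_mem_nonneg (by omega)) _
    obtain ⟨y, hy, hxy⟩ := exists_inv_one_sub isClosed_nonneg hx (by
      rw [norm_smul, norm_monomial, norm_inv]
      simpa using (inv_mul_lt_one₀ (norm_pos_iff.2 h0)).2 h1)
    have := (Factorable.const (ρ := ρ) (neg_ne_zero.2 h0)).mul
      (Factorable.of_nonneg (sub_mem (one_mem _) hx) hy hxy)
    convert this using 1
    rw [mul_sub, mul_one, Algebra.algebraMap_eq_smul_one, Algebra.algebraMap_eq_smul_one,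
      smul_mul_assoc, one_mul, smul_smul, neg_mul, mul_inv_cancel₀ h0]
    module

theorem Factorable.aeval {P : Polynomial ℂ} (hP : P ≠ 0)
    (h : ∀ a, P.IsRoot a → ¬ InAnnulus ρ a) :
    Factorable (Polynomial.aeval (W.monomial 1 : W ρ) P) := by
  have h1 := (IsAlgClosed.splits P).eq_prod_roots
  have h2 : ∀ s : Multiset ℂ, (∀ a ∈ s, ¬ InAnnulus ρ a) → Factorable
      (Polynomial.aeval (W.monomial 1 : W ρ)
        (s.map fun a => Polynomial.X - Polynomial.C a).prod) := by
    intro s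
    induction s using Multiset.induction with
    | empty => intro _; simpa [monomial_zero] using Factorable.monomial (ρ := ρ) 0
    | cons a s ih =>
      intro hs
      rw [Multiset.map_cons, Multiset.prod_cons, map_mul]
      refine Factorable.mul ?_ (ih fun b hb => hs b (Multiset.mem_cons_of_mem hb))
      simpa using Factorable.linear (hs a (Multiset.mem_cons_self a s))
  rw [h1, map_mul]
  refine Factorable.mul ?_ (h2 _ fun a ha => h a (Polynomial.isRoot_of_mem_roots ha))
  simpa using Factorable.const (ρ := ρ) (Polynomial.leadingCoeff_ne_zero.2 hP)

/-- A Laurent polynomial `q` close to `d` is again a unit, so its roots avoid the annulus and it is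
a product of factorable linear terms. The correction `d q⁻¹` is the inverse of `e q`, which is close
to `1` and hence factorable. -/
theorem factorable_of_mul_eq_one {d e : W ρ} (hde : d * e = 1) : Factorable d := by
  have hs : Tendsto (fun s : Finset ℤ => e * ∑ i ∈ s, d.coeff i • (monomial i : W ρ)) atTop
      (𝓝 1) := by
    have := (tendsto_const_nhds (x := e)).mul d.hasSum_monomial
    rwa [mul_comm e d, hde] at this
  have hu : ∀ᶠ x in 𝓝 (1 : W ρ), IsUnit x := Units.isOpen.mem_nhds isUnit_one
  obtain ⟨s, hs1, hs2⟩ := ((hs.eventually eventually_factorable).and (hs.eventually hu)).exists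
  set q : W ρ := ∑ i ∈ s, d.coeff i • (monomial i : W ρ) with hq
  obtain ⟨m, hm⟩ : ∃ m : ℕ, ∀ i ∈ s, 0 ≤ i + m := by
    obtain ⟨b, hb⟩ := s.bddBelow
    exact ⟨b.natAbs, fun i hi => by have := hb hi; omega⟩
  -- Multiplying `q` by `λ^m` clears its negative exponents.
  let P : Polynomial ℂ := ∑ i ∈ s, Polynomial.C (d.coeff i) * Polynomial.X ^ (i + m).toNat
  have hpow : ∀ n : ℕ, (monomial 1 : W ρ) ^ n = monomial n := fun n => by
    induction n with
    | zero => simp [monomial_zero]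
    | succ n ih => rw [pow_succ, ih, monomial_mul_monomial]; rfl
  have hPq : Polynomial.aeval (monomial 1 : W ρ) P = monomial m * q := by
    simp only [P, map_sum, map_mul, Polynomial.aeval_C, map_pow, Polynomial.aeval_X, hq,
      Finset.mul_sum, hpow]
    refine Finset.sum_congr rfl fun i hi => ?_
    rw [mul_smul_comm, monomial_mul_monomial, Int.toNat_of_nonneg (hm i hi),
      Algebra.algebraMap_eq_smul_one, smul_mul_assoc, one_mul, add_comm]
  obtain ⟨v, hv⟩ := hs2.exists_right_inv
  have hqv : q * (e * v) = 1 := by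
    rw [← mul_assoc, mul_comm q e, hv]
  have hPi : Polynomial.aeval (monomial 1 : W ρ) P * (monomial (-m) * (e * v)) = 1 := by
    rw [hPq, mul_mul_mul_comm, hqv, monomial_mul_monomial, add_neg_cancel, monomial_zero, one_mul]
  have heval : ∀ (a : ℂ), InAnnulus ρ a →
      (Polynomial.aeval (monomial 1 : W ρ) P).eval a = P.eval a := fun a ha => by
    have : Polynomial.aeval (monomial 1 : W ρ) P =
        ∑ i ∈ s, d.coeff i • (monomial ((i + m).toNat : ℤ) : W ρ) := by
      simp only [P, map_sum, map_mul, Polynomial.aeval_C, map_pow, Polynomial.aeval_X, hpow,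
        Algebra.algebraMap_eq_smul_one, smul_mul_assoc, one_mul]
    rw [this, ← evalCLM_apply a ha, map_sum]
    simp only [map_smul, evalCLM_apply, eval_monomial, smul_eq_mul, zpow_natCast, P,
      Polynomial.eval_finsetSum, Polynomial.eval_mul, Polynomial.eval_C, Polynomial.eval_pow,
      Polynomial.eval_X]
  have hroot : ∀ a, P.IsRoot a → ¬ InAnnulus ρ a := fun a h0 ha => by
    have := congrArg (fun x : W ρ => x.eval a) hPi
    simp only [eval_mul ha, heval a ha, h0.eq_zero, zero_mul, eval_one] at this
    exact zero_ne_one this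
  have hP0 : P ≠ 0 := by
    rintro h0
    exact hroot 1 (by simp [h0]) (inAnnulus_of_norm_eq_one (by simp))
  have hqf : Factorable q := by
    have := (Factorable.monomial (ρ := ρ) (-m)).mul (Factorable.aeval hP0 hroot)
    rwa [hPq, ← mul_assoc, monomial_mul_monomial, neg_add_cancel, monomial_zero, one_mul] at this
  have h3 : d = q * v := by
    calc d = d * (e * q * v) := by rw [hv, mul_one]
      _ = (d * e) * q * v := by ring
      _ = _ := by rw [hde, one_mul]
  exact h3 ▸ hqf.mul (hs1.inv hv)

/-- The positive loop `d d^*` is `h h^*` for a unit `h` of `𝒲^{≥ 0}`. -/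
theorem exists_factorization {d e : W ρ} (hde : d * e = 1) :
    ∃ h h' : W ρ, h ∈ nonneg ρ ∧ h' ∈ nonneg ρ ∧ h * h' = 1 ∧ d * d.adj = h * h.adj := by
  obtain ⟨n, p, p', q, q', hp, hp', hq, hq', hpp, hqq, rfl⟩ := factorable_of_mul_eq_one hde
  -- The adjoint exchanges `𝒲^{≥0}` and `𝒲^{≤0}`, so `h = p q^*` is a unit of `𝒲^{≥0}`. In `d d^*`
  -- the powers `λ^n` and `λ^{-n}` cancel.
  refine ⟨p * q.adj, p' * q'.adj, mul_mem hp (adj_mem_nonneg hq), mul_mem hp' (adj_mem_nonneg hq'),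
    ?_, ?_⟩
  · rw [mul_mul_mul_comm, hpp, ← adj_mul, hqq, adj_one, one_mul]
  · have : (monomial n : W ρ) * monomial (-n) = 1 := by
      rw [monomial_mul_monomial, add_neg_cancel, monomial_zero]
    rw [adj_mul, adj_mul, adj_mul, adj_adj, adj_monomial]
    calc _ = (monomial n * monomial (-n)) * (p * q.adj * (p.adj * q)) := by ring
      _ = _ := by rw [this, one_mul]

end W

/-! ### Conditions at the Sym-points -/

namespace W

variable {ρ : ℝ} [hρ : Fact (1 < ρ)]

/-- A pair of continuous functionals on `𝒲` whose kernel is an ideal not containing any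
nonzero element of `span {λ, λ²}`. -/
structure IsSymFunctional (E : W ρ →L[ℂ] ℂ × ℂ) : Prop where
  exists_mul : ∀ u, ∃ m : ℂ × ℂ →L[ℂ] ℂ × ℂ, ∀ x, E (x * u) = m (E x)
  injective : ∀ a b : ℂ, a • E (monomial 1) + b • E (monomial 2) = 0 → a = 0 ∧ b = 0

/-- Otherwise the kernel, being an ideal, would contain `λ`. -/
theorem IsSymFunctional.apply_one_ne_zero {E : W ρ →L[ℂ] ℂ × ℂ} (hE : IsSymFunctional E) :
    E 1 ≠ 0 := fun h => by
  obtain ⟨m, hm⟩ := hE.exists_mul (monomial 1)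
  have h1 := hm 1
  rw [one_mul, h, map_zero] at h1
  exact one_ne_zero (hE.injective 1 0 (by simp [h1])).1

theorem inAnnulus_of_mem {μ : ℂ} (h1 : ρ⁻¹ < ‖μ‖) (h2 : ‖μ‖ < ρ) : InAnnulus ρ μ := by
  have hρ0 : 0 < ρ := one_pos.trans hρ.out
  refine ⟨h2.le, ?_, ?_⟩
  · exact inv_le_of_inv_le₀ hρ0 h1.le
  · rintro rfl
    rw [norm_zero] at h1
    exact absurd h1 (not_lt.2 (inv_nonneg.2 hρ0.le))

/-- The open annulus `ρ⁻¹ < |μ| < ρ`. -/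
def openAnnulus (ρ : ℝ) : Set ℂ := {μ | ρ⁻¹ < ‖μ‖ ∧ ‖μ‖ < ρ}

theorem isOpen_openAnnulus : IsOpen (openAnnulus ρ) :=
  (isOpen_lt continuous_const continuous_norm).inter (isOpen_lt continuous_norm continuous_const)

theorem differentiableOn_eval (f : W ρ) : DifferentiableOn ℂ (fun μ => f.eval μ)
    (openAnnulus ρ) := by
  refine Complex.differentiableOn_tsum_of_summable_norm f.summable (fun i μ hμ => ?_)
    isOpen_openAnnulus fun i μ hμ => ?_
  · have : μ ≠ 0 := (inAnnulus_of_mem hμ.1 hμ.2).2.2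
    exact ((differentiableAt_zpow.2 (Or.inl this)).const_mul _).differentiableWithinAt
  · rw [norm_mul]
    exact mul_le_mul_of_nonneg_left (norm_zpow_le_weight (inAnnulus_of_mem hμ.1 hμ.2) i)
      (norm_nonneg _)

theorem one_mem_openAnnulus : (1 : ℂ) ∈ openAnnulus ρ := by
  simpa [openAnnulus] using ⟨inv_lt_one_of_one_lt₀ hρ.out, hρ.out⟩

theorem differentiableAt_eval_one (f : W ρ) : DifferentiableAt ℂ (fun μ => f.eval μ) 1 :=
  f.differentiableOn_eval.differentiableAt (isOpen_openAnnulus.mem_nhds one_mem_openAnnulus)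

theorem eventually_inAnnulus : ∀ᶠ μ in 𝓝 (1 : ℂ), InAnnulus ρ μ := by
  filter_upwards [isOpen_openAnnulus.mem_nhds (one_mem_openAnnulus (ρ := ρ))] with μ hμ
  exact inAnnulus_of_mem hμ.1 hμ.2

/-- The functional `f ↦ f'(1)`. -/
theorem exists_derivCLM : ∃ L : W ρ →L[ℂ] ℂ, ∀ f, L f = deriv (fun μ => f.eval μ) 1 := by
  obtain ⟨r, hr, hr2⟩ := Metric.nhds_basis_closedBall.mem_iff.1
    (isOpen_openAnnulus.mem_nhds (one_mem_openAnnulus (ρ := ρ)))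
  refine ⟨LinearMap.mkContinuous
    { toFun := fun f => deriv (fun μ => f.eval μ) 1
      map_add' := fun f g => ?_
      map_smul' := fun k f => ?_ } r⁻¹ fun f => ?_, fun f => rfl⟩
  · rw [← deriv_add f.differentiableAt_eval_one g.differentiableAt_eval_one]
    refine Filter.EventuallyEq.deriv_eq ?_
    filter_upwards [eventually_inAnnulus (ρ := ρ)] with μ hμ
    exact map_add (evalCLM μ hμ) f g
  · rw [RingHom.id_apply, smul_eq_mul, ← deriv_const_mul_field]
    refine Filter.EventuallyEq.deriv_eq ?_
    filter_upwards [eventually_inAnnulus (ρ := ρ)] with μ hμ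
    exact map_smul (evalCLM μ hμ) k f
  -- Cauchy's estimate on a circle inside the annulus, where evaluation has norm at most `1`.
  · have := Complex.norm_deriv_le_of_forall_mem_sphere_norm_le (C := ‖f‖) hr
      (f.differentiableOn_eval.diffContOnCl_ball hr2) fun z hz => by
        have hz := hr2 (Metric.sphere_subset_closedBall hz)
        have := (evalCLM (ρ := ρ) z (inAnnulus_of_mem hz.1 hz.2)).le_of_opNorm_le
          (LinearMap.mkContinuous_norm_le _ zero_le_one _) f
        simpa using this
    rw [div_eq_inv_mul] at this
    exact this

theorem isSymFunctional_prod {a b : ℂ} (ha : InAnnulus ρ a) (hb : InAnnulus ρ b) (hab : a ≠ b) :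
    IsSymFunctional ((evalCLM (ρ := ρ) a ha).prod (evalCLM b hb)) where
  exists_mul u := by
    refine ⟨(u.eval a • ContinuousLinearMap.fst ℂ ℂ ℂ).prod
      (u.eval b • ContinuousLinearMap.snd ℂ ℂ ℂ), fun x => ?_⟩
    simp [eval_mul ha, eval_mul hb, mul_comm]
  injective x y h := by
    simp only [ContinuousLinearMap.prod_apply, evalCLM_apply, eval_monomial, Prod.smul_mk,
      smul_eq_mul, Prod.mk_add_mk, Prod.mk_eq_zero] at h
    obtain ⟨h1, h2⟩ := h
    have ha0 := ha.2.2
    have hb0 := hb.2.2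
    have h1' : x + y * a = 0 := by
      refine (mul_eq_zero.1 (?_ : a * (x + y * a) = 0)).resolve_left ha0
      rw [← h1]; norm_cast; ring
    have h2' : x + y * b = 0 := by
      refine (mul_eq_zero.1 (?_ : b * (x + y * b) = 0)).resolve_left hb0
      rw [← h2]; norm_cast; ring
    have h3 : y = 0 := by
      refine (mul_eq_zero.1 (?_ : (a - b) * y = 0)).resolve_left (sub_ne_zero.2 hab)
      linear_combination h1' - h2'
    exact ⟨by simpa [h3] using h1', h3⟩

/-- The conditions of the Monodromy Problem at the Sym-points. -/
theorem exists_symFunctional (S : SpaceForm ρ) : ∃ E : W ρ →L[ℂ] ℂ × ℂ, IsSymFunctional E ∧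
    ∀ M : SL(2, W ρ), MonodromyProblem S M →
      (∀ i j, E (M.1 i j) = E ((1 : Matrix (Fin 2) (Fin 2) (W ρ)) i j)) ∨
      (∀ i j, E (M.1 i j) = -E ((1 : Matrix (Fin 2) (Fin 2) (W ρ)) i j)) := by
  have hone : ∀ (μ : ℂ) (i j : Fin 2), ((1 : Matrix (Fin 2) (Fin 2) (W ρ)) i j).eval μ =
      (1 : Matrix (Fin 2) (Fin 2) ℂ) i j := fun μ i j => by
    rcases eq_or_ne i j with rfl | h
    · simp [eval_one]
    · simp [h, eval]
  have hsym : ∀ a b : ℂ, InAnnulus ρ a → InAnnulus ρ b → a ≠ b →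
      ∃ E : W ρ →L[ℂ] ℂ × ℂ, IsSymFunctional E ∧ ∀ M : SL(2, W ρ), MonodromyProblemSym a b M →
      (∀ i j, E (M.1 i j) = E ((1 : Matrix (Fin 2) (Fin 2) (W ρ)) i j)) ∨
      (∀ i j, E (M.1 i j) = -E ((1 : Matrix (Fin 2) (Fin 2) (W ρ)) i j)) := by
    intro a b ha hb hab
    refine ⟨_, isSymFunctional_prod ha hb hab, fun M hM => hM.2.imp (fun h i j => ?_)
      (fun h i j => ?_)⟩
    · have h1 := congrFun₂ h.1 i j
      have h2 := congrFun₂ h.2 i j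
      simp only [evalMatrix, Matrix.map_apply] at h1 h2
      simp [h1, h2, hone]
    · have h1 := congrFun₂ h.1 i j
      have h2 := congrFun₂ h.2 i j
      simp only [evalMatrix, Matrix.map_apply] at h1 h2
      simp [h1, h2, hone]
  cases S with
  | euclidean =>
    obtain ⟨L, hL⟩ := exists_derivCLM (ρ := ρ)
    have h1 : InAnnulus ρ 1 := inAnnulus_of_norm_eq_one (by simp)
    refine ⟨(evalCLM 1 h1).prod L, ⟨fun u => ?_, fun a b h => ?_⟩, fun M hM => ?_⟩
    -- By the product rule, multiplication by `u` acts linearly on the pair of value and derivative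
    -- at `1`.
    · refine ⟨(u.eval 1 • ContinuousLinearMap.fst ℂ ℂ ℂ).prod
        (u.eval 1 • ContinuousLinearMap.snd ℂ ℂ ℂ + L u • ContinuousLinearMap.fst ℂ ℂ ℂ),
        fun x => ?_⟩
      have : L (x * u) = L x * u.eval 1 + x.eval 1 * L u := by
        rw [hL, hL, hL, ← deriv_fun_mul x.differentiableAt_eval_one u.differentiableAt_eval_one]
        refine Filter.EventuallyEq.deriv_eq ?_
        filter_upwards [eventually_inAnnulus (ρ := ρ)] with μ hμ
        exact eval_mul hμ x u
      rw [ContinuousLinearMap.prod_apply, this]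
      simp [eval_mul h1, mul_comm]
    · have hd : ∀ n : ℕ, L (monomial n) = n := fun n => by
        rw [hL]
        simp [eval_monomial]
      have e1 := hd 1
      have e2 := hd 2
      push_cast at e1 e2
      simp only [ContinuousLinearMap.prod_apply, evalCLM_apply, eval_monomial, Prod.smul_mk,
        smul_eq_mul, Prod.mk_add_mk, Prod.mk_eq_zero, one_zpow, e1, e2] at h
      obtain ⟨h2, h3⟩ := h
      have hb : b = 0 := by linear_combination h3 - h2
      exact ⟨by simpa [hb] using h2, hb⟩
    · have hd : ∀ i j, L ((1 : Matrix (Fin 2) (Fin 2) (W ρ)) i j) = 0 := fun i j => by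
        rw [hL]; simp [hone]
      obtain ⟨-, h2, h3⟩ := hM
      refine h2.imp (fun h i j => ?_) (fun h i j => ?_)
      · have h4 := congrFun₂ h i j
        simp only [evalMatrix, Matrix.map_apply] at h4
        simp [h4, hone, hL, h3]
      · have h4 := congrFun₂ h i j
        simp only [evalMatrix, Matrix.map_apply] at h4
        simp [h4, hone, hL, h3]
  | spherical θ h0 hπ =>
    refine hsym _ _ (inAnnulus_of_norm_eq_one (by rw [Complex.norm_exp]; simp))
      (inAnnulus_of_norm_eq_one (by rw [Complex.norm_exp]; simp)) fun h => ?_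
    have h2 := congrArg Complex.im h
    have h3 : Complex.exp (-(θ * Complex.I)) = Complex.exp ((-θ : ℝ) * Complex.I) := by
      push_cast; ring_nf
    rw [h3, Complex.exp_ofReal_mul_I_im, Complex.exp_ofReal_mul_I_im, Real.sin_neg] at h2
    have := Real.sin_pos_of_pos_of_lt_pi h0 hπ
    linarith
  | hyperbolic q h0 hq =>
    have hq1 : ‖Complex.exp q‖ = Real.exp q := by rw [Complex.norm_exp]; simp
    have hq2 : ‖Complex.exp (-q)‖ = (Real.exp q)⁻¹ := by
      rw [Complex.norm_exp]; simp [Real.exp_neg]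
    have h1 : 1 < Real.exp q := Real.one_lt_exp_iff.2 h0
    have hρ0 : 0 < ρ := one_pos.trans hρ.out
    have h2 : (Real.exp q)⁻¹ < 1 := inv_lt_one_of_one_lt₀ h1
    refine hsym _ _ (inAnnulus_of_mem ?_ ?_) (inAnnulus_of_mem ?_ ?_) fun h => ?_
    · rw [hq1]; exact (inv_lt_one_of_one_lt₀ hρ.out).trans h1
    · rwa [hq1]
    · rw [hq2]; exact inv_strictAnti₀ (Real.exp_pos q) hq
    · rw [hq2]; exact h2.trans hρ.out
    · have := congrArg norm h
      rw [hq1, hq2] at this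
      linarith

/-! ### Asymptotics of the linearized Monodromy Problem. -/

open Asymptotics

theorem isLittleO_adj {ι F : Type*} [NormedAddCommGroup F] {l : Filter ι} {f : ι → W ρ}
    {y : ι → F} (h : f =o[l] y) : (fun t => (f t).adj) =o[l] y :=
  IsLittleO.of_norm_left (by simpa using h.norm_left)

theorem isLittleO_clm {ι F G H : Type*} [NormedAddCommGroup F] [NormedAddCommGroup G]
    [NormedSpace ℂ G] [NormedAddCommGroup H] [NormedSpace ℂ H] {l : Filter ι} {f : ι → G}
    {y : ι → F} (L : G →L[ℂ] H) (h : f =o[l] y) : (fun t => L (f t)) =o[l] y :=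
  (L.isBigO_comp f l).trans_isLittleO h

theorem isLittleO_const_mul {ι F : Type*} [NormedAddCommGroup F] {l : Filter ι} {f : ι → W ρ}
    {y : ι → F} (u : W ρ) (h : f =o[l] y) : (fun t => u * f t) =o[l] y :=
  isLittleO_clm (ContinuousLinearMap.mul ℂ (W ρ) u) h

/-- A nonnegative family which is asymptotically self-adjoint and vanishes asymptotically at
the Sym-points is asymptotically zero. -/
theorem isLittleO_of_adj {ι F : Type*} [NormedAddCommGroup F] {l : Filter ι}
    {E : W ρ →L[ℂ] ℂ × ℂ} (hE : IsSymFunctional E) {x : ι → W ρ} {y : ι → F}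
    (hx : ∀ᶠ t in l, x t ∈ nonneg ρ) (h1 : (fun t => x t - (x t).adj) =o[l] y)
    (h2 : (fun t => E (x t)) =o[l] y) : x =o[l] y := by
  have hE1 := hE.apply_one_ne_zero
  -- The adjoint of an element of `𝒲^{≥0}` has no positive exponents, so `x` and `x - x^*` have the
  -- same positive part.
  have ht : (fun t => trunc (Set.Ioi 0) (x t)) =o[l] y := by
    refine (isLittleO_clm (trunc (Set.Ioi 0)) h1).congr' ?_ EventuallyEq.rfl
    filter_upwards [hx] with t ht
    ext i
    by_cases hi : 0 < i
    · rw [coeff_trunc_of_mem (Set.mem_Ioi.2 hi), coeff_trunc_of_mem (Set.mem_Ioi.2 hi), coeff_sub,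
        adj_mem_nonpos ht i hi, sub_zero]
    · rw [coeff_trunc_of_notMem (mt Set.mem_Ioi.1 hi), coeff_trunc_of_notMem (mt Set.mem_Ioi.1 hi)]
  have hdec : ∀ᶠ t in l, x t = trunc (Set.Ioi 0) (x t) + (x t).coeff 0 • 1 := by
    filter_upwards [hx] with t ht
    ext i
    rw [coeff_add, coeff_smul, coeff_one]
    rcases lt_trichotomy i 0 with hi | rfl | hi
    · rw [coeff_trunc_of_notMem (by simpa using hi.le), ht i hi, if_neg hi.ne]; simp
    · rw [coeff_trunc_of_notMem (by simp)]; simp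
    · rw [coeff_trunc_of_mem (Set.mem_Ioi.2 hi), if_neg hi.ne']; simp
  -- Up to `o(y)`, `E x` is `x_0 • E 1`, and `E 1 ≠ 0`.
  have hc : (fun t => (x t).coeff 0) =o[l] y := by
    have h3 := h2.sub (isLittleO_clm E ht)
    have h4 : (fun t => (x t).coeff 0 • E 1) =o[l] y := by
      refine h3.congr' ?_ EventuallyEq.rfl
      filter_upwards [hdec] with t ht
      nth_rewrite 1 [ht]
      rw [map_add, map_smul, add_sub_cancel_left]
    have h5 : (fun t => (x t).coeff 0) =O[l] fun t => (x t).coeff 0 • E 1 :=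
      IsBigO.of_bound ‖E 1‖⁻¹ (Eventually.of_forall fun t => by
        rw [norm_smul]
        field_simp [norm_ne_zero_iff.2 hE1]
        exact le_rfl)
    exact h5.trans_isLittleO h4
  have h6 := ht.add (isLittleO_clm ((ContinuousLinearMap.id ℂ ℂ).smulRight (1 : W ρ)) hc)
  refine h6.congr' ?_ EventuallyEq.rfl
  filter_upwards [hdec] with t ht
  exact ht.symm

/-- A family of `𝒲^{≥ 1}` which is asymptotically in `λ² 𝒲^{≤ 0}` and vanishes asymptotically at
the Sym-points is asymptotically zero. -/
theorem isLittleO_of_add {ι F : Type*} [NormedAddCommGroup F] {l : Filter ι}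
    {E : W ρ →L[ℂ] ℂ × ℂ} (hE : IsSymFunctional E) {x x' : ι → W ρ} {y : ι → F}
    (hx : ∀ᶠ t in l, ∀ i ≤ 0, (x t).coeff i = 0) (hx' : ∀ᶠ t in l, ∀ i > 2, (x' t).coeff i = 0)
    (h1 : (fun t => x t + x' t) =o[l] y) (h2 : (fun t => E (x t)) =o[l] y) : x =o[l] y := by
  -- Exponents above `2` occur in `x` only, so the sum controls them.
  have ht : (fun t => trunc (Set.Ioi 2) (x t)) =o[l] y := by
    refine (isLittleO_clm (trunc (Set.Ioi 2)) h1).congr' ?_ EventuallyEq.rfl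
    filter_upwards [hx'] with t ht
    ext i
    by_cases hi : 2 < i
    · rw [coeff_trunc_of_mem (Set.mem_Ioi.2 hi), coeff_trunc_of_mem (Set.mem_Ioi.2 hi), coeff_add, ht i hi, add_zero]
    · rw [coeff_trunc_of_notMem (mt Set.mem_Ioi.1 hi), coeff_trunc_of_notMem (mt Set.mem_Ioi.1 hi)]
  have hdec : ∀ᶠ t in l, x t = trunc (Set.Ioi 2) (x t) +
      ((x t).coeff 1 • monomial 1 + (x t).coeff 2 • monomial 2) := by
    filter_upwards [hx] with t ht
    ext i
    rw [coeff_add, coeff_add, coeff_smul, coeff_smul, coeff_monomial, coeff_monomial]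
    rcases lt_trichotomy i 2 with hi | rfl | hi
    · rw [coeff_trunc_of_notMem (by simpa using hi.le), if_neg hi.ne]
      split_ifs with h
      · subst h; simp
      · rw [ht i (by omega)]; simp
    · rw [coeff_trunc_of_notMem (by simp)]; simp
    · rw [coeff_trunc_of_mem (Set.mem_Ioi.2 hi), if_neg hi.ne', if_neg (by omega)]; simp
  -- `J (a, b) = E (aλ + bλ²)` is injective. A left inverse recovers the two remaining coefficients
  -- of `x` from its value under `E`.
  let J : ℂ × ℂ →L[ℂ] ℂ × ℂ :=
    (ContinuousLinearMap.fst ℂ ℂ ℂ).smulRight (E (monomial 1)) +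
      (ContinuousLinearMap.snd ℂ ℂ ℂ).smulRight (E (monomial 2))
  obtain ⟨K, hK⟩ := LinearMap.exists_leftInverse_of_injective (J : ℂ × ℂ →ₗ[ℂ] ℂ × ℂ)
    (LinearMap.ker_eq_bot'.2 fun c hc => by
      have := hE.injective c.1 c.2 hc
      exact Prod.ext this.1 this.2)
  have hc : (fun t => ((x t).coeff 1, (x t).coeff 2)) =o[l] y := by
    refine (isLittleO_clm K.toContinuousLinearMap (h2.sub (isLittleO_clm E ht))).congr' ?_
      EventuallyEq.rfl
    filter_upwards [hdec] with t ht
    have : E (x t) - E (trunc (Set.Ioi 2) (x t)) = J ((x t).coeff 1, (x t).coeff 2) := by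
      nth_rewrite 1 [ht]
      rw [map_add, add_sub_cancel_left, map_add, map_smul, map_smul]
      rfl
    rw [this]
    exact LinearMap.congr_fun hK _
  have h6 := ht.add (isLittleO_clm
    ((ContinuousLinearMap.fst ℂ ℂ ℂ).smulRight (monomial 1 : W ρ) +
      (ContinuousLinearMap.snd ℂ ℂ ℂ).smulRight (monomial 2 : W ρ)) hc)
  refine h6.congr' ?_ EventuallyEq.rfl
  filter_upwards [hdec] with t ht
  exact ht.symm

/-- The linearized Monodromy Problem at `ξ_0` has only the trivial solution, and so has any
problem asymptotic to it. Here `A`, `B` are the coefficients of `dz / z²` and `dz / z` in the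
singular entry, and `N` is the inverse of the monodromy. -/
theorem eventually_eq_zero_of_linearization {ι : Type*} {l : Filter ι} {E : W ρ →L[ℂ] ℂ × ℂ}
    (hE : IsSymFunctional E) {k κ : ℂ} (hk : k ≠ 0) (hκ : κ ≠ 0) (hκ' : conj κ = -κ) {d e : W ρ}
    (hde : d * e = 1) {A B : ι → W ρ} {N : ι → Matrix (Fin 2) (Fin 2) (W ρ)}
    (hA : ∀ᶠ t in l, A t ∈ nonneg ρ) (hB : ∀ᶠ t in l, B t ∈ nonneg ρ)
    (hB0 : ∀ᶠ t in l, (B t).coeff 0 = 0)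
    (hN1 : ∀ᶠ t in l, N t 1 1 = (N t 0 0).adj) (hN2 : ∀ᶠ t in l, N t 1 0 = -(N t 0 1).adj)
    (hE1 : ∀ᶠ t in l, E (N t 0 0) = E 1) (hE2 : ∀ᶠ t in l, E (N t 1 0) = 0)
    (h00 : (fun t => N t 0 0 - 1 + κ • (monomial (-1) * ((-k / 2) • (B t + (B t).bar))))
      =o[l] fun t => (A t, B t))
    (h01 : (fun t => N t 0 1 - κ • (d ^ 2 * (monomial (-2) *
      ((k ^ 2 / 4) • (B t - (B t).bar) - (2 * k ^ 2) • A t)))) =o[l] fun t => (A t, B t))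
    (h10 : (fun t => N t 1 0 + κ • (e ^ 2 * (B t - (B t).bar))) =o[l] fun t => (A t, B t))
    (h11 : (fun t => N t 1 1 - 1 - κ • (monomial (-1) * ((-k / 2) • (B t + (B t).bar))))
      =o[l] fun t => (A t, B t)) :
    ∀ᶠ t in l, A t = 0 ∧ B t = 0 := by
  set y : ι → W ρ × W ρ := fun t => (A t, B t) with hy
  set R₀ : ι → W ρ := fun t => B t - (B t).bar with hR₀
  set R₁ : ι → W ρ := fun t => (-k / 2) • (B t + (B t).bar) with hR₁
  set R₂ : ι → W ρ := fun t => (k ^ 2 / 4) • (B t - (B t).bar) - (2 * k ^ 2) • A t with hR₂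
  have smul_inv : ∀ {f : ι → W ρ}, (fun t => κ • f t) =o[l] y → f =o[l] y := fun {f} h => by
    refine (h.const_smul_left κ⁻¹).congr_left fun t => ?_
    simp [smul_smul, inv_mul_cancel₀ hκ]
  have smul_inv' : ∀ {f : ι → ℂ × ℂ}, (fun t => κ • f t) =o[l] y → f =o[l] y := fun {f} h => by
    refine (h.const_smul_left κ⁻¹).congr_left fun t => ?_
    simp [smul_smul, inv_mul_cancel₀ hκ]
  -- the diagonal entries
  have hx : (fun t => monomial (-1) * R₁ t) =o[l] y := by
    refine isLittleO_of_adj hE ?_ ?_ ?_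
    -- The factor `λ⁻¹` does no harm because `B_0 = 0`.
    · filter_upwards [hB, hB0] with t ht ht0 i hi
      rw [coeff_monomial_mul, hR₁, coeff_smul, coeff_add, coeff_bar]
      rcases eq_or_ne i (-1) with rfl | h
      · simp [ht0]
      · rw [ht (i - -1) (by omega)]; simp
    -- In the adjoint of the `(0,0)` estimate minus the `(1,1)` estimate, the entries of `N` cancel.
    -- Since `conj κ = -κ`, what is left is `κ (x - x^*)` with `x = λ⁻¹R₁`.
    · refine smul_inv (((isLittleO_adj h00).sub h11).congr' ?_ EventuallyEq.rfl)
      filter_upwards [hN1] with t ht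
      rw [ht]
      simp only [adj_add, adj_sub, adj_one, adj_smul κ, hκ', hR₁]
      module
    · refine smul_inv' ((isLittleO_clm E h00).congr' ?_ EventuallyEq.rfl)
      filter_upwards [hE1] with t ht
      rw [map_add, map_sub, ht, sub_self, zero_add, map_smul]
  have hR₁o : R₁ =o[l] y := (isLittleO_const_mul (monomial 1) hx).congr_left fun t => by
    simpa using monomial_mul_cancel (-1) (R₁ t)
  -- the off-diagonal entries
  obtain ⟨h, h', hh, hh', hhh, hd⟩ := exists_factorization hde
  -- Unitarity cancels the entries of `N` in the `(1,0)` estimate plus the adjoint of the `(0,1)`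
  -- estimate. The sign in `conj κ = -κ` lets `κ` factor out of the sum.
  have hoff : (fun t => e ^ 2 * R₀ t + d.adj ^ 2 * (monomial 2 * (R₂ t).adj)) =o[l] y := by
    refine smul_inv ((h10.add (isLittleO_adj h01)).congr' ?_ EventuallyEq.rfl)
    filter_upwards [hN2] with t ht
    rw [ht]
    simp only [hR₀, hR₂, adj_sub (N t 0 1), adj_smul κ, hκ', adj_mul, adj_monomial, pow_two,
      neg_neg]
    module
  -- Multiplication by `d² h'²` turns `e²` into `h'²` and, as `d d^* = h h^*`, turns `d^{*2}` into
  -- `h^{*2}`. The summands then lie in `λ𝒲^{≥0}` and `λ²𝒲^{≤0}`.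
  have hX : (fun t => h' ^ 2 * R₀ t) =o[l] y := by
    refine isLittleO_of_add hE (x' := fun t => h.adj ^ 2 * (monomial 2 * (R₂ t).adj)) ?_ ?_ ?_ ?_
    · filter_upwards [hB, hB0] with t ht ht0 i hi
      have h1 : monomial (-1) * R₀ t ∈ nonneg ρ := fun i hi => by
        rw [coeff_monomial_mul, hR₀, coeff_sub, coeff_bar]
        rcases eq_or_ne i (-1) with rfl | h
        · simp [ht0]
        · rw [ht (i - -1) (by omega)]; simp
      have h2 := mul_mem (pow_mem hh' 2) h1 (i - 1) (by omega)
      rw [mul_left_comm, coeff_monomial_mul] at h2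
      simpa using h2
    · filter_upwards [hA, hB] with t htA htB i hi
      have h1 : R₂ t ∈ nonneg ρ := sub_mem (Subalgebra.smul_mem _ (sub_mem htB (bar_mem_nonneg htB)) _)
        (Subalgebra.smul_mem _ htA _)
      have h2 := mul_mem (pow_mem (adj_mem_nonpos hh) 2) (adj_mem_nonpos h1) (i - 2) (by omega)
      rw [mul_left_comm, coeff_monomial_mul]
      exact h2
    · refine (isLittleO_const_mul (d ^ 2 * h' ^ 2) hoff).congr_left fun t => ?_
      have e1 : d ^ 2 * h' ^ 2 * (e ^ 2 * R₀ t) = (d * e) ^ 2 * (h' ^ 2 * R₀ t) := by ring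
      have e2 : d ^ 2 * h' ^ 2 * (d.adj ^ 2 * (monomial 2 * (R₂ t).adj)) =
        (d * d.adj) ^ 2 * h' ^ 2 * (monomial 2 * (R₂ t).adj) := by ring
      have e3 : (h * h.adj) ^ 2 * h' ^ 2 = (h * h') ^ 2 * h.adj ^ 2 := by ring
      rw [mul_add, e1, e2, hde, hd, e3, hhh, one_pow, one_mul, one_mul]
    -- The Sym-point condition is known for `e²R₀`. It passes to the multiple `h'²R₀` because the
    -- kernel of `E` is an ideal.
    · obtain ⟨m, hm⟩ := hE.exists_mul (d ^ 2 * h' ^ 2)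
      have h1 : (fun t => E (e ^ 2 * R₀ t)) =o[l] y := by
        refine smul_inv' ((isLittleO_clm E h10).congr' ?_ EventuallyEq.rfl)
        filter_upwards [hE2] with t ht
        rw [map_add, ht, zero_add, map_smul]
      refine (isLittleO_clm m h1).congr_left fun t => ?_
      rw [← hm]
      congr 1
      have : e ^ 2 * R₀ t * (d ^ 2 * h' ^ 2) = (d * e) ^ 2 * (h' ^ 2 * R₀ t) := by ring
      rw [this, hde, one_pow, one_mul]
  have hR₀o : R₀ =o[l] y := (isLittleO_const_mul (h ^ 2) hX).congr_left fun t => by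
    rw [← mul_assoc, ← mul_pow, hhh, one_pow, one_mul]
  have hR₂o : R₂ =o[l] y := by
    have h1 := hoff.sub (isLittleO_const_mul (e ^ 2) hR₀o)
    refine (isLittleO_adj (isLittleO_const_mul (e.adj ^ 2 * monomial (-2)) h1)).congr_left
      fun t => ?_
    have h2 : d.adj * e.adj = 1 := by rw [← adj_mul, hde, adj_one]
    have h3 : (monomial (-2) : W ρ) * monomial 2 = 1 := by
      rw [monomial_mul_monomial]; rfl
    have : e.adj ^ 2 * monomial (-2) * (d.adj ^ 2 * (monomial 2 * (R₂ t).adj)) =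
      (d.adj * e.adj) ^ 2 * (monomial (-2) * monomial 2) * (R₂ t).adj := by ring
    rw [add_sub_cancel_left, this, h2, h3, one_pow, one_mul, one_mul, adj_adj]
  -- conclusion
  have hBo : B =o[l] y := ((hR₀o.sub (hR₁o.const_smul_left (2 / k))).const_smul_left
    (1 / 2 : ℂ)).congr_left fun t => by
      simp only [hR₀, hR₁, smul_smul, Pi.smul_apply]
      have : 2 / k * (-k / 2) = -1 := by field_simp
      rw [this]; module
  have hAo : A =o[l] y := (((hR₀o.const_smul_left (k ^ 2 / 4)).sub hR₂o).const_smul_left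
    (1 / (2 * k ^ 2))).congr_left fun t => by
      simp only [hR₀, hR₂, Pi.smul_apply, sub_sub_cancel, smul_smul]
      have : 1 / (2 * k ^ 2) * (2 * k ^ 2) = 1 := by field_simp
      rw [this, one_smul]
  -- A family negligible with respect to itself is eventually zero.
  have hyo : y =o[l] y := hAo.prod_left hBo
  have h1 : ∀ᶠ t in l, y t = 0 := by
    by_contra hne
    exact isLittleO_irrefl (not_eventually.1 hne) hyo
  filter_upwards [h1] with t h0
  exact ⟨congrArg Prod.fst h0, congrArg Prod.snd h0⟩

end W

/-! ### Derivatives along a map into the plane -/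

section Along

variable {Z : Type*} [TopologicalSpace Z] {c : Z → ℂ}
  {E : Type*} [NormedAddCommGroup E] [NormedSpace ℂ E]

/-- Locally, `V` is a function of `c`, with derivative `V'`. -/
def HasDerivAlong (c : Z → ℂ) (V V' : Z → E) : Prop :=
  ∀ z, ∃ F : ℂ → E, ∀ᶠ y in 𝓝 z, V y = F (c y) ∧ HasDerivAt F (V' y) (c y)

namespace HasDerivAlong

variable {V V' U U' : Z → E}

theorem of_hasDerivAt {F F' : ℂ → E} (h : ∀ y, HasDerivAt F (F' (c y)) (c y)) :
    HasDerivAlong c (fun y => F (c y)) (fun y => F' (c y)) :=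
  fun _ => ⟨F, Eventually.of_forall fun y => ⟨rfl, h y⟩⟩

theorem congr (h : HasDerivAlong c V V') (hU : ∀ y, U y = V y) (hU' : ∀ y, U' y = V' y) :
    HasDerivAlong c U U' := by
  rwa [funext hU, funext hU']

theorem add (h : HasDerivAlong c V V') (h' : HasDerivAlong c U U') :
    HasDerivAlong c (fun y => V y + U y) (fun y => V' y + U' y) := fun z => by
  obtain ⟨F, hF⟩ := h z
  obtain ⟨G, hG⟩ := h' z
  refine ⟨fun w => F w + G w, ?_⟩
  filter_upwards [hF, hG] with y h1 h2
  exact ⟨by rw [h1.1, h2.1], h1.2.add h2.2⟩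

theorem clm {G : Type*} [NormedAddCommGroup G] [NormedSpace ℂ G] (h : HasDerivAlong c V V')
    (L : E →L[ℂ] G) : HasDerivAlong c (fun y => L (V y)) (fun y => L (V' y)) := fun z => by
  obtain ⟨F, hF⟩ := h z
  refine ⟨fun w => L (F w), ?_⟩
  filter_upwards [hF] with y h1
  exact ⟨by rw [h1.1], L.hasFDerivAt.comp_hasDerivAt _ h1.2⟩

theorem smul_const {v v' : Z → ℂ} (h : HasDerivAlong c v v') (a : E) :
    HasDerivAlong c (fun y => v y • a) (fun y => v' y • a) :=
  h.clm ((ContinuousLinearMap.id ℂ ℂ).smulRight a)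

theorem comp {Y : Type*} [TopologicalSpace Y] (h : HasDerivAlong c V V') {e : Y → Z}
    (he : Continuous e) :
    HasDerivAlong (fun y => c (e y)) (fun y => V (e y)) (fun y => V' (e y)) := fun z => by
  obtain ⟨F, hF⟩ := h (e z)
  exact ⟨F, he.continuousAt.eventually hF⟩

/-- Change of coordinate `c = φ ∘ b`. -/
theorem change {b : Z → ℂ} {φ φ' : ℂ → ℂ} (h : HasDerivAlong c V V') (hb : ∀ y, φ (b y) = c y)
    (hφ : ∀ y, HasDerivAt φ (φ' (b y)) (b y)) :
    HasDerivAlong b V (fun y => φ' (b y) • V' y) := fun z => by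
  obtain ⟨F, hF⟩ := h z
  refine ⟨F ∘ φ, ?_⟩
  filter_upwards [hF] with y h1
  refine ⟨by rw [h1.1, Function.comp_apply, hb], ?_⟩
  have h2 : HasDerivAt F (V' y) (φ (b y)) := by rw [hb]; exact h1.2
  exact h2.scomp _ (hφ y)

theorem continuous (h : HasDerivAlong c V V') (hc : Continuous c) : Continuous V := by
  refine continuous_iff_continuousAt.2 fun z => ?_
  obtain ⟨F, hF⟩ := h z
  have h1 : ContinuousAt (fun y => F (c y)) z :=
    ContinuousAt.comp (f := c) hF.self_of_nhds.2.continuousAt hc.continuousAt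
  exact h1.congr (hF.mono fun y hy => hy.1.symm)

/-- Since `c` is open, the local function of `c` has zero derivative on a full neighbourhood in the
plane, hence is constant on a ball. -/
theorem isLocallyConstant (h : HasDerivAlong c V fun _ => 0) (hc : IsOpenMap c)
    (hc' : Continuous c) : IsLocallyConstant V := by
  refine (IsLocallyConstant.iff_eventually_eq V).2 fun z => ?_
  obtain ⟨F, hF⟩ := h z
  have h1 : ∀ᶠ w in 𝓝 (c z), HasDerivAt F 0 w := by
    have := hc.nhds_le z
    refine this ?_
    rw [mem_map]
    exact hF.mono fun y hy => hy.2
  obtain ⟨r, hr, hr2⟩ := Metric.eventually_nhds_iff_ball.1 h1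
  filter_upwards [hF, hc'.continuousAt (Metric.ball_mem_nhds (c z) hr)] with y hy hyr
  have h2 := (convex_ball (c z) r).norm_image_sub_le_of_norm_hasDerivWithin_le (C := 0)
    (fun w hw => (hr2 w hw).hasDerivWithinAt) (fun w _ => by simp) (Metric.mem_ball_self hr) hyr
  rw [hy.1, hF.self_of_nhds.1]
  simpa [sub_eq_zero] using h2

variable {𝒜 : Type*} [NormedRing 𝒜] [NormedAlgebra ℂ 𝒜] {P P' Q Q' : Z → 𝒜}

theorem mul (h : HasDerivAlong c P P') (h' : HasDerivAlong c Q Q') :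
    HasDerivAlong c (fun y => P y * Q y) (fun y => P' y * Q y + P y * Q' y) := fun z => by
  obtain ⟨F, hF⟩ := h z
  obtain ⟨G, hG⟩ := h' z
  refine ⟨fun w => F w * G w, ?_⟩
  filter_upwards [hF, hG] with y h1 h2
  exact ⟨by rw [h1.1, h2.1], by rw [h1.1, h2.1]; exact h1.2.fun_mul h2.2⟩

theorem _root_.HasDerivAt.ringInverse [CompleteSpace 𝒜] {F : ℂ → 𝒜} {F' : 𝒜} {w : ℂ}
    (h : HasDerivAt F F' w) (hu : IsUnit (F w)) :
    HasDerivAt (fun w => Ring.inverse (F w)) (-(Ring.inverse (F w) * F' * Ring.inverse (F w))) w := by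
  obtain ⟨u, hu⟩ := hu
  have h1 := hasFDerivAt_ringInverse (𝕜 := ℂ) u
  rw [hu] at h1
  have h2 := h1.comp_hasDerivAt w h
  rw [← hu, Ring.inverse_unit]
  simpa [Function.comp_def] using h2

theorem ringInverse [CompleteSpace 𝒜] (h : HasDerivAlong c P P') (hP : ∀ y, IsUnit (P y)) :
    HasDerivAlong c (fun y => Ring.inverse (P y))
      (fun y => -(Ring.inverse (P y) * P' y * Ring.inverse (P y))) := fun z => by
  obtain ⟨F, hF⟩ := h z
  refine ⟨fun w => Ring.inverse (F w), ?_⟩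
  filter_upwards [hF] with y h1
  exact ⟨by rw [h1.1], by simpa [h1.1] using h1.2.ringInverse (h1.1 ▸ hP y)⟩

end HasDerivAlong

end Along

/-! ### A mean value inequality along a continuous path -/

section MeanValue

variable {E : Type*} [NormedAddCommGroup E] [NormedSpace ℂ E]

theorem norm_sub_le_of_hasDerivAlong_ball {δ : ℝ → ℂ} {r : ℝ} (hr : 0 < r) {c : ℝ × ℂ → ℂ}
    (hc : ∀ s, ∀ h ∈ Metric.ball (0 : ℂ) 1, c (s, h) = δ s + r * h) {V V' : ℝ × ℂ → E}
    (hV : HasDerivAlong c V V') {s C : ℝ}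
    (hC : ∀ h ∈ Metric.ball (0 : ℂ) 1, ‖V' (s, h)‖ ≤ C) {h : ℂ} (hh : h ∈ Metric.ball (0 : ℂ) 1) :
    ‖V (s, h) - V (s, 0)‖ ≤ r * C := by
  have h0 : (0 : ℂ) ∈ Metric.ball (0 : ℂ) 1 := Metric.mem_ball_self one_pos
  have hC0 : 0 ≤ C := (norm_nonneg _).trans (hC 0 h0)
  have hd : ∀ h ∈ Metric.ball (0 : ℂ) 1,
      HasDerivAt (fun h => V (s, h)) ((r : ℂ) • V' (s, h)) h := fun h hh => by
    obtain ⟨F, hF⟩ := hV (s, h)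
    have h1 : ∀ᶠ h' in 𝓝 h, V (s, h') = F (δ s + r * h') := by
      have : ContinuousAt (fun h' : ℂ => (s, h')) h := by fun_prop
      filter_upwards [this.eventually hF, Metric.isOpen_ball.mem_nhds hh] with h' h2 h3
      rw [h2.1, hc s h' h3]
    have h2 := hF.self_of_nhds.2
    rw [hc s h hh] at h2
    have h3 : HasDerivAt (fun h' : ℂ => δ s + r * h') (r : ℂ) h := by
      simpa using ((hasDerivAt_id h).const_mul (r : ℂ)).const_add (δ s)
    exact (h2.scomp h h3).congr_of_eventuallyEq h1
  have := (convex_ball (0 : ℂ) 1).norm_image_sub_le_of_norm_hasDerivWithin_le (C := r * C)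
    (fun h hh => (hd h hh).hasDerivWithinAt) (fun h hh => by
      rw [norm_smul, Complex.norm_real, Real.norm_of_nonneg hr.le]
      exact mul_le_mul_of_nonneg_left (hC h hh) hr.le) h0 hh
  refine this.trans ?_
  rw [sub_zero]
  exact mul_le_of_le_one_right (by positivity) (by simpa using (mem_ball_zero_iff.1 hh).le)

/-- For `u` between `s` and `s'`, the points `(u, (δ s' - δ u)/r)` all lie over `δ s'`. As `V`
factors locally through `c`, it is constant along them. A move along the curve is thus traded for a
straight segment in a single ball. -/
theorem apply_eq_of_hasDerivAlong {δ : ℝ → ℂ} (hδ : Continuous δ) {r : ℝ} (hr : 0 < r)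
    {c : ℝ × ℂ → ℂ} (hc : ∀ s, ∀ h ∈ Metric.ball (0 : ℂ) 1, c (s, h) = δ s + r * h)
    {V V' : ℝ × ℂ → E} (hV : HasDerivAlong c V V') {s s' : ℝ} (hs : s ≤ s')
    (hd : ∀ u ∈ Set.Icc s s', ‖δ s' - δ u‖ < r) :
    V (s', 0) = V (s, (δ s' - δ s) / r) := by
  have hr' : (r : ℂ) ≠ 0 := by exact_mod_cast hr.ne'
  have hmem : ∀ u ∈ Set.Icc s s', (δ s' - δ u) / r ∈ Metric.ball (0 : ℂ) 1 := fun u hu => by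
    rw [mem_ball_zero_iff, norm_div, Complex.norm_real, Real.norm_of_nonneg hr.le, div_lt_one hr]
    exact hd u hu
  have hcc : ∀ u ∈ Set.Icc s s', c (u, (δ s' - δ u) / r) = δ s' := fun u hu => by
    rw [hc u _ (hmem u hu)]; field_simp; ring
  let φ : Set.Icc s s' → E := fun u => V (u, (δ s' - δ u) / r)
  have hφ : IsLocallyConstant φ := by
    refine (IsLocallyConstant.iff_eventually_eq φ).2 fun u => ?_
    obtain ⟨F, hF⟩ := hV (u, (δ s' - δ u) / r)
    have h1 : ContinuousAt (fun v : Set.Icc s s' => ((v : ℝ), (δ s' - δ v) / (r : ℂ))) u := by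
      fun_prop
    filter_upwards [h1.eventually hF] with v hv
    simp only [φ]
    rw [hv.1, hF.self_of_nhds.1, hcc v v.2, hcc u u.2]
  have : PreconnectedSpace (Set.Icc s s') := Subtype.preconnectedSpace isPreconnected_Icc
  have h2 := hφ.apply_eq_of_preconnectedSpace ⟨s', Set.right_mem_Icc.2 hs⟩
    ⟨s, Set.left_mem_Icc.2 hs⟩
  simpa [φ] using h2

/-- The constant depends only on the path, although the path need not be rectifiable: `V` is a
function of the endpoint on balls of radius `r` around the points of the path. -/
theorem exists_norm_sub_le_of_hasDerivAlong {δ : ℝ → ℂ} (hδ : Continuous δ) {r : ℝ} (hr : 0 < r)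
    {c : ℝ × ℂ → ℂ} (hc : ∀ s, ∀ h ∈ Metric.ball (0 : ℂ) 1, c (s, h) = δ s + r * h) :
    ∃ K : ℝ, 0 ≤ K ∧ ∀ (V V' : ℝ × ℂ → E) (C : ℝ), HasDerivAlong c V V' →
      (∀ s ∈ Set.Icc (0 : ℝ) 1, ∀ h ∈ Metric.ball (0 : ℂ) 1, ‖V' (s, h)‖ ≤ C) →
      ∀ s ∈ Set.Icc (0 : ℝ) 1, ∀ h ∈ Metric.ball (0 : ℂ) 1,
        ‖V (s, h) - V (0, 0)‖ ≤ K * C := by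
  obtain ⟨η, hη, hη2⟩ := Metric.uniformContinuousOn_iff.1
    (isCompact_Icc.uniformContinuousOn_of_continuous (s := Set.Icc (0 : ℝ) 1) hδ.continuousOn) r hr
  obtain ⟨n, hn⟩ := exists_nat_gt η⁻¹
  have hn0 : (0 : ℝ) < n := (inv_pos.2 hη).trans hn
  have hnη : (1 : ℝ) / n < η := by
    rw [div_lt_iff₀ hn0]
    have := (inv_lt_iff_one_lt_mul₀ hη).1 hn
    linarith
  -- Each displacement within one ball costs at most `r C`. There are at most `n` grid steps, one
  -- step from the last grid point to `s`, and one from the centre `(s, 0)` to `(s, h)`.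
  refine ⟨(n + 2) * r, by positivity, fun V V' C hV hC => ?_⟩
  have hC0 : 0 ≤ C := (norm_nonneg _).trans
    (hC 0 ⟨le_rfl, zero_le_one⟩ 0 (Metric.mem_ball_self one_pos))
  have step : ∀ s s' : ℝ, 0 ≤ s → s ≤ s' → s' ≤ 1 → s' ≤ s + 1 / n →
      ‖V (s', 0) - V (s, 0)‖ ≤ r * C := fun s s' h0 h1 h2 h3 => by
    have hd : ∀ u ∈ Set.Icc s s', ‖δ s' - δ u‖ < r := fun u hu => by
      have := hη2 s' ⟨h0.trans h1, h2⟩ u ⟨h0.trans hu.1, hu.2.trans h2⟩ (by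
        rw [Real.dist_eq, abs_of_nonneg (sub_nonneg.2 hu.2)]
        linarith [hu.1])
      rwa [dist_eq_norm] at this
    rw [apply_eq_of_hasDerivAlong hδ hr hc hV h1 hd]
    refine norm_sub_le_of_hasDerivAlong_ball hr hc hV (hC s ⟨h0, h1.trans h2⟩) ?_
    rw [mem_ball_zero_iff, norm_div, Complex.norm_real, Real.norm_of_nonneg hr.le, div_lt_one hr]
    exact hd s (Set.left_mem_Icc.2 h1)
  have grid : ∀ i : ℕ, i ≤ n → ‖V ((i / n : ℝ), 0) - V (0, 0)‖ ≤ i * (r * C) := by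
    intro i
    induction i with
    | zero => intro _; simp
    | succ i ih =>
      intro hi
      have h1 := ih (by omega)
      have h2 := step (i / n) ((i + 1 : ℕ) / n) (by positivity) (by gcongr; simp)
        ((div_le_one hn0).2 (by exact_mod_cast hi)) (by push_cast; rw [add_div])
      calc _ ≤ ‖V (((i + 1 : ℕ) / n : ℝ), 0) - V ((i / n : ℝ), 0)‖ +
            ‖V ((i / n : ℝ), 0) - V (0, 0)‖ := norm_sub_le_norm_sub_add_norm_sub _ _ _
        _ ≤ r * C + i * (r * C) := add_le_add h2 h1
        _ = _ := by push_cast; ring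
  intro s hs h hh
  have h1 := norm_sub_le_of_hasDerivAlong_ball hr hc hV (hC s hs) hh
  have hi : ⌊s * n⌋₊ ≤ n := by
    have : s * n ≤ n := mul_le_of_le_one_left hn0.le hs.2
    exact_mod_cast (Nat.floor_le (mul_nonneg hs.1 hn0.le)).trans this
  have h2 := grid _ hi
  have h3 := step (⌊s * n⌋₊ / n) s (by positivity)
    ((div_le_iff₀ hn0).2 (Nat.floor_le (mul_nonneg hs.1 hn0.le))) hs.2 (by
      rw [← add_div, le_div_iff₀ hn0]
      exact (Nat.lt_floor_add_one _).le)
  have h4 : (⌊s * n⌋₊ : ℝ) * (r * C) ≤ n * (r * C) := by gcongr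
  calc ‖V (s, h) - V (0, 0)‖
      = ‖(V (s, h) - V (s, 0)) + (V (s, 0) - V ((⌊s * n⌋₊ / n : ℝ), 0)) +
          (V ((⌊s * n⌋₊ / n : ℝ), 0) - V (0, 0))‖ := by congr 1; abel
    _ ≤ r * C + r * C + n * (r * C) := (norm_add₃_le).trans
        (add_le_add (add_le_add h1 h3) (h2.trans h4))
    _ = _ := by ring

end MeanValue

/-! ### Linear holomorphic differential equations -/

section LinearODE

variable {𝒜 : Type*} [NormedRing 𝒜] [NormedAlgebra ℂ 𝒜] [CompleteSpace 𝒜]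

/-- Picard iteration for `F' = F ξ` on a small disk. -/
theorem exists_hasDerivAt_mul_of_bound {ξ : ℂ → 𝒜} {w₀ : ℂ} {r C : ℝ} (hr : 0 < r) (hC : 0 ≤ C)
    (hξ : DifferentiableOn ℂ ξ (Metric.ball w₀ r)) (hb : ∀ w ∈ Metric.ball w₀ r, ‖ξ w‖ ≤ C)
    (hCr : C * r < 1) :
    ∃ F : ℂ → 𝒜, F w₀ = 1 ∧ ∀ w ∈ Metric.ball w₀ r, HasDerivAt F (F w * ξ w) w := by
  have hw₀ : w₀ ∈ Metric.ball w₀ r := Metric.mem_ball_self hr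
  -- One Picard step: the primitive of `G ξ` on the disk that vanishes at `w₀`.
  have step : ∀ G : {G : ℂ → 𝒜 // DifferentiableOn ℂ G (Metric.ball w₀ r)},
      ∃ H : {G : ℂ → 𝒜 // DifferentiableOn ℂ G (Metric.ball w₀ r)}, H.1 w₀ = 0 ∧
        ∀ w ∈ Metric.ball w₀ r, HasDerivAt H.1 (G.1 w * ξ w) w := fun G => by
    obtain ⟨g, hg0, hg⟩ := ((G.2.mul hξ).isExactOn_ball).with_val_at w₀ 0
    exact ⟨⟨g, fun w hw => (hg w hw).differentiableAt.differentiableWithinAt⟩, hg0, hg⟩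
  choose S hS0 hS using step
  let f : ℕ → {G : ℂ → 𝒜 // DifferentiableOn ℂ G (Metric.ball w₀ r)} := fun n =>
    S^[n] ⟨fun _ => 1, differentiableOn_const 1⟩
  have hf : ∀ n, f (n + 1) = S (f n) := fun n => Function.iterate_succ_apply' _ _ _
  have hbound : ∀ n, ∀ w ∈ Metric.ball w₀ r, ‖(f n).1 w‖ ≤ ‖(1 : 𝒜)‖ * (C * r) ^ n := by
    intro n
    induction n with
    | zero => intro w _; simp [f]
    | succ n ih =>
      intro w hw
      have h1 := (convex_ball w₀ r).norm_image_sub_le_of_norm_hasDerivWithin_le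
        (f := (f (n + 1)).1) (C := ‖(1 : 𝒜)‖ * (C * r) ^ n * C)
        (fun w hw => by rw [hf]; exact (hS (f n) w hw).hasDerivWithinAt)
        (fun w hw => (norm_mul_le _ _).trans
          (mul_le_mul (ih w hw) (hb w hw) (norm_nonneg _) (by positivity))) hw₀ hw
      rw [hf, hS0, sub_zero] at h1
      rw [hf]
      refine h1.trans ?_
      have h2 : ‖w - w₀‖ ≤ r := (mem_ball_iff_norm.1 hw).le
      calc _ ≤ ‖(1 : 𝒜)‖ * (C * r) ^ n * C * r := by gcongr
        _ = _ := by ring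
  have hsum : Summable fun n : ℕ => ‖(1 : 𝒜)‖ * (C * r) ^ n :=
    (summable_geometric_of_lt_one (by positivity) hCr).mul_left _
  have hs : ∀ w ∈ Metric.ball w₀ r, Summable fun n => (f n).1 w := fun w hw =>
    Summable.of_norm_bounded hsum fun n => hbound n w hw
  refine ⟨fun w => ∑' n, (f n).1 w, ?_, fun w hw => ?_⟩
  · change ∑' n, (f n).1 w₀ = 1
    rw [tsum_eq_single 0]
    · rfl
    · intro n hn
      obtain ⟨m, rfl⟩ := Nat.exists_eq_succ_of_ne_zero hn
      rw [Nat.succ_eq_add_one, hf, hS0]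
  · have h1 := Complex.hasSum_deriv_of_summable_norm hsum (fun n => (f n).2) Metric.isOpen_ball
      hbound hw
    have h2 := (Complex.differentiableOn_tsum_of_summable_norm hsum (fun n => (f n).2)
      Metric.isOpen_ball hbound).differentiableAt (Metric.isOpen_ball.mem_nhds hw)
    -- Differentiation kills the zeroth iterate and turns the `(n+1)`-st into the `n`-th times `ξ`,
    -- so the series of derivatives is the series itself times `ξ`.
    have h3 : HasSum (fun n => deriv (f n).1 w) ((∑' n, (f n).1 w) * ξ w) := by
      rw [← hasSum_nat_add_iff' 1]
      have h4 : deriv (f 0).1 w = 0 := by simp [f]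
      simp only [Finset.range_one, Finset.sum_singleton, h4, sub_zero]
      have h5 : ∀ n, deriv (f (n + 1)).1 w = (f n).1 w * ξ w := fun n => by
        rw [hf]; exact (hS (f n) w hw).deriv
      simp only [h5]
      exact (hs w hw).hasSum.mul_right _
    rw [← h1.unique h3]
    exact h2.hasDerivAt

/-- Local existence for `F' = F ξ`, with invertible values. -/
theorem exists_local_solution {ξ : ℂ → 𝒜} {V : Set ℂ} (hV : IsOpen V)
    (hξ : DifferentiableOn ℂ ξ V) {w₀ : ℂ} (hw₀ : w₀ ∈ V) :
    ∃ (r : ℝ) (F : ℂ → 𝒜), 0 < r ∧ Metric.ball w₀ r ⊆ V ∧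
      ∀ w ∈ Metric.ball w₀ r, HasDerivAt F (F w * ξ w) w ∧ IsUnit (F w) := by
  have hcont : ContinuousAt ξ w₀ := (hξ.differentiableAt (hV.mem_nhds hw₀)).continuousAt
  have h1 : ∀ᶠ w in 𝓝 w₀, w ∈ V ∧ ‖ξ w‖ < ‖ξ w₀‖ + 1 :=
    (hV.eventually_mem hw₀).and (hcont.norm.eventually (gt_mem_nhds (lt_add_one _)))
  obtain ⟨r₁, hr₁, hr₁'⟩ := Metric.eventually_nhds_iff_ball.1 h1
  set C := ‖ξ w₀‖ + 1
  have hC : 0 < C := by positivity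
  -- This radius gives `C r ≤ 1/2`, so the iteration converges geometrically.
  set r := min r₁ (1 / (2 * C))
  have hr : 0 < r := by positivity
  have hsub : Metric.ball w₀ r ⊆ Metric.ball w₀ r₁ := Metric.ball_subset_ball (min_le_left _ _)
  obtain ⟨F, hF0, hF⟩ := exists_hasDerivAt_mul_of_bound hr hC.le
    (hξ.mono fun w hw => (hr₁' w (hsub hw)).1) (fun w hw => (hr₁' w (hsub hw)).2.le) (by
      calc C * r ≤ C * (1 / (2 * C)) := mul_le_mul_of_nonneg_left (min_le_right _ _) hC.le
        _ = 1 / 2 := by field_simp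
        _ < 1 := by norm_num)
  have hu : ∀ᶠ w in 𝓝 w₀, IsUnit (F w) :=
    (hF w₀ (Metric.mem_ball_self hr)).continuousAt.eventually
      (Units.isOpen.mem_nhds (by rw [hF0]; exact isUnit_one))
  obtain ⟨r₂, hr₂, hr₂'⟩ := Metric.eventually_nhds_iff_ball.1 hu
  refine ⟨min r r₂, F, lt_min hr hr₂, fun w hw => (hr₁' w (hsub ?_)).1, fun w hw =>
    ⟨hF w ?_, hr₂' w ?_⟩⟩
  · exact Metric.ball_subset_ball (min_le_left _ _) hw
  · exact Metric.ball_subset_ball (min_le_left _ _) hw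
  · exact Metric.ball_subset_ball (min_le_right _ _) hw

/-- The units of a ring with the discrete topology. -/
def DiscreteUnits (𝒜 : Type*) [Monoid 𝒜] : Type _ := 𝒜ˣ

instance (𝒜 : Type*) [Monoid 𝒜] : Group (DiscreteUnits 𝒜) := inferInstanceAs (Group 𝒜ˣ)

instance (𝒜 : Type*) [Monoid 𝒜] : TopologicalSpace (DiscreteUnits 𝒜) := ⊥

instance (𝒜 : Type*) [Monoid 𝒜] : DiscreteTopology (DiscreteUnits 𝒜) := ⟨rfl⟩

/-- A unit, as a point of the discrete space of units. -/
def DiscreteUnits.of {𝒜 : Type*} [Monoid 𝒜] (u : 𝒜ˣ) : DiscreteUnits 𝒜 := u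

/-- The underlying element of the ring. -/
def DiscreteUnits.val {𝒜 : Type*} [Monoid 𝒜] (u : DiscreteUnits 𝒜) : 𝒜 := Units.val u

theorem DiscreteUnits.val_mul {𝒜 : Type*} [Monoid 𝒜] (u v : DiscreteUnits 𝒜) :
    (u * v).val = u.val * v.val := rfl

theorem DiscreteUnits.ext {𝒜 : Type*} [Monoid 𝒜] {u v : DiscreteUnits 𝒜} (h : u.val = v.val) :
    u = v := Units.ext h

theorem DiscreteUnits.isUnit_val {𝒜 : Type*} [Monoid 𝒜] (u : DiscreteUnits 𝒜) : IsUnit u.val :=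
  Units.isUnit u

/-- Two solutions of `F' = F ξ` on a convex open set differ by a constant factor. -/
theorem mul_inv_eq_of_solutions {ξ : ℂ → 𝒜} {s : Set ℂ} (hs : Convex ℝ s)
    {u v : ℂ → DiscreteUnits 𝒜} {F G : ℂ → 𝒜} (hu : ∀ w ∈ s, (u w).val = F w)
    (hv : ∀ w ∈ s, (v w).val = G w) (hF : ∀ w ∈ s, HasDerivAt F (F w * ξ w) w)
    (hG : ∀ w ∈ s, HasDerivAt G (G w * ξ w) w) {a b : ℂ} (ha : a ∈ s) (hb : b ∈ s) :
    u a * (v a)⁻¹ = u b * (v b)⁻¹ := by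
  have hGu : ∀ w ∈ s, IsUnit (G w) := fun w hw => hv w hw ▸ (v w).isUnit_val
  have hd : ∀ w ∈ s, HasDerivAt (fun w => F w * Ring.inverse (G w)) 0 w := fun w hw => by
    have := (hF w hw).fun_mul ((hG w hw).ringInverse (hGu w hw))
    convert this using 1
    rw [← mul_assoc (Ring.inverse (G w)), Ring.inverse_mul_cancel _ (hGu w hw), one_mul,
      mul_neg, mul_assoc, add_neg_cancel]
  have h := hs.norm_image_sub_le_of_norm_hasDerivWithin_le (C := 0)
    (fun w hw => (hd w hw).hasDerivWithinAt) (fun w _ => by simp) hb ha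
  have h1 : F a * Ring.inverse (G a) = F b * Ring.inverse (G b) := by
    simpa [sub_eq_zero] using h
  have h2 : ∀ w ∈ s, (u w * (v w)⁻¹).val = F w * Ring.inverse (G w) := fun w hw => by
    rw [DiscreteUnits.val_mul, hu w hw, ← hv w hw]
    congr 1
    exact (Ring.inverse_unit (v w)).symm
  exact DiscreteUnits.ext (by rw [h2 a ha, h2 b hb, h1])

/-- Global solutions of `dT = T ξ` along a map from a simply connected space. -/
theorem exists_solution_along {ξ : ℂ → 𝒜} {V : Set ℂ} (hV : IsOpen V)
    (hξ : DifferentiableOn ℂ ξ V) {Z : Type*} [TopologicalSpace Z] [SimplyConnectedSpace Z]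
    [LocallyPathConnectedSpace Z] {c : Z → ℂ} (hc : Continuous c) (hcV : ∀ z, c z ∈ V) (z₀ : Z)
    {a : 𝒜} (ha : IsUnit a) :
    ∃ T : Z → 𝒜, T z₀ = a ∧ (∀ z, IsUnit (T z)) ∧
      HasDerivAlong c T (fun z => T z * ξ (c z)) := by
  have hloc : ∀ x : V, ∃ (r : ℝ) (F : ℂ → 𝒜) (u : ℂ → DiscreteUnits 𝒜), 0 < r ∧
      ∀ w ∈ Metric.ball (x : ℂ) r, HasDerivAt F (F w * ξ w) w ∧ (u w).val = F w := fun x => by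
    classical
    obtain ⟨r, F, hr, -, h⟩ := exists_local_solution hV hξ x.2
    choose u hu using fun w : {w // IsUnit (F w)} => w.2
    -- The default `1` only makes `u` total; on the ball `F` is invertible.
    refine ⟨r, F, fun w => if h : IsUnit (F w) then DiscreteUnits.of (u ⟨w, h⟩) else 1, hr, fun w hw =>
      ⟨(h w hw).1, ?_⟩⟩
    simp only [dif_pos (h w hw).2]
    exact hu ⟨w, (h w hw).2⟩
  choose r F u hr hFu using hloc
  -- The bundle of local solutions: in chart `i` the coordinate `v` stands for the solution `v F_i`.
  -- The transitions are locally constant, so with discrete fibres the total space covers `V`.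
  -- Lifting `c` to it, which is possible as `Z` is simply connected, produces the global solution.
  let core : FiberBundleCore V V (DiscreteUnits 𝒜) :=
    { baseSet := fun x => Subtype.val ⁻¹' Metric.ball (x : ℂ) (r x)
      isOpen_baseSet := fun x => Metric.isOpen_ball.preimage continuous_subtype_val
      indexAt := id
      mem_baseSet_at := fun x => Metric.mem_ball_self (hr x)
      coordChange := fun i j x v => v * (u i x * (u j x)⁻¹)
      coordChange_self := fun i x _ v => by rw [mul_inv_cancel, mul_one]
      continuousOn_coordChange := fun i j => by
        -- Two balls meet in a convex set, on which the transition keeps its value at any one point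
        -- `b`.
        rcases (Metric.ball (i : ℂ) (r i) ∩ Metric.ball (j : ℂ) (r j)).eq_empty_or_nonempty with
          h | ⟨b, hb⟩
        · refine (continuousOn_empty _).mono fun q hq => ?_
          have : (q.1 : ℂ) ∈ Metric.ball (i : ℂ) (r i) ∩ Metric.ball (j : ℂ) (r j) := hq.1
          rw [h] at this
          exact this
        · have hcont : Continuous fun q : V × DiscreteUnits 𝒜 => q.2 * (u i b * (u j b)⁻¹) :=
            (continuous_of_discreteTopology (f := fun v : DiscreteUnits 𝒜 =>
              v * (u i b * (u j b)⁻¹))).comp continuous_snd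
          refine hcont.continuousOn.congr fun q hq => ?_
          change q.2 * (u i q.1 * (u j q.1)⁻¹) = q.2 * (u i b * (u j b)⁻¹)
          rw [mul_inv_eq_of_solutions (ξ := ξ) (F := F i) (G := F j)
            ((convex_ball _ _).inter (convex_ball _ _)) (fun w hw => (hFu i w hw.1).2)
            (fun w hw => (hFu j w hw.2).2) (fun w hw => (hFu i w hw.1).1)
            (fun w hw => (hFu j w hw.2).1) hq.1 hb]
      coordChange_comp := fun i j k x _ v => by group }
  have cov : IsCoveringMap core.proj := FiberBundle.isCoveringMap (E := core.Fiber)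
  obtain ⟨a, rfl⟩ := ha
  let v₀ : DiscreteUnits 𝒜 := DiscreteUnits.of a * (u ⟨c z₀, hcV z₀⟩ (c z₀))⁻¹
  obtain ⟨L, ⟨hL0, hL⟩, -⟩ := cov.existsUnique_continuousMap_lifts
    (⟨fun z => ⟨c z, hcV z⟩, by fun_prop⟩ : C(Z, V)) z₀ ⟨⟨c z₀, hcV z₀⟩, v₀⟩ rfl
  have hL1 : ∀ z, (L z).1 = ⟨c z, hcV z⟩ := fun z => congrFun hL z
  let f : core.TotalSpace → DiscreteUnits 𝒜 := fun q => q.2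
  let G : core.TotalSpace → DiscreteUnits 𝒜 := fun q => f q * u q.1 q.1
  refine ⟨fun z => (G (L z)).val, ?_, fun z => DiscreteUnits.isUnit_val _, fun z => ?_⟩
  · change (G (L z₀)).val = _
    rw [hL0]
    change (DiscreteUnits.of a * (u ⟨c z₀, hcV z₀⟩ (c z₀))⁻¹ * u ⟨c z₀, hcV z₀⟩ (c z₀)).val = _
    rw [inv_mul_cancel_right]
    rfl
  · let i : V := ⟨c z, hcV z⟩
    have hi : ∀ᶠ y in 𝓝 z, c y ∈ Metric.ball (i : ℂ) (r i) :=
      hc.continuousAt.eventually (Metric.isOpen_ball.mem_nhds (Metric.mem_ball_self (hr i)))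
    let coord : Z → DiscreteUnits 𝒜 := fun y => (core.localTriv i (L y)).2
    have hcoord : ContinuousAt coord z := by
      refine continuous_snd.continuousAt.comp (ContinuousAt.comp (f := L) ?_ (L.continuousAt z))
      refine (core.localTriv i).continuousOn.continuousAt
        ((core.localTriv i).open_source.mem_nhds ?_)
      rw [(core.localTriv i).mem_source]
      change ((L z).1 : ℂ) ∈ Metric.ball (i : ℂ) (r i)
      rw [hL1]
      exact Metric.mem_ball_self (hr i)
    -- A continuous coordinate with values in a discrete space is locally constant, so the lift is
    -- locally a constant times `F i`.
    have hconst : ∀ᶠ y in 𝓝 z, coord y = coord z :=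
      hcoord.eventually (IsOpen.mem_nhds (isOpen_discrete {coord z}) rfl)
    have hG : ∀ y, G (L y) = coord y * u i (c y) := fun y => by
      change f (L y) * u (L y).1 (L y).1 =
        f (L y) * (u (L y).1 (L y).1 * (u i (L y).1)⁻¹) * u i (c y)
      rw [hL1]
      group
    refine ⟨fun w => (coord z).val * F i w, ?_⟩
    filter_upwards [hi, hconst] with y h1 h2
    have h3 : (G (L y)).val = (coord z).val * F i (c y) := by
      rw [hG, h2, DiscreteUnits.val_mul, (hFu i _ h1).2]
    refine ⟨h3, ?_⟩
    rw [h3, mul_assoc]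
    exact (hFu i _ h1).1.const_mul _

end LinearODE

/-! ### Logarithms along a map, and the index of a Jordan curve bounding a disk -/

section Winding

theorem exists_continuous_log {Z : Type*} [TopologicalSpace Z] [SimplyConnectedSpace Z]
    [LocallyPathConnectedSpace Z] {g : Z → ℂ} (hg : Continuous g) (h0 : ∀ z, g z ≠ 0) :
    ∃ θ : Z → ℂ, Continuous θ ∧ ∀ z, Complex.exp (θ z) = g z := by
  obtain ⟨z₀⟩ : Nonempty Z := inferInstance
  obtain ⟨F, ⟨-, hF⟩, -⟩ := Complex.isCoveringMapOn_exp.existsUnique_continuousMap_lifts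
    ⟨g, hg⟩ (a₀ := z₀) (e₀ := Complex.log (g z₀)) (Complex.exp_log (h0 z₀)) h0
  exact ⟨F, F.continuous, fun z => congrFun hF z⟩

theorem eq_of_exp_eq {Z : Type*} [TopologicalSpace Z] [PreconnectedSpace Z] {f : Z → ℂ}
    (hf : Continuous f) {k : ℂ} (h : ∀ z, Complex.exp (f z) = k) (a b : Z) : f a = f b := by
  have := Complex.isCoveringMap_exp.eq_of_comp_eq hf (continuous_const (y := f b))
    (funext fun z => Subtype.ext (by simp [h])) b rfl
  exact congrFun this a

/-- Two logarithms of the same function have the same variation. -/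
theorem sub_eq_sub_of_exp_eq {Z : Type*} [TopologicalSpace Z] [PreconnectedSpace Z] {f g : Z → ℂ}
    (hf : Continuous f) (hg : Continuous g) (h : ∀ z, Complex.exp (f z) = Complex.exp (g z))
    (a b : Z) : f a - f b = g a - g b := by
  have := eq_of_exp_eq (f := fun z => f z - g z) (k := 1) (hf.sub hg)
    (fun z => by rw [Complex.exp_sub, h, div_self (Complex.exp_ne_zero _)]) a b
  linear_combination this

theorem hasDerivAlong_log {Z : Type*} [TopologicalSpace Z] {c θ : Z → ℂ} {p : ℂ}
    (hθ : Continuous θ) (h : ∀ z, Complex.exp (θ z) = c z - p) :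
    HasDerivAlong c θ (fun z => (c z - p)⁻¹) := fun z => by
  have hz : c z - p ≠ 0 := h z ▸ Complex.exp_ne_zero _
  have hF : ∀ y, (c y - p) / (c z - p) = Complex.exp (θ y - θ z) := fun y => by
    rw [Complex.exp_sub, h, h]
  refine ⟨fun w => θ z + Complex.log ((w - p) / (c z - p)), ?_⟩
  have h1 : ContinuousAt (fun y => (θ y - θ z).im) z := by fun_prop
  have h2 : ∀ᶠ y in 𝓝 z, (θ y - θ z).im ∈ Set.Ioo (-Real.pi) Real.pi :=
    h1.eventually (isOpen_Ioo.mem_nhds (by simp [Real.pi_pos]))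
  have h3 : ContinuousAt (fun y => Complex.exp (θ y - θ z)) z := by fun_prop
  have h4 : ∀ᶠ y in 𝓝 z, Complex.exp (θ y - θ z) ∈ Complex.slitPlane :=
    h3.eventually (Complex.isOpen_slitPlane.mem_nhds (by simp))
  filter_upwards [h2, h4] with y hy1 hy2
  refine ⟨?_, ?_⟩
  · rw [hF, Complex.log_exp hy1.1 hy1.2.le]; ring
  · rw [← hF] at hy2
    have hd : HasDerivAt (fun w : ℂ => (w - p) / (c z - p)) (1 / (c z - p)) (c y) :=
      ((hasDerivAt_id _).sub_const p).div_const _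
    have := (hd.clog hy2).const_add (θ z)
    convert this using 1
    have hy : c y - p ≠ 0 := h y ▸ Complex.exp_ne_zero _
    field_simp

/-- The parametrization `s ↦ e^{2πis}` of the unit circle. -/
def circ (s : ℝ) : ℂ := Complex.exp (2 * Real.pi * Complex.I * s)

theorem continuous_circ : Continuous circ := by unfold circ; fun_prop

theorem norm_circ (s : ℝ) : ‖circ s‖ = 1 := by
  rw [circ, Complex.norm_exp]; simp

theorem circ_mem (s : ℝ) : circ s ∈ Metric.closedBall (0 : ℂ) 1 := by
  simp [norm_circ]

theorem circ_one : circ 1 = circ 0 := by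
  simp [circ, Complex.exp_two_pi_mul_I]

theorem circ_add_half (s : ℝ) : circ (s + 1 / 2) = -circ s := by
  rw [circ, circ, ← Complex.exp_add_pi_mul_I]
  congr 1; push_cast; ring

/-- The projection of `ℝ` onto `[0, 1]`. -/
def clamp (v : ℝ) : ℝ := max 0 (min 1 v)

theorem continuous_clamp : Continuous clamp := by unfold clamp; fun_prop

theorem clamp_nonneg (v : ℝ) : 0 ≤ clamp v := le_max_left _ _

theorem clamp_le_one (v : ℝ) : clamp v ≤ 1 := max_le zero_le_one (min_le_left _ _)

theorem clamp_of_mem {v : ℝ} (h : v ∈ Set.Icc (0 : ℝ) 1) : clamp v = v := by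
  rw [clamp, min_eq_right h.2, max_eq_right h.1]

/-- `H` has a logarithm on the whole plane of parameters. Its variation over a period depends
continuously on `v` and has exponential `1`, hence does not depend on `v`. -/
theorem index_eq_of_homotopy {H : ℝ × ℝ → ℂ} (hH : Continuous H) (h0 : ∀ q, H q ≠ 0)
    (hper : ∀ v, H (1, v) = H (0, v)) {θ₀ θ₁ : ℝ → ℂ} (hθ₀ : Continuous θ₀) (hθ₁ : Continuous θ₁)
    (h₀ : ∀ s, Complex.exp (θ₀ s) = H (s, 0)) (h₁ : ∀ s, Complex.exp (θ₁ s) = H (s, 1)) :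
    θ₁ 1 - θ₁ 0 = θ₀ 1 - θ₀ 0 := by
  obtain ⟨Θ, hΘ, hΘH⟩ := exists_continuous_log hH h0
  have h2 := eq_of_exp_eq (f := fun v : ℝ => Θ (1, v) - Θ (0, v)) (k := 1) (by fun_prop)
    (fun v => by rw [Complex.exp_sub, hΘH, hΘH, hper, div_self (h0 _)]) 1 0
  rw [sub_eq_sub_of_exp_eq (g := fun s => Θ (s, 1)) hθ₁ (by fun_prop)
      (fun s => by rw [h₁, hΘH]) 1 0,
    sub_eq_sub_of_exp_eq (g := fun s => Θ (s, 0)) hθ₀ (by fun_prop)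
      (fun s => by rw [h₀, hΘH]) 1 0]
  exact h2

/-- The boundary of an embedded disk has the same nonzero index with respect to all points of
the interior of the disk. -/
theorem exists_index {ψ : ℂ → ℂ} (hψ : Continuous ψ)
    (hinj : Set.InjOn ψ (Metric.closedBall 0 1)) :
    ∃ κ : ℂ, κ ≠ 0 ∧ conj κ = -κ ∧ ∀ z ∈ Metric.ball (0 : ℂ) 1, ∀ θ : ℝ → ℂ, Continuous θ →
      (∀ s, Complex.exp (θ s) = ψ (circ s) - ψ z) → θ 1 - θ 0 = κ := by
  have hcirc := continuous_circ
  have hclamp := continuous_clamp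
  have hne : ∀ z ∈ Metric.ball (0 : ℂ) 1, ∀ s, ψ (circ s) - ψ z ≠ 0 := fun z hz s h => by
    have := hinj (circ_mem s) (Metric.ball_subset_closedBall hz) (sub_eq_zero.1 h)
    rw [← this, mem_ball_zero_iff, norm_circ] at hz
    exact lt_irrefl _ hz
  have h0 : (0 : ℂ) ∈ Metric.ball (0 : ℂ) 1 := Metric.mem_ball_self one_pos
  obtain ⟨θ₀, hθ₀, hθ₀'⟩ := exists_continuous_log (g := fun s : ℝ => ψ (circ s) - ψ 0)
    (by fun_prop) (hne 0 h0)
  refine ⟨θ₀ 1 - θ₀ 0, ?_, ?_, fun z hz θ hθ h => ?_⟩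
  -- With `ω = circ s`, this is `ψ(ω/(1+v)) - ψ(-vω/(1+v))`. The two arguments never coincide, so by
  -- injectivity `H` has no zero. It deforms `ψ(ω) - ψ(0)` into `ψ(ω/2) - ψ(-ω/2)`, which is odd in
  -- `ω`.
  · let H : ℝ × ℝ → ℂ := fun q => ψ (((1 + clamp q.2 : ℝ) : ℂ)⁻¹ * circ q.1) -
      ψ (-(((clamp q.2 / (1 + clamp q.2) : ℝ) : ℂ) * circ q.1))
    have hpos : ∀ v, 0 < 1 + clamp v := fun v => by linarith [clamp_nonneg v]
    have hHc : Continuous H := by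
      have h1 : Continuous fun q : ℝ × ℝ => ((1 + clamp q.2 : ℝ) : ℂ)⁻¹ :=
        Continuous.inv₀ (by fun_prop) fun q => by exact_mod_cast (hpos q.2).ne'
      have h2 : Continuous fun q : ℝ × ℝ => clamp q.2 / (1 + clamp q.2) :=
        Continuous.div (by fun_prop) (by fun_prop) fun q => (hpos q.2).ne'
      fun_prop
    have hH0 : ∀ q, H q ≠ 0 := fun q h => by
      have hp := hpos q.2
      have hc0 := clamp_nonneg q.2
      have h1 := hinj (x₁ := ((1 + clamp q.2 : ℝ) : ℂ)⁻¹ * circ q.1)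
        (x₂ := -(((clamp q.2 / (1 + clamp q.2) : ℝ) : ℂ) * circ q.1)) (by
          rw [mem_closedBall_zero_iff, norm_mul, norm_circ, mul_one, norm_inv, Complex.norm_real,
            Real.norm_of_nonneg hp.le]
          exact inv_le_one_of_one_le₀ (by linarith)) (by
          rw [mem_closedBall_zero_iff, norm_neg, norm_mul, norm_circ, mul_one, Complex.norm_real,
            Real.norm_of_nonneg (by positivity), div_le_one hp]
          linarith) (sub_eq_zero.1 h)
      have hcne : circ q.1 ≠ 0 := fun h => by simpa [h] using norm_circ q.1
      rw [← neg_mul] at h1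
      have h2 := mul_right_cancel₀ hcne h1
      have h3 : (1 + clamp q.2)⁻¹ = -(clamp q.2 / (1 + clamp q.2)) := by exact_mod_cast h2
      have h4 : 0 < (1 + clamp q.2)⁻¹ := inv_pos.2 hp
      have h5 : 0 ≤ clamp q.2 / (1 + clamp q.2) := by positivity
      linarith
    have hcl0 : clamp 0 = 0 := clamp_of_mem (by simp)
    have hcl1 : clamp 1 = 1 := clamp_of_mem (by simp)
    obtain ⟨θ₁, hθ₁, hθ₁'⟩ := exists_continuous_log (g := fun s : ℝ => H (s, 1)) (by fun_prop)
      (fun s => hH0 _)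
    rw [← index_eq_of_homotopy hHc hH0 (fun v => by simp only [H, circ_one]) hθ₀ hθ₁
      (fun s => by rw [hθ₀']; simp [H, hcl0]) hθ₁']
    have hanti : ∀ s, H (s + 1 / 2, 1) = -H (s, 1) := fun s => by
      simp only [H, circ_add_half, hcl1]
      norm_num
    -- The variation over half a period is a constant whose exponential is `-1`. It is therefore
    -- nonzero, and so is its double, the variation over the full period.
    have hD : ∀ s, Complex.exp (θ₁ (s + 1 / 2) - θ₁ s) = -1 := fun s => by
      rw [Complex.exp_sub, hθ₁', hθ₁', hanti, neg_div, div_self (hH0 _)]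
    have h1 := eq_of_exp_eq (f := fun s : ℝ => θ₁ (s + 1 / 2) - θ₁ s) (by fun_prop) hD (1 / 2) 0
    norm_num at h1
    intro h2
    have h3 : θ₁ (1 / 2) - θ₁ 0 = 0 := by linear_combination h2 / 2 - h1 / 2
    have h4 := hD 0
    rw [zero_add, h3, Complex.exp_zero] at h4
    norm_num at h4
  -- `κ` is an integer multiple of `2πi`, hence purely imaginary.
  · have h1 : Complex.exp (θ₀ 1 - θ₀ 0) = 1 := by
      rw [Complex.exp_sub, hθ₀', hθ₀', circ_one, div_self (hne 0 h0 0)]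
    obtain ⟨n, hn⟩ := Complex.exp_eq_one_iff.1 h1
    rw [hn, show (n : ℂ) * (2 * Real.pi * Complex.I) = ((n * (2 * Real.pi) : ℝ) : ℂ) * Complex.I by
      push_cast; ring]
    simp only [map_mul, Complex.conj_ofReal, Complex.conj_I, mul_neg]
  -- The base point slides from the centre to `z` along a radius, inside the open disk.
  · refine index_eq_of_homotopy (H := fun q => ψ (circ q.1) - ψ ((clamp q.2 : ℂ) * z))
      (by fun_prop) (fun q => hne _ ?_ _) (fun v => by simp only [circ_one]) hθ₀ hθ ?_ ?_
    · rw [mem_ball_zero_iff, norm_mul, Complex.norm_real, Real.norm_of_nonneg (clamp_nonneg _)]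
      exact (mul_le_of_le_one_left (norm_nonneg z) (clamp_le_one _)).trans_lt
        (mem_ball_zero_iff.1 hz)
    · intro s; rw [hθ₀', clamp_of_mem (by simp)]; simp
    · intro s; rw [h, clamp_of_mem (by simp)]; simp

/-- The radial retraction of the plane onto the closed unit disk. -/
def retr (z : ℂ) : ℂ := ((max 1 ‖z‖ : ℝ) : ℂ)⁻¹ * z

theorem continuous_retr : Continuous retr :=
  (Continuous.inv₀ (by fun_prop) fun z => by
    exact_mod_cast (one_pos.trans_le (le_max_left 1 ‖z‖)).ne').mul continuous_id

theorem retr_mem (z : ℂ) : retr z ∈ Metric.closedBall (0 : ℂ) 1 := by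
  have h : 0 < max 1 ‖z‖ := one_pos.trans_le (le_max_left 1 ‖z‖)
  rw [mem_closedBall_zero_iff, retr, norm_mul, norm_inv, Complex.norm_real,
    Real.norm_of_nonneg h.le, inv_mul_le_one₀ h]
  exact le_max_right _ _

theorem retr_of_mem {z : ℂ} (h : z ∈ Metric.closedBall (0 : ℂ) 1) : retr z = z := by
  rw [retr, max_eq_left (mem_closedBall_zero_iff.1 h)]; simp

end Winding

/-! ### The coordinate `w = 1 / (z + 1)` -/

section Coordinate

/-- The point of the Riemann sphere with coordinate `w = 1 / (z + 1)`. -/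
def toSphere (w : ℂ) : OnePoint ℂ := if w = 0 then ∞ else ((w⁻¹ - 1 : ℂ) : OnePoint ℂ)

/-- The coordinate `w = 1 / (z + 1)` on the Riemann sphere minus `-1`. -/
def ofSphere (z : OnePoint ℂ) : ℂ := z.elim 0 fun z => (z + 1)⁻¹

@[simp] theorem ofSphere_infty : ofSphere ∞ = 0 := rfl

@[simp] theorem ofSphere_coe (z : ℂ) : ofSphere (z : OnePoint ℂ) = (z + 1)⁻¹ := rfl

theorem toSphere_ofSphere {z : OnePoint ℂ} (hz : z ≠ ((-1 : ℂ) : OnePoint ℂ)) :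
    toSphere (ofSphere z) = z := by
  induction z using OnePoint.rec with
  | infty => simp [toSphere]
  | coe z =>
    have : z + 1 ≠ 0 := fun h => hz (by rw [eq_neg_of_add_eq_zero_left h])
    simp [toSphere, this]

theorem toSphere_of_ne {w : ℂ} (hw : w ≠ 0) : toSphere w = ((w⁻¹ - 1 : ℂ) : OnePoint ℂ) :=
  if_neg hw

theorem continuous_toSphere : Continuous toSphere := by
  refine continuous_iff_continuousAt.2 fun w => ?_
  rcases eq_or_ne w 0 with rfl | hw
  · rw [continuousAt_iff_punctured_nhds]
    have h1 : Tendsto (fun w : ℂ => w⁻¹ - 1) (𝓝[≠] 0) (coclosedCompact ℂ) := by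
      rw [coclosedCompact_eq_cocompact, ← Metric.cobounded_eq_cocompact,
        ← tendsto_norm_atTop_iff_cobounded]
      have h2 : Tendsto (fun w : ℂ => ‖w⁻¹‖ - 1) (𝓝[≠] 0) atTop :=
        tendsto_atTop_add_const_right _ _
          (tendsto_norm_atTop_iff_cobounded.2 tendsto_inv₀_nhdsNE_zero)
      refine tendsto_atTop_mono (fun w => ?_) h2
      simpa using norm_sub_norm_le w⁻¹ 1
    have h3 : toSphere 0 = ∞ := by simp [toSphere]
    rw [h3]
    have h4 := (OnePoint.tendsto_coe_infty (X := ℂ)).comp h1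
    refine h4.congr' ?_
    filter_upwards [self_mem_nhdsWithin] with w hw
    exact (toSphere_of_ne hw).symm
  · have h1 : ContinuousAt (fun w : ℂ => ((w⁻¹ - 1 : ℂ) : OnePoint ℂ)) w :=
      OnePoint.continuous_coe.continuousAt.comp ((continuousAt_inv₀ hw).sub continuousAt_const)
    refine h1.congr ?_
    filter_upwards [isOpen_ne.mem_nhds hw] with w hw
    exact (toSphere_of_ne hw).symm

theorem continuousAt_ofSphere {z : OnePoint ℂ} (hz : z ≠ ((-1 : ℂ) : OnePoint ℂ)) :
    ContinuousAt ofSphere z := by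
  induction z using OnePoint.rec with
  | infty =>
    rw [OnePoint.continuousAt_infty']
    change Tendsto (fun z : ℂ => (z + 1)⁻¹) _ (𝓝 0)
    rw [coclosedCompact_eq_cocompact, ← Metric.cobounded_eq_cocompact]
    refine tendsto_inv₀_cobounded.comp ?_
    rw [← tendsto_norm_atTop_iff_cobounded]
    refine tendsto_atTop_mono (fun z => ?_)
      (tendsto_atTop_add_const_right _ (-1) (tendsto_norm_cobounded_atTop (E := ℂ)))
    have := norm_sub_le (z + 1) 1
    simp at this
    linarith
  | coe z =>
    have : z + 1 ≠ 0 := fun h => hz (by rw [eq_neg_of_add_eq_zero_left h])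
    rw [OnePoint.continuousAt_coe]
    change ContinuousAt (fun z : ℂ => (z + 1)⁻¹) z
    exact (continuousAt_id.add continuousAt_const).inv₀ this

/-- The domain `Ω` in the coordinate `w = 1 / (z + 1)`. -/
def wplane (Ω : Set (OnePoint ℂ)) : Set ℂ := toSphere ⁻¹' Ω

theorem isOpen_wplane {Ω : Set (OnePoint ℂ)} (hΩ : IsOpen Ω) : IsOpen (wplane Ω) :=
  hΩ.preimage continuous_toSphere

theorem ofSphere_mem_wplane {Ω : Set (OnePoint ℂ)} (hΩ1 : ((-1 : ℂ) : OnePoint ℂ) ∉ Ω)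
    {z : OnePoint ℂ} (hz : z ∈ Ω) : ofSphere z ∈ wplane Ω := by
  rw [wplane, Set.mem_preimage, toSphere_ofSphere fun h => hΩ1 (h ▸ hz)]
  exact hz

theorem sub_one_mem_puncture {Ω : Set (OnePoint ℂ)} {w : ℂ} (hw : w ∈ wplane Ω) (h0 : w ≠ 0)
    (h1 : w ≠ 1) : w⁻¹ - 1 ∈ puncture Ω := by
  refine ⟨?_, ?_⟩
  · rw [sub_ne_zero, ne_eq, inv_eq_one]; exact h1
  · rw [← toSphere_of_ne h0]; exact hw

theorem isOpen_puncture {Ω : Set (OnePoint ℂ)} (hΩ : IsOpen Ω) : IsOpen (puncture Ω) :=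
  isOpen_ne.inter (hΩ.preimage OnePoint.continuous_coe)

end Coordinate

/-! ### Extension of holomorphic forms -/

section Extension

variable {E : Type*} [NormedAddCommGroup E] [NormedSpace ℂ E]

theorem differentiableOn_update {S : Set ℂ} (hS : IsOpen S) {h G : ℂ → E} {a : ℂ}
    (hd : DifferentiableOn ℂ h (S \ {a})) (hG : DifferentiableAt ℂ G a)
    (heq : ∀ᶠ z in 𝓝[≠] a, h z = G z) :
    DifferentiableOn ℂ (Function.update h a (G a)) S := fun x hx => by
  refine DifferentiableAt.differentiableWithinAt ?_
  rcases eq_or_ne x a with rfl | hxa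
  · refine hG.congr_of_eventuallyEq ?_
    rw [eventually_nhdsWithin_iff] at heq
    filter_upwards [heq] with z hz
    by_cases hza : z = x
    · simp [hza]
    · rw [Function.update_of_ne hza, hz hza]
  · refine (hd.differentiableAt ((hS.sdiff isClosed_singleton).mem_nhds
      ⟨hx, hxa⟩)).congr_of_eventuallyEq ?_
    filter_upwards [isOpen_ne.mem_nhds hxa] with z hz
    rw [Function.update_of_ne hz]

/-- A 1-form holomorphic on `Ω ∖ {0, ∞}`, and at `0` and `∞`, is in the coordinate
`w = 1 / (z + 1)` a holomorphic form on all of `Ω`. -/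
theorem exists_extension [CompleteSpace E] {Ω : Set (OnePoint ℂ)} (hΩ : IsOpen Ω) {f : ℂ → E}
    (hf : DifferentiableOn ℂ f (puncture Ω)) (h : HolomorphicAtZeroInfty f) :
    ∃ F : ℂ → E, DifferentiableOn ℂ F (wplane Ω) ∧
      ∀ w, w ≠ 0 → w ≠ 1 → F w = -(w ^ 2)⁻¹ • f (w⁻¹ - 1) := by
  obtain ⟨⟨g₀, hg₀, hfg₀⟩, ⟨g₁, hg₁, hfg₁⟩⟩ := h
  let h : ℂ → E := fun w => -(w ^ 2)⁻¹ • f (w⁻¹ - 1)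
  have hS := isOpen_wplane hΩ
  have hinv : ∀ w : ℂ, w ≠ 0 → DifferentiableAt ℂ (fun w : ℂ => w⁻¹ - 1) w := fun w hw =>
    (differentiableAt_inv hw).sub_const 1
  have hsq : ∀ w : ℂ, w ≠ 0 → DifferentiableAt ℂ (fun w : ℂ => -(w ^ 2)⁻¹) w := fun w hw => by
    have h : DifferentiableAt ℂ (fun w : ℂ => w ^ 2) w := by fun_prop
    exact (h.fun_inv (pow_ne_zero 2 hw)).fun_neg
  have hd : DifferentiableOn ℂ h ((wplane Ω \ {0}) \ {1}) := fun w hw => by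
    refine DifferentiableAt.differentiableWithinAt ((hsq w hw.1.2).smul ?_)
    exact (hf.differentiableAt ((isOpen_puncture hΩ).mem_nhds
      (sub_one_mem_puncture hw.1.1 hw.1.2 hw.2))).comp w (hinv w hw.1.2)
  -- The point `z = 0` is `w = 1`.
  let G₀ : ℂ → E := fun w => -(w ^ 2)⁻¹ • g₀ (w⁻¹ - 1)
  have hG₀ : DifferentiableAt ℂ G₀ 1 := by
    refine (hsq 1 one_ne_zero).smul (DifferentiableAt.comp (1 : ℂ) ?_ (hinv 1 one_ne_zero))
    simpa using hg₀.differentiableAt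
  have hhG₀ : ∀ᶠ w in 𝓝[≠] (1 : ℂ), h w = G₀ w := by
    have ht : Tendsto (fun w : ℂ => w⁻¹ - 1) (𝓝[≠] 1) (𝓝[≠] 0) := by
      refine tendsto_nhdsWithin_iff.2 ⟨?_, ?_⟩
      · have := (hinv 1 one_ne_zero).continuousAt.tendsto
        simp only [inv_one, sub_self] at this
        exact this.mono_left nhdsWithin_le_nhds
      · filter_upwards [self_mem_nhdsWithin] with w hw
        simpa [sub_eq_zero] using hw
    filter_upwards [ht.eventually hfg₀] with w hw
    simp only [h, G₀, hw, pow_zero, inv_one, one_smul]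
  have hd₁ := differentiableOn_update (hS.sdiff isClosed_singleton) hd hG₀ hhG₀
  set h₁ := Function.update h 1 (G₀ 1) with hh₁
  -- The point `z = ∞` is `w = 0`, and the coordinate `1/z` there is `w/(1-w)`.
  let G₁ : ℂ → E := fun w => ((1 - w) ^ 2)⁻¹ • g₁ (w / (1 - w))
  have hG₁ : DifferentiableAt ℂ G₁ 0 := by
    have h1 : DifferentiableAt ℂ (fun w : ℂ => ((1 - w) ^ 2)⁻¹) 0 := by
      have h : DifferentiableAt ℂ (fun w : ℂ => (1 - w) ^ 2) 0 := by fun_prop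
      exact h.fun_inv (by simp)
    have h2 : DifferentiableAt ℂ (fun w : ℂ => w / (1 - w)) 0 :=
      DifferentiableAt.div (by fun_prop) (by fun_prop) (by simp)
    refine h1.smul (DifferentiableAt.comp (0 : ℂ) ?_ h2)
    simpa using hg₁.differentiableAt
  have hhG₁ : ∀ᶠ w in 𝓝[≠] (0 : ℂ), h₁ w = G₁ w := by
    have ht : Tendsto (fun w : ℂ => w / (1 - w)) (𝓝[≠] 0) (𝓝[≠] 0) := by
      refine tendsto_nhdsWithin_iff.2 ⟨?_, ?_⟩
      · have h2 : ContinuousAt (fun w : ℂ => w / (1 - w)) 0 :=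
          ContinuousAt.div (by fun_prop) (by fun_prop) (by simp)
        have := h2.tendsto
        simp only [zero_div] at this
        exact this.mono_left nhdsWithin_le_nhds
      · filter_upwards [self_mem_nhdsWithin,
          nhdsWithin_le_nhds (isOpen_ne.mem_nhds (zero_ne_one (α := ℂ)))] with w hw hw1
        exact div_ne_zero hw (sub_ne_zero.2 (Ne.symm hw1))
    filter_upwards [ht.eventually hfg₁, self_mem_nhdsWithin,
      nhdsWithin_le_nhds (isOpen_ne.mem_nhds (zero_ne_one (α := ℂ)))] with w hw hw0 hw1
    have hw0 : w ≠ 0 := hw0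
    have hw1' : 1 - w ≠ 0 := sub_ne_zero.2 (Ne.symm hw1)
    rw [hh₁, Function.update_of_ne hw1]
    simp only [atInfinity, pow_zero, inv_one, one_smul] at hw
    have e1 : (w / (1 - w))⁻¹ = w⁻¹ - 1 := by field_simp
    rw [e1] at hw
    simp only [G₁, ← hw, h, smul_neg, neg_smul, smul_smul]
    congr 2
    field_simp
  refine ⟨_, differentiableOn_update hS hd₁ hG₁ hhG₁, fun w hw0 hw1 => ?_⟩
  rw [Function.update_of_ne hw0, hh₁, Function.update_of_ne hw1]

end Extension

/-! ### The singular part of the singular entry -/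

section Singular

variable {ρ : ℝ} [hρ : Fact (1 < ρ)]

/-- Conjugating both the argument and the value, two antilinear operations, leaves a complex linear
derivative. This is how `σ`-symmetry carries holomorphy from `0` to `∞`. -/
theorem HasDerivAt.bar_conj {F : ℂ → W ρ} {F' : W ρ} {w : ℂ} (h : HasDerivAt F F' (conj w)) :
    HasDerivAt (fun w => (F (conj w)).bar) F'.bar w := by
  rw [hasDerivAt_iff_isLittleO_nhds_zero] at h ⊢
  have h1 : Tendsto (fun h : ℂ => conj h) (𝓝 0) (𝓝 0) := by
    simpa using Complex.continuous_conj.tendsto 0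
  have h2 := (h.comp_tendsto h1).norm_left.norm_right
  refine Asymptotics.IsLittleO.of_norm_left (Asymptotics.IsLittleO.of_norm_right ?_)
  refine h2.congr (fun k => ?_) (fun k => ?_)
  · simp only [Function.comp_apply]
    rw [← W.norm_bar, W.bar_sub, W.bar_sub, W.bar_smul, Complex.conj_conj, map_add]
  · simp

theorem AnalyticAt.bar_conj {F : ℂ → W ρ} (h : AnalyticAt ℂ F 0) :
    AnalyticAt ℂ (fun w => (F (conj w)).bar) 0 := by
  rw [Complex.analyticAt_iff_eventually_differentiableAt] at h ⊢
  have h1 : Tendsto (fun h : ℂ => conj h) (𝓝 0) (𝓝 0) := by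
    simpa using Complex.continuous_conj.tendsto 0
  filter_upwards [h1.eventually h] with w hw
  exact hw.hasDerivAt.bar_conj.differentiableAt

/-- The rational 1-form with principal parts `A dz / z² + B dz / z` at `0` and the symmetric
ones at `∞`. Its only other pole is `-1`. -/
def singularPart (A B : W ρ) (z : ℂ) : W ρ :=
  (z ^ 2)⁻¹ • A + (z * (z + 1))⁻¹ • B + A.bar + (z + 1)⁻¹ • B.bar

theorem singularPart_symm (A B : W ρ) {z : ℂ} (h0 : z ≠ 0) (h1 : z + 1 ≠ 0) :
    singularPart A B z = (z ^ 2)⁻¹ • (singularPart A B (conj z)⁻¹).bar := by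
  simp only [singularPart, W.bar_add, W.bar_smul, W.bar_bar, map_inv₀, map_pow, map_mul, map_add,
    map_one, Complex.conj_conj, smul_add, smul_smul]
  have e1 : (z ^ 2)⁻¹ * ((z⁻¹) ^ 2)⁻¹ = 1 := by field_simp
  have e2 : (z ^ 2)⁻¹ * (z⁻¹ * (z⁻¹ + 1))⁻¹ = (z + 1)⁻¹ := by
    have : z⁻¹ + 1 = (z + 1) / z := by field_simp; ring
    rw [this]; field_simp
  have e3 : (z ^ 2)⁻¹ * (z⁻¹ + 1)⁻¹ = (z * (z + 1))⁻¹ := by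
    have : z⁻¹ + 1 = (z + 1) / z := by field_simp; ring
    rw [this]; field_simp
  rw [e1, e2, e3, one_smul]
  abel

/-- Each negative Fourier coefficient of `g` vanishes off `0`, hence by continuity on a full
neighbourhood of `0`, and so does its derivative. -/
theorem mem_nonneg_of_eventually {g : ℂ → W ρ} (hg : AnalyticAt ℂ g 0)
    (h : ∀ᶠ z in 𝓝[≠] (0 : ℂ), g z ∈ W.nonneg ρ) :
    g 0 ∈ W.nonneg ρ ∧ deriv g 0 ∈ W.nonneg ρ := by
  have key : ∀ i < 0, ∀ᶠ z in 𝓝 (0 : ℂ), W.coeffCLM i (g z) = 0 := fun i hi => by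
    have hc : ContinuousAt (fun z => W.coeffCLM i (g z)) 0 :=
      (W.coeffCLM i).continuous.continuousAt.comp hg.continuousAt
    exact (hc.eventuallyEq_nhds_iff_eventuallyEq_nhdsNE continuousAt_const).1
      (h.mono fun z hz => hz i hi)
  refine ⟨fun i hi => (key i hi).self_of_nhds, fun i hi => ?_⟩
  have h1 : HasDerivAt (fun z => W.coeffCLM i (g z)) (W.coeffCLM i (deriv g 0)) 0 :=
    (W.coeffCLM i).hasFDerivAt.comp_hasDerivAt _ hg.differentiableAt.hasDerivAt
  have h2 : HasDerivAt (fun z => W.coeffCLM i (g z)) 0 0 :=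
    (hasDerivAt_const (0 : ℂ) (0 : ℂ)).congr_of_eventuallyEq (key i hi)
  exact h1.unique h2

theorem hasResidueAtZero_of_eventually {E : Type*} [NormedAddCommGroup E] [NormedSpace ℂ E]
    [CompleteSpace E] {f : ℂ → E} {R R' : E} (hR : HasResidueAtZero f R)
    (h : ∀ᶠ r in 𝓝[>] (0 : ℝ), (2 * Real.pi * Complex.I : ℂ)⁻¹ • (∮ z in C(0, r), f z) = R') :
    R = R' :=
  tendsto_nhds_unique hR (tendsto_const_nhds.congr' (h.mono fun _ h => h.symm))

/-- Uniformly near `0`, on circles. -/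
theorem eventually_forall_sphere {P : ℂ → Prop} (h : ∀ᶠ z in 𝓝[≠] (0 : ℂ), P z) :
    ∀ᶠ r in 𝓝[>] (0 : ℝ), ∀ z ∈ Metric.sphere (0 : ℂ) r, P z := by
  rw [eventually_nhdsWithin_iff, Metric.eventually_nhds_iff] at h
  obtain ⟨ε, hε, h⟩ := h
  filter_upwards [Ioo_mem_nhdsGT hε] with r hr z hz
  rw [mem_sphere_zero_iff_norm] at hz
  refine h (by rw [dist_zero_right, hz]; exact hr.2) ?_
  rintro rfl
  rw [norm_zero] at hz
  exact hr.1.ne hz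

theorem residue_of_simplePole {E : Type*} [NormedAddCommGroup E] [NormedSpace ℂ E]
    [CompleteSpace E] {f g : ℂ → E} {R : E} (hR : HasResidueAtZero f R) (hg : AnalyticAt ℂ g 0)
    (h : ∀ᶠ z in 𝓝[≠] (0 : ℂ), f z = z⁻¹ • g z) : R = g 0 := by
  refine hasResidueAtZero_of_eventually hR ?_
  obtain ⟨ε, hε, hd⟩ := Metric.eventually_nhds_iff_ball.1
    (Complex.analyticAt_iff_eventually_differentiableAt.1 hg)
  filter_upwards [eventually_forall_sphere h, Ioo_mem_nhdsGT hε] with r hr hrε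
  rw [circleIntegral.integral_congr hrε.1.le (fun z hz => hr z hz)]
  have hdc : DiffContOnCl ℂ g (Metric.ball 0 r) :=
    DifferentiableOn.diffContOnCl_ball (U := Metric.ball 0 ε)
      (fun z hz => (hd z hz).differentiableWithinAt) (Metric.closedBall_subset_ball hrε.2)
  have := hdc.two_pi_i_inv_smul_circleIntegral_sub_inv_smul (Metric.mem_ball_self hrε.1)
  simpa using this

theorem residue_of_doublePole {E : Type*} [NormedAddCommGroup E] [NormedSpace ℂ E]
    [CompleteSpace E] {f g : ℂ → E} {R : E} (hR : HasResidueAtZero f R) (hg : AnalyticAt ℂ g 0)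
    (h : ∀ᶠ z in 𝓝[≠] (0 : ℂ), f z = (z ^ 2)⁻¹ • g z) : R = deriv g 0 := by
  refine hasResidueAtZero_of_eventually hR ?_
  obtain ⟨ε, hε, hd⟩ := Metric.eventually_nhds_iff_ball.1
    (Complex.analyticAt_iff_eventually_differentiableAt.1 hg)
  filter_upwards [eventually_forall_sphere h, Ioo_mem_nhdsGT hε] with r hr hrε
  rw [circleIntegral.integral_congr hrε.1.le (fun z hz => hr z hz)]
  have := Complex.two_pi_I_inv_smul_circleIntegral_sub_sq_inv_smul_of_differentiable
    Metric.isOpen_ball (Metric.closedBall_subset_ball hrε.2)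
    (fun z hz => (hd z hz).differentiableWithinAt) (Metric.mem_ball_self hrε.1)
  simpa using this

theorem AnalyticAt.dslope_self {E : Type*} [NormedAddCommGroup E] [NormedSpace ℂ E] {g : ℂ → E}
    {a : ℂ} (h : AnalyticAt ℂ g a) : AnalyticAt ℂ (dslope g a) a := by
  obtain ⟨p, hp⟩ := h
  exact ⟨_, hp.has_fpower_series_dslope_fslope⟩

/-- The coefficients `A`, `B` of `dz / z²` and `dz / z` in the singular entry of a symmetric
potential, and their properties. -/
theorem exists_singularPart {Ω : Set (OnePoint ℂ)} (hΩ : IsOpen Ω)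
    (hΩ0 : ((0 : ℂ) : OnePoint ℂ) ∈ Ω) {ω : ℂ → W ρ} (hd : DifferentiableOn ℂ ω (puncture Ω))
    (hnn : ∀ z ∈ puncture Ω, ω z ∈ W.nonneg ρ)
    (hsymm : ∀ z ∈ puncture Ω, ω z = (z ^ 2)⁻¹ • (ω (conj z)⁻¹).bar) (hω : SingularEntry ω) :
    ∃ A B : W ρ, A ∈ W.nonneg ρ ∧ B ∈ W.nonneg ρ ∧ A.bar = -A ∧ B.coeff 0 = 0 ∧
      HolomorphicAtZeroInfty (fun z => ω z - singularPart A B z) ∧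
      ∀ r C : ℝ, 0 < r → Metric.closedBall (0 : ℂ) r \ {0} ⊆ puncture Ω →
        (∀ z ∈ Metric.sphere (0 : ℂ) r, ‖ω z‖ ≤ C) → ‖A‖ ≤ r ^ 2 * C ∧ ‖B‖ ≤ r * C := by
  obtain ⟨⟨⟨g, hg, hgω⟩, -⟩, ⟨R, hR, hRre⟩, hR0⟩ := hω
  have hpunct : ∀ᶠ z in 𝓝[≠] (0 : ℂ), z ∈ puncture Ω := by
    have h1 : ∀ᶠ z : ℂ in 𝓝 0, (z : OnePoint ℂ) ∈ Ω :=
      OnePoint.continuous_coe.continuousAt.eventually (hΩ.mem_nhds hΩ0)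
    filter_upwards [self_mem_nhdsWithin, nhdsWithin_le_nhds h1] with z hz hz1
    exact ⟨hz, hz1⟩
  have hgω' : ∀ᶠ z in 𝓝[≠] (0 : ℂ), z ^ 2 • ω z = g z := by
    filter_upwards [hgω, self_mem_nhdsWithin] with z hz hz0
    rw [hz, smul_smul, mul_inv_cancel₀ (pow_ne_zero 2 hz0), one_smul]
  have hgnn : ∀ᶠ z in 𝓝[≠] (0 : ℂ), g z ∈ W.nonneg ρ := by
    filter_upwards [hgω', hpunct] with z hz hz1
    rw [← hz]
    exact Subalgebra.smul_mem _ (hnn z hz1) _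
  obtain ⟨hA, hB⟩ := mem_nonneg_of_eventually hg hgnn
  have hAR : R = g 0 := residue_of_simplePole hR hg <| by
    filter_upwards [hgω, self_mem_nhdsWithin] with z hz hz0
    have hz0 : z ≠ 0 := hz0
    rw [hz, smul_smul]
    congr 1
    field_simp
  have hgc : AnalyticAt ℂ (fun z => W.coeffCLM 0 (g z)) 0 :=
    ((W.coeffCLM (ρ := ρ) 0).analyticAt (g 0)).comp hg
  have hB0 : (0 : ℂ) = deriv (fun z => W.coeffCLM 0 (g z)) 0 :=
    residue_of_doublePole hR0 hgc <| by
      filter_upwards [hgω] with z hz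
      rw [hz]; simp
  have hB0' : (deriv g 0).coeff 0 = 0 := by
    have h1 : HasDerivAt (fun z => W.coeffCLM 0 (g z)) (W.coeffCLM 0 (deriv g 0)) 0 :=
      (W.coeffCLM 0).hasFDerivAt.comp_hasDerivAt _ hg.differentiableAt.hasDerivAt
    rw [h1.deriv] at hB0
    exact hB0.symm
  have hbar : (g 0).bar = -g 0 := by
    rw [hAR, W.re, smul_eq_zero] at hRre
    have := hRre.resolve_left (by norm_num)
    exact eq_neg_of_add_eq_zero_right this
  set A := g 0 with hAdef
  set B := deriv g 0 with hBdef
  have hzero : PoleAtMost 0 (fun z => ω z - singularPart A B z) := by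
    -- `g = A + zB + z²(...)`, the last factor being the second divided slope. The other terms come
    -- from `1/z = 1/(z(z+1)) + 1/(z+1)` and from the part of `singularPart` that is regular at `0`.
    refine ⟨fun z => dslope (dslope g 0) 0 z + (z + 1)⁻¹ • (B - B.bar) - A.bar, ?_, ?_⟩
    · have h1 : AnalyticAt ℂ (fun z : ℂ => (z + 1)⁻¹) 0 :=
        AnalyticAt.inv (by fun_prop) (by simp)
      exact (hg.dslope_self.dslope_self.add (h1.smul analyticAt_const)).sub analyticAt_const
    · have hne : ∀ᶠ z in 𝓝[≠] (0 : ℂ), z ≠ -1 :=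
        nhdsWithin_le_nhds (isOpen_ne.mem_nhds (by norm_num))
      filter_upwards [hgω, self_mem_nhdsWithin, hne] with z hz hz0 hz1
      have hz0 : z ≠ 0 := hz0
      have hz1 : z + 1 ≠ 0 := fun h => hz1 (eq_neg_of_add_eq_zero_left h)
      have e1 : g z = A + z • dslope g 0 z := by
        have := sub_smul_dslope g 0 z
        rw [sub_zero] at this
        rw [this]; abel
      have e2 : dslope g 0 z = B + z • dslope (dslope g 0) 0 z := by
        have := sub_smul_dslope (dslope g 0) 0 z
        rw [sub_zero, dslope_same] at this
        rw [this]; abel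
      rw [hz, e1, e2, singularPart]
      simp only [pow_zero, inv_one, one_smul, smul_add, smul_smul, smul_sub]
      have e3 : (z ^ 2)⁻¹ * (z * z) = 1 := by field_simp
      have e4 : (z ^ 2)⁻¹ * z = z⁻¹ := by field_simp
      have e5 : z⁻¹ = (z * (z + 1))⁻¹ + (z + 1)⁻¹ := by field_simp; ring
      rw [e3, e4, e5]
      module
  refine ⟨A, B, hA, hB, hbar, hB0', ⟨hzero, ?_⟩, fun r C hr hsub hC => ?_⟩
  -- Both `ω` and `singularPart A B` are symmetric, so the extension at `∞` is the conjugate of the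
  -- one at `0`.
  · obtain ⟨F, hF, hFeq⟩ := hzero
    refine ⟨fun w => -(F (conj w)).bar, hF.bar_conj.neg, ?_⟩
    have ht : Tendsto (fun w : ℂ => conj w) (𝓝[≠] 0) (𝓝[≠] 0) := by
      refine tendsto_nhdsWithin_iff.2 ⟨?_, ?_⟩
      · have : Tendsto (fun h : ℂ => conj h) (𝓝 0) (𝓝 0) := by
          simpa using Complex.continuous_conj.tendsto 0
        exact this.mono_left nhdsWithin_le_nhds
      · filter_upwards [self_mem_nhdsWithin] with w hw
        simpa using hw
    have hne : ∀ᶠ z in 𝓝[≠] (0 : ℂ), z ≠ -1 :=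
      nhdsWithin_le_nhds (isOpen_ne.mem_nhds (by norm_num))
    filter_upwards [ht.eventually hFeq, ht.eventually hpunct, ht.eventually hne] with w h1 h2 h3
    have h4 : conj w + 1 ≠ 0 := fun h => h3 (eq_neg_of_add_eq_zero_left h)
    rw [hsymm _ h2, singularPart_symm A B h2.1 h4, Complex.conj_conj, ← smul_sub, ← W.bar_sub] at h1
    simp only [pow_zero, inv_one, one_smul] at h1 ⊢
    rw [← h1, atInfinity, W.bar_smul, W.bar_bar]
    simp
  -- `G` is `z²ω` extended across `0`, with `G(0) = A` and `G'(0) = B`. The two bounds are the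
  -- maximum principle and Cauchy's estimate on the circle of radius `r`.
  · let G := Function.update (fun z => z ^ 2 • ω z) 0 (g 0)
    have hop : IsOpen (puncture Ω ∪ {0}) := by
      have : puncture Ω ∪ {0} = {z : ℂ | (z : OnePoint ℂ) ∈ Ω} := by
        ext z
        rcases eq_or_ne z 0 with rfl | hz
        · simp [hΩ0]
        · simp [puncture, hz]
      rw [this]
      exact hΩ.preimage OnePoint.continuous_coe
    have hGd : DifferentiableOn ℂ G (puncture Ω ∪ {0}) := by
      refine differentiableOn_update hop (fun z hz => ?_) hg.differentiableAt hgω'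
      have hz' : z ∈ puncture Ω := hz.1.resolve_right hz.2
      exact (((differentiableAt_pow 2).smul (hd.differentiableAt
        ((isOpen_puncture hΩ).mem_nhds hz')))).differentiableWithinAt
    have hball : Metric.closedBall (0 : ℂ) r ⊆ puncture Ω ∪ {0} := fun z hz => by
      by_cases h0 : z = 0
      · exact Or.inr h0
      · exact Or.inl (hsub ⟨hz, h0⟩)
    have hGc := hGd.diffContOnCl_ball hball
    have hGs : ∀ z ∈ Metric.sphere (0 : ℂ) r, ‖G z‖ ≤ r ^ 2 * C := fun z hz => by
      have hz' := mem_sphere_zero_iff_norm.1 hz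
      have hz0 : z ≠ 0 := by
        rintro rfl
        rw [norm_zero] at hz'
        exact hr.ne hz'
      simp only [G]
      rw [Function.update_of_ne hz0, norm_smul, norm_pow, hz']
      exact mul_le_mul_of_nonneg_left (hC z hz) (by positivity)
    constructor
    · have h1 := Complex.norm_le_of_forall_mem_frontier_norm_le Metric.isBounded_ball hGc
        (fun z hz => hGs z (by rwa [frontier_ball (0 : ℂ) hr.ne'] at hz))
        (subset_closure (Metric.mem_ball_self hr))
      simpa [G] using h1
    · have h1 := Complex.norm_deriv_le_of_forall_mem_sphere_norm_le hr hGc hGs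
      have h2 : deriv G 0 = deriv g 0 := by
        refine Filter.EventuallyEq.deriv_eq ?_
        rw [eventually_nhdsWithin_iff] at hgω'
        filter_upwards [hgω'] with z hz
        by_cases hz0 : z = 0
        · simp [G, hz0]
        · simp only [G]
          rw [Function.update_of_ne hz0]
          exact hz hz0
      rw [h2] at h1
      refine h1.trans (le_of_eq ?_)
      field_simp

end Singular

/-! ### Linearization of a flat solution along a curve -/

section Linearization

variable {𝒜 : Type*} [NormedRing 𝒜] [NormedAlgebra ℂ 𝒜] [CompleteSpace 𝒜]

/-- If `dZ = -Z Θ` and `Z = 1` at the origin of the curve, with `Θ = O(Y)` and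
`Θ = Θ₀ + o(Y)`, then `Z = 1 - ∫ Θ₀ + o(Y)`. -/
theorem isLittleO_of_hasDerivAlong {ι F : Type*} [NormedAddCommGroup F] {l : Filter ι}
    {δ : ℝ → ℂ} (hδ : Continuous δ) {r : ℝ} (hr : 0 < r) {c : ℝ × ℂ → ℂ} (hcc : Continuous c)
    (hc : ∀ s, ∀ h ∈ Metric.ball (0 : ℂ) 1, c (s, h) = δ s + r * h)
    {Z Θ Θ₀ Q : ι → ℝ × ℂ → 𝒜} {Y : ι → F} {C : ℝ} (hY : Tendsto Y l (𝓝 0))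
    (hZ : ∀ᶠ t in l, HasDerivAlong c (Z t) fun y => -(Z t y * Θ t y))
    (hZ1 : ∀ᶠ t in l, Z t (0, 0) = 1)
    (hQ : ∀ᶠ t in l, HasDerivAlong c (Q t) (Θ₀ t))
    (hΘ : ∀ᶠ t in l, ∀ s ∈ Set.Icc (0 : ℝ) 1, ∀ h ∈ Metric.ball (0 : ℂ) 1,
      ‖Θ t (s, h)‖ ≤ C * ‖Y t‖)
    (hΘ₀ : ∀ ε > 0, ∀ᶠ t in l, ∀ s ∈ Set.Icc (0 : ℝ) 1, ∀ h ∈ Metric.ball (0 : ℂ) 1,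
      ‖Θ t (s, h) - Θ₀ t (s, h)‖ ≤ ε * ‖Y t‖) :
    (fun t => Z t (1, 0) - 1 + (Q t (1, 0) - Q t (0, 0))) =o[l] Y := by
  obtain ⟨K, hK, hmv⟩ := exists_norm_sub_le_of_hasDerivAlong (E := 𝒜) hδ hr hc
  have h0 : (0 : ℂ) ∈ Metric.ball (0 : ℂ) 1 := Metric.mem_ball_self one_pos
  have hYn : Tendsto (fun t => ‖Y t‖) l (𝓝 0) := by simpa using hY.norm
  set C' : ℝ := max C 0 with hC'
  have hC0 : 0 ≤ C' := le_max_right _ _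
  have hsmall : ∀ η > 0, ∀ᶠ t in l, ‖Y t‖ < η := fun η hη => hYn.eventually_lt_const hη
  -- a priori bound
  have hbound : ∀ᶠ t in l, ∀ s ∈ Set.Icc (0 : ℝ) 1, ∀ h ∈ Metric.ball (0 : ℂ) 1,
      ‖Z t (s, h) - 1‖ ≤ K * (2 * ‖(1 : 𝒜)‖ * (C' * ‖Y t‖)) := by
    filter_upwards [hZ, hZ1, hΘ, hsmall (1 / (2 * (K * C' + 1))) (by positivity)]
      with t hZt hZ1t hΘt hYt
    have hcont := hZt.continuous hcc
    obtain ⟨S₀, hS₀⟩ := (isCompact_Icc (a := (0 : ℝ)) (b := 1)).prod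
      (isCompact_closedBall (0 : ℂ) 1) |>.exists_bound_of_continuousOn hcont.continuousOn
    let B : Set ℝ := (fun y => ‖Z t y‖) '' (Set.Icc (0 : ℝ) 1 ×ˢ Metric.ball (0 : ℂ) 1)
    have hBb : BddAbove B := ⟨S₀, by
      rintro _ ⟨y, hy, rfl⟩
      exact hS₀ y ⟨hy.1, Metric.ball_subset_closedBall hy.2⟩⟩
    have hBn : B.Nonempty := ⟨_, ⟨(0, 0), ⟨by simp, h0⟩, rfl⟩⟩
    set S := sSup B with hS
    have hle : ∀ s ∈ Set.Icc (0 : ℝ) 1, ∀ h ∈ Metric.ball (0 : ℂ) 1, ‖Z t (s, h)‖ ≤ S :=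
      fun s hs h hh => le_csSup hBb ⟨(s, h), ⟨hs, hh⟩, rfl⟩
    have hS0 : 0 ≤ S := (norm_nonneg _).trans (hle 0 (by simp) 0 h0)
    have hest : ∀ s ∈ Set.Icc (0 : ℝ) 1, ∀ h ∈ Metric.ball (0 : ℂ) 1,
        ‖Z t (s, h) - 1‖ ≤ K * (S * (C' * ‖Y t‖)) := fun s hs h hh => by
      have := hmv (Z t) _ (S * (C' * ‖Y t‖)) hZt (fun s hs h hh => by
        rw [norm_neg]
        refine (norm_mul_le _ _).trans (mul_le_mul (hle s hs h hh) ?_ (norm_nonneg _) hS0)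
        exact (hΘt s hs h hh).trans
          (mul_le_mul_of_nonneg_right (le_max_left C 0) (norm_nonneg _))) s hs h hh
      rwa [hZ1t] at this
    have hhalf : K * (C' * ‖Y t‖) ≤ 1 / 2 := by
      have h1 : K * C' * ‖Y t‖ ≤ (K * C' + 1) * (1 / (2 * (K * C' + 1))) :=
        mul_le_mul (by linarith) hYt.le (norm_nonneg _) (by positivity)
      have h2 : (K * C' + 1) * (1 / (2 * (K * C' + 1))) = 1 / 2 := by
        have : K * C' + 1 ≠ 0 := by positivity
        field_simp
      linarith
    -- For small `Y` the mean value inequality gives `S ≤ ‖1‖ + S/2`. As the supremum `S` is finite,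
    -- the last term can be absorbed.
    have hS2 : S ≤ 2 * ‖(1 : 𝒜)‖ := by
      have : S ≤ ‖(1 : 𝒜)‖ + S * (1 / 2) := by
        refine csSup_le hBn ?_
        rintro _ ⟨⟨s, h⟩, hy, rfl⟩
        have h1 := hest s hy.1 h hy.2
        have h2 : ‖Z t (s, h)‖ ≤ ‖Z t (s, h) - 1‖ + ‖(1 : 𝒜)‖ := by
          simpa using norm_add_le (Z t (s, h) - 1) 1
        have h3 := mul_le_mul_of_nonneg_left hhalf hS0
        simp only
        nlinarith
      linarith
    intro s hs h hh
    refine (hest s hs h hh).trans (mul_le_mul_of_nonneg_left ?_ hK)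
    exact mul_le_mul_of_nonneg_right hS2 (by positivity)
  rw [Asymptotics.isLittleO_iff]
  intro ε hε
  set D : ℝ := K * (2 * ‖(1 : 𝒜)‖ * C') * C' with hD
  have hD0 : 0 ≤ D := by positivity
  have hη : 0 < ε / (K + 1) / (D + 1 + 1) := by positivity
  filter_upwards [hZ, hZ1, hQ, hΘ, hbound, hΘ₀ (ε / (K + 1) / (D + 1 + 1)) hη,
    hsmall _ hη] with t hZt hZ1t hQt hΘt hbt hΘ₀t hYt
  set η := ε / (K + 1) / (D + 1 + 1) with hηd
  -- The derivative of `Z + Q` is `-(Z - 1)Θ - (Θ - Θ₀)`: the first term is quadratic in `Y` by the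
  -- a priori bound, and the second is a small multiple of `‖Y‖`.
  have hV := hZt.add hQt
  have := hmv _ _ (ε / (K + 1) * ‖Y t‖) hV (fun s hs h hh => by
    have e : -(Z t (s, h) * Θ t (s, h)) + Θ₀ t (s, h) =
      -((Z t (s, h) - 1) * Θ t (s, h)) - (Θ t (s, h) - Θ₀ t (s, h)) := by noncomm_ring
    rw [e]
    refine (norm_sub_le _ _).trans ?_
    rw [norm_neg]
    have h1 := (norm_mul_le (Z t (s, h) - 1) (Θ t (s, h))).trans
      (mul_le_mul (hbt s hs h hh) ((hΘt s hs h hh).trans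
          (mul_le_mul_of_nonneg_right (le_max_left C 0) (norm_nonneg _))) (norm_nonneg _)
        (by positivity))
    have h2 := hΘ₀t s hs h hh
    have h3 : K * (2 * ‖(1 : 𝒜)‖ * (C' * ‖Y t‖)) * (C' * ‖Y t‖) = D * ‖Y t‖ * ‖Y t‖ := by
      rw [hD]; ring
    have h4 : D * ‖Y t‖ * ‖Y t‖ ≤ D * ‖Y t‖ * η :=
      mul_le_mul_of_nonneg_left hYt.le (by positivity)
    have h5 : η * (D + 1 + 1) = ε / (K + 1) := div_mul_cancel₀ _ (by positivity)
    have h6 : ε / (K + 1) * ‖Y t‖ = D * ‖Y t‖ * η + η * ‖Y t‖ + η * ‖Y t‖ := by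
      rw [← h5]; ring
    have h7 : 0 ≤ η * ‖Y t‖ := by positivity
    change _ + ‖Θ t (s, h) - Θ₀ t (s, h)‖ ≤ _
    linarith) 1 (by simp) 0 h0
  have h8 : Z t (1, 0) - 1 + (Q t (1, 0) - Q t (0, 0)) =
      Z t (1, 0) + Q t (1, 0) - (Z t (0, 0) + Q t (0, 0)) := by rw [hZ1t]; abel
  rw [h8]
  refine this.trans ?_
  have h9 : K * (ε / (K + 1) * ‖Y t‖) = (K / (K + 1)) * (ε * ‖Y t‖) := by ring
  rw [h9]
  refine mul_le_of_le_one_left (by positivity) ?_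
  rw [div_le_one (by positivity)]
  linarith

end Linearization

/-! ### Matrices over `𝒲` -/

section MatrixCalculus

open scoped Matrix.Norms.Operator

variable {ρ : ℝ} [hρ : Fact (1 < ρ)]

instance Matrix.completeSpace_linftyOp : @CompleteSpace (Matrix (Fin 2) (Fin 2) (W ρ))
    PseudoMetricSpace.toUniformSpace :=
  (inferInstance : CompleteSpace (Fin 2 → Fin 2 → W ρ))

theorem Matrix.norm_entry_le (M : Matrix (Fin 2) (Fin 2) (W ρ)) (i j : Fin 2) :
    ‖M i j‖ ≤ ‖M‖ := by
  rw [Matrix.linfty_opNorm_def]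
  have h : ‖M i j‖₊ ≤ Finset.univ.sup fun i => ∑ j, ‖M i j‖₊ :=
    (Finset.single_le_sum (f := fun j => ‖M i j‖₊) (fun _ _ => zero_le) (Finset.mem_univ j)).trans
      (Finset.le_sup (f := fun i => ∑ j, ‖M i j‖₊) (Finset.mem_univ i))
  exact_mod_cast h

/-- The entry `(i, j)` of a matrix over `𝒲`. -/
def Matrix.entryCLM (i j : Fin 2) : Matrix (Fin 2) (Fin 2) (W ρ) →L[ℂ] W ρ :=
  LinearMap.mkContinuous
    { toFun := fun M => M i j
      map_add' := fun _ _ => rfl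
      map_smul' := fun _ _ => rfl } 1 fun M => by
        rw [one_mul]
        exact Matrix.norm_entry_le M i j

theorem Matrix.norm_le_of_entry {M : Matrix (Fin 2) (Fin 2) (W ρ)} {C : ℝ}
    (h : ∀ i j, ‖M i j‖ ≤ C) : ‖M‖ ≤ 2 * C := by
  have hC : 0 ≤ C := (norm_nonneg _).trans (h 0 0)
  rw [Matrix.linfty_opNorm_def]
  lift C to NNReal using hC
  have h : (Finset.univ.sup fun i => ∑ j, ‖M i j‖₊) ≤ 2 * C := Finset.sup_le fun i _ => by
    rw [Fin.sum_univ_two, two_mul]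
    exact add_le_add (by exact_mod_cast h i 0) (by exact_mod_cast h i 1)
  exact_mod_cast h

/-- The matrix with only entry `f` at `(i, j)`. -/
def Matrix.singleCLM (i j : Fin 2) : W ρ →L[ℂ] Matrix (Fin 2) (Fin 2) (W ρ) :=
  LinearMap.mkContinuous (Matrix.singleLinearMap ℂ i j) 2 fun f => by
    refine Matrix.norm_le_of_entry fun a b => ?_
    rw [Matrix.singleLinearMap_apply, Matrix.single_apply]
    split_ifs <;> simp

theorem Matrix.sum_singleCLM (M : Matrix (Fin 2) (Fin 2) (W ρ)) :
    M = ∑ i, ∑ j, Matrix.singleCLM i j (M i j) :=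
  Matrix.matrix_eq_sum_single M

theorem HasDerivAlong.matrix {Z : Type*} [TopologicalSpace Z] {c : Z → ℂ}
    {V V' : Z → Matrix (Fin 2) (Fin 2) (W ρ)}
    (h : ∀ i j, HasDerivAlong c (fun y => V y i j) fun y => V' y i j) : HasDerivAlong c V V' := by
  have h1 := (((h 0 0).clm (Matrix.singleCLM 0 0)).add ((h 0 1).clm (Matrix.singleCLM 0 1))).add
    (((h 1 0).clm (Matrix.singleCLM 1 0)).add ((h 1 1).clm (Matrix.singleCLM 1 1)))
  refine h1.congr (fun y => ?_) fun y => ?_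
  · have := Matrix.sum_singleCLM (V y)
    simp only [Fin.sum_univ_two] at this
    exact this
  · have := Matrix.sum_singleCLM (V' y)
    simp only [Fin.sum_univ_two] at this
    exact this

theorem Matrix.differentiableOn_of_entry {F : ℂ → Matrix (Fin 2) (Fin 2) (W ρ)} {S : Set ℂ}
    (h : ∀ i j, DifferentiableOn ℂ (fun w => F w i j) S) : DifferentiableOn ℂ F S := by
  have h1 : DifferentiableOn ℂ (fun w => ∑ i, ∑ j, Matrix.singleCLM i j (F w i j)) S :=
    DifferentiableOn.fun_sum fun i _ => DifferentiableOn.fun_sum fun j _ =>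
      (Matrix.singleCLM (ρ := ρ) i j).differentiable.comp_differentiableOn (h i j)
  exact h1.congr fun w _ => Matrix.sum_singleCLM (F w)

end MatrixCalculus

/-! ### A tube around the curve -/

section Tube

variable {X : Type*} [TopologicalSpace X]

/-- In the coordinate `w = 1 / (z + 1)`: a map `C` of `ℂ × ℂ` into `Ω` filling the disk bounded
by the curve `δ'`, so that `(s, h) ↦ C (e^{2πis}, h)` is a thickening `δ + r h` of the curve,
and a lift `x` of this thickening to the covering. -/
structure Tube (Ω : Set (OnePoint ℂ)) (p : X → puncture Ω) (δ' : C(unitInterval, X)) where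
  C : ℂ × ℂ → ℂ
  continuous_C : Continuous C
  mem_wplane : ∀ q, C q ∈ wplane Ω
  δ : ℝ → ℂ
  continuous_δ : Continuous δ
  r : ℝ
  r_pos : 0 < r
  apply_circ : ∀ s, ∀ h ∈ Metric.ball (0 : ℂ) 1, C (circ s, h) = δ s + r * h
  ne_zero : ∀ y : ℝ × ℂ, C (circ y.1, y.2) ≠ 0
  ne_one : ∀ y : ℝ × ℂ, C (circ y.1, y.2) ≠ 1
  x : ℝ × ℂ → X
  continuous_x : Continuous x
  apply_x : ∀ y, (p (x y) : ℂ) = (C (circ y.1, y.2))⁻¹ - 1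
  x_zero : x (0, 0) = δ' 0
  x_one : x (1, 0) = δ' 1
  κ : ℂ
  κ_ne_zero : κ ≠ 0
  conj_κ : conj κ = -κ
  index : ∀ a : ℂ, a = 0 ∨ a = 1 → ∀ θ : ℝ × ℂ → ℂ, Continuous θ →
    (∀ y, Complex.exp (θ y) = C (circ y.1, y.2) - a) → θ (1, 0) - θ (0, 0) = κ

/-- The embedded disk is extended to all of `ℂ` by the radial retraction and then thickened by a
small `r`. As `ℂ × ℂ` is simply connected, an equation with holomorphic coefficients on `Ω` can be
solved globally on this parameter space. The boundary part avoids the punctures and so lifts to the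
covering. -/
theorem exists_tube {Ω : Set (OnePoint ℂ)} (hΩo : IsOpen Ω)
    (hΩ1 : ((-1 : ℂ) : OnePoint ℂ) ∉ Ω) {p : X → puncture Ω} (hp : IsCoveringMap p)
    {δ' : C(unitInterval, X)} (hδ : BoundsDisk Ω fun s => ((p (δ' s) : ℂ) : OnePoint ℂ)) :
    Nonempty (Tube Ω p δ') := by
  obtain ⟨ψ, hψc, hψi, hψm, ⟨a, ha, hψa⟩, ⟨b, hb, hψb⟩, hψδ⟩ := hδ
  have hne : ∀ z ∈ Ω, z ≠ ((-1 : ℂ) : OnePoint ℂ) := fun z hz h => hΩ1 (h ▸ hz)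
  let φ : ℂ → ℂ := fun z => ofSphere (ψ (retr z))
  have hφ : ∀ z ∈ Metric.closedBall (0 : ℂ) 1, φ z = ofSphere (ψ z) := fun z hz => by
    simp only [φ, retr_of_mem hz]
  have hφc : Continuous φ := by
    have h1 : Continuous fun z => ψ (retr z) := hψc.comp_continuous continuous_retr retr_mem
    exact continuous_iff_continuousAt.2 fun z => ContinuousAt.comp (f := fun z => ψ (retr z))
      (continuousAt_ofSphere (hne _ (hψm (retr_mem z)))) h1.continuousAt
  have hφi : Set.InjOn φ (Metric.closedBall 0 1) := fun z hz z' hz' h => by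
    rw [hφ z hz, hφ z' hz'] at h
    refine hψi hz hz' ?_
    rw [← toSphere_ofSphere (hne _ (hψm hz)), h, toSphere_ofSphere (hne _ (hψm hz'))]
  have hφa : φ a = 1 := by rw [hφ a (Metric.ball_subset_closedBall ha), hψa]; simp
  have hφb : φ b = 0 := by rw [hφ b (Metric.ball_subset_closedBall hb), hψb]; simp
  have hφm : ∀ z, φ z ∈ wplane Ω := fun z => ofSphere_mem_wplane hΩ1 (hψm (retr_mem z))
  obtain ⟨κ, hκ, hκ', hindex⟩ := exists_index hφc hφi
  -- `r₁` keeps the thickened disk inside `Ω`, and `r₂` keeps the thickened boundary away from `w =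
  -- 0` and `w = 1`.
  obtain ⟨r₁, hr₁, hsub₁⟩ := ((isCompact_closedBall (0 : ℂ) 1).image
    hφc).exists_cthickening_subset_open (isOpen_wplane hΩo) (by
      rintro _ ⟨z, -, rfl⟩
      exact hφm z)
  obtain ⟨r₂, hr₂, hsub₂⟩ := ((isCompact_sphere (0 : ℂ) 1).image
    hφc).exists_cthickening_subset_open (t := {0, 1}ᶜ)
    ((Set.toFinite ({0, 1} : Set ℂ)).isClosed.isOpen_compl) (by
      rintro _ ⟨z, hz, rfl⟩
      have hz1 : z ∉ Metric.ball (0 : ℂ) 1 := fun h => by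
        rw [mem_sphere_zero_iff_norm] at hz
        rw [mem_ball_zero_iff, hz] at h
        exact lt_irrefl _ h
      rintro (h | h)
      · have h : φ z = φ b := by rw [hφb]; exact h
        exact hz1 (hφi (Metric.sphere_subset_closedBall hz) (Metric.ball_subset_closedBall hb) h ▸ hb)
      · have h : φ z = φ a := by rw [hφa]; exact h
        exact hz1 (hφi (Metric.sphere_subset_closedBall hz) (Metric.ball_subset_closedBall ha) h ▸ ha))
  set r := min r₁ r₂ with hr
  have hr0 : 0 < r := lt_min hr₁ hr₂
  let C : ℂ × ℂ → ℂ := fun q => φ (retr q.1) + r * retr q.2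
  have hdist : ∀ q, dist (C q) (φ (retr q.1)) ≤ r := fun q => by
    have h1 : ‖retr q.2‖ ≤ 1 := mem_closedBall_zero_iff.1 (retr_mem q.2)
    simp only [C, dist_eq_norm, add_sub_cancel_left, norm_mul, Complex.norm_real,
      Real.norm_of_nonneg hr0.le]
    exact mul_le_of_le_one_right hr0.le h1
  have hretr := continuous_retr
  have hcirc := continuous_circ
  have hC : Continuous C := by fun_prop
  have hCm : ∀ q, C q ∈ wplane Ω := fun q =>
    hsub₁ (Metric.mem_cthickening_of_dist_le _ _ _ _ ⟨_, retr_mem q.1, rfl⟩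
      ((hdist q).trans (min_le_left _ _)))
  have hC01 : ∀ y : ℝ × ℂ, C (circ y.1, y.2) ∈ ({0, 1} : Set ℂ)ᶜ := fun y =>
    hsub₂ (Metric.mem_cthickening_of_dist_le _ _ _ _
      ⟨retr (circ y.1), by rw [retr_of_mem (circ_mem _)]; simp [norm_circ], rfl⟩
      ((hdist (circ y.1, y.2)).trans (min_le_right _ _)))
  have hC0 : ∀ y : ℝ × ℂ, C (circ y.1, y.2) ≠ 0 := fun y h => hC01 y (Or.inl h)
  have hC1 : ∀ y : ℝ × ℂ, C (circ y.1, y.2) ≠ 1 := fun y h => hC01 y (Or.inr h)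
  have hCs : ∀ s, C (circ s, 0) = φ (circ s) := fun s => by
    have : retr 0 = 0 := retr_of_mem (by simp)
    simp only [C, this, mul_zero, add_zero, retr_of_mem (circ_mem s)]
  have hφδ : ∀ s : unitInterval, φ (circ s) = ((p (δ' s) : ℂ) + 1)⁻¹ := fun s => by
    rw [hφ _ (circ_mem _), circ, ← hψδ s, ofSphere_coe]
  let f : C(ℝ × ℂ, puncture Ω) :=
    ⟨fun y => ⟨(C (circ y.1, y.2))⁻¹ - 1, sub_one_mem_puncture (hCm _) (hC0 y) (hC1 y)⟩,
      ((hC.comp (by fun_prop)).inv₀ hC0 |>.sub continuous_const).subtype_mk _⟩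
  have hf : ∀ s : unitInterval, p (δ' s) = f ((s : ℝ), 0) := fun s => Subtype.ext <| by
    simp only [f, ContinuousMap.coe_mk, hCs, hφδ, inv_inv, add_sub_cancel_right]
  obtain ⟨x, ⟨hx0, hx⟩, -⟩ := hp.existsUnique_continuousMap_lifts f (0, 0) (δ' 0) (by
    simpa using hf 0)
  have hx' : ∀ y, p (x y) = f y := fun y => congrFun hx y
  -- By uniqueness of lifts, the lifted tube restricts to `δ'` on its core, so its ends are the ends
  -- of `δ'`.
  have hxδ := hp.eq_of_comp_eq (g₁ := fun s : unitInterval => x ((s : ℝ), 0)) (g₂ := δ')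
    (by fun_prop) δ'.continuous (funext fun s => by simp [hx', hf]) 0 (by simpa using hx0)
  exact ⟨{
    C := C
    continuous_C := hC
    mem_wplane := hCm
    δ := fun s => φ (circ s)
    continuous_δ := by fun_prop
    r := r
    r_pos := hr0
    apply_circ := fun s h hh => by
      simp only [C, retr_of_mem (circ_mem s), retr_of_mem (Metric.ball_subset_closedBall hh)]
    ne_zero := hC0
    ne_one := hC1
    x := x
    continuous_x := x.continuous
    apply_x := fun y => by rw [hx' y]; rfl
    x_zero := hx0
    x_one := by simpa using congrFun hxδ 1
    κ := κ
    κ_ne_zero := hκ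
    conj_κ := hκ'
    index := fun a' ha' θ hθ h => by
      have h1 : ∀ s : ℝ, Complex.exp (θ (s, 0)) = φ (circ s) - a' := fun s => by rw [h, hCs]
      rcases ha' with rfl | rfl
      · exact hindex b hb (fun s => θ (s, 0)) (by fun_prop) fun s => by rw [h1, hφb]
      · exact hindex a ha (fun s => θ (s, 0)) (by fun_prop) fun s => by rw [h1, hφa] }⟩

end Tube

/-! ### Solutions on the covering -/

section SolutionCalculus

open scoped Matrix.Norms.Operator

variable {ρ : ℝ} [hρ : Fact (1 < ρ)] {X : Type*} [TopologicalSpace X]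

theorem isLocalHomeomorph_coe {U : Set ℂ} (hU : IsOpen U) {p : X → U} (hp : IsCoveringMap p) :
    IsLocalHomeomorph fun x => (p x : ℂ) :=
  hU.isOpenEmbedding_subtypeVal.isLocalHomeomorph.comp hp.isLocalHomeomorph

theorem IsSolution.hasDerivAlong {U : Set ℂ} (hU : IsOpen U) {p : X → U} (hp : IsCoveringMap p)
    {ξ : DPWPotential ρ} {Φ : X → SL(2, W ρ)} (h : IsSolution p ξ Φ) :
    HasDerivAlong (fun x => (p x : ℂ)) (fun x => (Φ x).1)
      fun x => (Φ x).1 * ξ.toMatrix (p x) := by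
  refine HasDerivAlong.matrix fun i j x => ?_
  obtain ⟨e, hx, he⟩ := isLocalHomeomorph_coe hU hp x
  have he' : ∀ y, (p y : ℂ) = e y := fun y => congrFun he y
  refine ⟨fun z => (Φ (e.symm z)).1 i j, ?_⟩
  filter_upwards [e.open_source.mem_nhds hx] with y hy
  have h1 : e.symm (p y) = y := by rw [he', e.left_inv hy]
  have hmem : (p y : ℂ) ∈ e.target := he' y ▸ e.map_source hy
  refine ⟨by rw [h1], h y e.symm h1 (e.continuousAt_symm hmem) ?_ i j⟩
  filter_upwards [e.open_target.mem_nhds hmem] with z hz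
  rw [he', e.right_inv hz]

/-- The second column of the solutions of `dΦ = Φ ξ` for `ξ = λ⁻¹ E₀₁ k dz / (z + 1)²`. -/
theorem IsSolution.eq_of_nilpotent [PathConnectedSpace X] {U : Set ℂ} (hU : IsOpen U)
    (hU1 : ∀ z ∈ U, z + 1 ≠ 0) {p : X → U} (hp : IsCoveringMap p) {ξ : DPWPotential ρ}
    {Φ : X → SL(2, W ρ)} (h : IsSolution p ξ Φ) {k : ℂ}
    (hξ : ∀ z ∈ U, ξ.toMatrix z = (k / (z + 1) ^ 2) • !![0, W.monomial (-1); 0, 0])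
    {x₁ : X} (hx₁ : (p x₁ : ℂ) = 1) (hdiag : (Φ x₁).1.IsDiag) :
    ∃ d e : W ρ, d * e = 1 ∧ ∀ x,
      (Φ x).1 0 1 = d * ((k * (1 / 2 - ((p x : ℂ) + 1)⁻¹)) • W.monomial (-1)) ∧
      (Φ x).1 1 1 = e := by
  -- The primitive of `λ⁻¹k dz/(z+1)²` that vanishes at `z = 1`, where `Φ` is diagonal. As the
  -- potential is nilpotent, `1 - u E₀₁` is the inverse of the solution equal to `1` there, and `Φ`
  -- times it is constant.
  let u : ℂ → W ρ := fun z => (k * (1 / 2 - (z + 1)⁻¹)) • W.monomial (-1)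
  let G : ℂ → Matrix (Fin 2) (Fin 2) (W ρ) := fun z => 1 - Matrix.singleCLM 0 1 (u z)
  have hu : ∀ x : X, HasDerivAt u ((k / ((p x : ℂ) + 1) ^ 2) • W.monomial (-1)) (p x) := fun x => by
    have hne := hU1 _ (p x).2
    have h1 : HasDerivAt (fun z : ℂ => (z + 1)⁻¹) (-1 / ((p x : ℂ) + 1) ^ 2) (p x) :=
      ((hasDerivAt_id (p x : ℂ)).add_const 1).fun_inv hne
    have h2 := ((h1.const_sub (1 / 2)).const_mul k).smul_const (W.monomial (ρ := ρ) (-1))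
    have e : k * -(-1 / ((p x : ℂ) + 1) ^ 2) = k / ((p x : ℂ) + 1) ^ 2 := by ring
    rwa [e] at h2
  have hG : HasDerivAlong (fun x => (p x : ℂ)) (fun x => G (p x))
      fun x => -Matrix.singleCLM 0 1 ((k / ((p x : ℂ) + 1) ^ 2) • W.monomial (-1)) :=
    HasDerivAlong.of_hasDerivAt (F := G) (F' := fun z => -Matrix.singleCLM 0 1
      ((k / (z + 1) ^ 2) • W.monomial (-1))) fun x =>
      ((Matrix.singleCLM (ρ := ρ) 0 1).hasFDerivAt.comp_hasDerivAt _ (hu x)).const_sub 1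
  have hV := (h.hasDerivAlong hU hp).mul hG
  have hV0 : HasDerivAlong (fun x => (p x : ℂ)) (fun x => (Φ x).1 * G (p x)) fun _ => 0 := by
    refine hV.congr (fun _ => rfl) fun x => ?_
    rw [mul_assoc, ← mul_add, hξ _ (p x).2]
    refine (mul_eq_zero_of_right _ ?_).symm
    have e : !![0, W.monomial (-1); 0, 0] =
        (Matrix.single 0 1 (W.monomial (-1)) : Matrix (Fin 2) (Fin 2) (W ρ)) := by
      refine Matrix.ext fun i j => ?_
      fin_cases i <;> fin_cases j <;> simp
    have e2 : ∀ f : W ρ, Matrix.singleCLM 0 1 f = Matrix.single 0 1 f := fun _ => rfl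
    simp only [G, e, e2, Matrix.smul_single, mul_sub, mul_one]
    rw [Matrix.single_mul_single_of_ne (h := by decide)]
    simp
  have hloc := hV0.isLocallyConstant (isLocalHomeomorph_coe hU hp).isOpenMap
    (isLocalHomeomorph_coe hU hp).continuous
  have hG1 : G (p x₁) = 1 := by
    simp only [G, u, hx₁]
    norm_num
  have hconst : ∀ x, (Φ x).1 * G (p x) = (Φ x₁).1 := fun x => by
    have := hloc.apply_eq_of_preconnectedSpace x x₁
    rwa [hG1, mul_one] at this
  have hΦ : ∀ x, (Φ x).1 = (Φ x₁).1 * (1 + Matrix.single 0 1 (u (p x))) := fun x => by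
    have e : G (p x) * (1 + Matrix.single 0 1 (u (p x))) = 1 := by
      have e2 : ∀ f : W ρ, Matrix.singleCLM 0 1 f = Matrix.single 0 1 f := fun _ => rfl
      simp only [G, e2, mul_add, mul_one, sub_mul, one_mul]
      rw [Matrix.single_mul_single_of_ne (h := by decide)]
      simp
    rw [← hconst x, mul_assoc, e, mul_one]
  have h01 : (Φ x₁).1 0 1 = 0 := hdiag (by decide)
  have h10 : (Φ x₁).1 1 0 = 0 := hdiag (by decide)
  refine ⟨(Φ x₁).1 0 0, (Φ x₁).1 1 1, ?_, fun x => ⟨?_, ?_⟩⟩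
  · have := (Φ x₁).2
    rw [Matrix.det_fin_two, h01, h10] at this
    simpa using this
  · rw [hΦ x]
    simp [Matrix.mul_apply, Matrix.add_apply, h01, u]
  · rw [hΦ x]
    simp [Matrix.mul_apply, Matrix.add_apply, h10]

/-- For `Φ = [[a, b], [c, d]]` of determinant one, `Φ E₁₀ Φ⁻¹`. -/
def nilConj (b d : W ρ) : Matrix (Fin 2) (Fin 2) (W ρ) := !![b * d, -b ^ 2; d ^ 2, -(b * d)]

/-- Only the second column of `Φ` enters, which is why only that column of `Φ_0` has to be computed.
-/
theorem conj_single (Φ : SL(2, W ρ)) (g : W ρ) :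
    Φ.1 * Matrix.single 1 0 g * (Φ⁻¹).1 = g • nilConj (Φ.1 0 1) (Φ.1 1 1) := by
  rw [Matrix.SpecialLinearGroup.coe_inv, Matrix.adjugate_fin_two]
  refine Matrix.ext fun i j => ?_
  fin_cases i <;> fin_cases j <;> simp [nilConj, Matrix.mul_apply, Fin.sum_univ_two] <;> ring

theorem SL_isUnit (M : SL(2, W ρ)) : IsUnit M.1 :=
  (Matrix.isUnit_iff_isUnit_det _).2 (by rw [M.2]; exact isUnit_one)

theorem SL_mul_inv (M : SL(2, W ρ)) : M.1 * (M⁻¹).1 = 1 := by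
  have := congrArg Subtype.val (mul_inv_cancel M)
  simpa only [Matrix.SpecialLinearGroup.coe_mul, Matrix.SpecialLinearGroup.coe_one] using this

theorem SL_inv_mul (M : SL(2, W ρ)) : (M⁻¹).1 * M.1 = 1 := by
  have := congrArg Subtype.val (inv_mul_cancel M)
  simpa only [Matrix.SpecialLinearGroup.coe_mul, Matrix.SpecialLinearGroup.coe_one] using this

theorem SL_ringInverse (M : SL(2, W ρ)) : Ring.inverse M.1 = (M⁻¹).1 :=
  Ring.inverse_unit (⟨M.1, (M⁻¹).1, SL_mul_inv M, SL_inv_mul M⟩ : (Matrix (Fin 2) (Fin 2) (W ρ))ˣ)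

/-- The quotient of a solution for the regular part `F` of the potential by a solution for the
potential itself. -/
theorem Tube.exists_quotient {Ω : Set (OnePoint ℂ)} (hΩo : IsOpen Ω) {p : X → puncture Ω}
    (hp : IsCoveringMap p) {δ' : C(unitInterval, X)} (τ : Tube Ω p δ')
    {ξ : DPWPotential ρ} {Φ : X → SL(2, W ρ)} (h : IsSolution p ξ Φ)
    {F : ℂ → Matrix (Fin 2) (Fin 2) (W ρ)} {g : ℂ → W ρ} (hF : DifferentiableOn ℂ F (wplane Ω))
    (hFg : ∀ w ≠ 0, w ≠ 1 → -(w ^ 2)⁻¹ • ξ.toMatrix (w⁻¹ - 1) = F w + Matrix.single 1 0 (g w)) :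
    ∃ Z : ℝ × ℂ → Matrix (Fin 2) (Fin 2) (W ρ), Z (0, 0) = 1 ∧
      Z (1, 0) = ((monodromy Φ δ')⁻¹).1 ∧
      HasDerivAlong (fun y : ℝ × ℂ => τ.C (circ y.1, y.2)) Z fun y =>
        -(Z y * (g (τ.C (circ y.1, y.2)) • nilConj ((Φ (τ.x y)).1 0 1) ((Φ (τ.x y)).1 1 1))) := by
  -- `T` lives on the filled disk, so it takes the same value at `circ 0` and `circ 1`. This common
  -- value is chosen as `Φ (δ' 0)`; then `T Φ⁻¹` ends at the inverse monodromy.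
  obtain ⟨T, hT0, -, hT⟩ := exists_solution_along (isOpen_wplane hΩo) hF τ.continuous_C
    τ.mem_wplane (circ 0, (0 : ℂ)) (SL_isUnit (Φ (δ' 0)))
  have hcirc := continuous_circ
  have hT' := hT.comp (e := fun y : ℝ × ℂ => (circ y.1, y.2)) (by fun_prop)
  have hΦ := ((h.hasDerivAlong (isOpen_puncture hΩo) hp).comp τ.continuous_x).change
    (b := fun y : ℝ × ℂ => τ.C (circ y.1, y.2)) (φ := fun w => w⁻¹ - 1)
    (φ' := fun w => -(w ^ 2)⁻¹) (fun y => (τ.apply_x y).symm)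
    fun y => (hasDerivAt_inv (τ.ne_zero y)).sub_const 1
  have hZ := hT'.mul (hΦ.ringInverse fun y => SL_isUnit _)
  refine ⟨fun y => T (circ y.1, y.2) * Ring.inverse (Φ (τ.x y)).1, ?_, ?_, ?_⟩
  · simp only [hT0, τ.x_zero, SL_ringInverse, SL_mul_inv]
  · simp only [circ_one, hT0, τ.x_one, SL_ringInverse, monodromy, mul_inv_rev, inv_inv]
    rfl
  · refine hZ.congr (fun _ => rfl) fun y => ?_
    rw [← conj_single, τ.apply_x, ← mul_smul_comm, hFg _ (τ.ne_zero y) (τ.ne_one y)]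
    simp only [SL_ringInverse]
    set Ψ := (Φ (τ.x y))
    set w := τ.C (circ y.1, y.2)
    have e1 : Ψ⁻¹.1 * (Ψ.1 * (F w + Matrix.single 1 0 (g w))) * Ψ⁻¹.1 =
        (F w + Matrix.single 1 0 (g w)) * Ψ⁻¹.1 := by
      rw [← mul_assoc Ψ⁻¹.1, SL_inv_mul, one_mul]
    have e2 : T (circ y.1, y.2) * Ψ⁻¹.1 * (Ψ.1 * Matrix.single 1 0 (g w) * Ψ⁻¹.1) =
        T (circ y.1, y.2) * (Matrix.single 1 0 (g w) * Ψ⁻¹.1) := by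
      rw [mul_assoc, ← mul_assoc Ψ⁻¹.1, ← mul_assoc Ψ⁻¹.1, SL_inv_mul, one_mul]
    rw [e1, e2]
    noncomm_ring

end SolutionCalculus

/-! ### Linearization of the monodromy -/

section MonodromyLinearization

open scoped Matrix.Norms.Operator

variable {ρ : ℝ} [hρ : Fact (1 < ρ)] {X : Type*} [TopologicalSpace X]

/-- The singular part in the coordinate `w = 1 / (z + 1)`. -/
theorem neg_smul_singularPart {A B : W ρ} (hA : A.bar = -A) {w : ℂ} (h0 : w ≠ 0) (h1 : w ≠ 1) :
    -(w ^ 2)⁻¹ • singularPart A B (w⁻¹ - 1) =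
      (w - 1)⁻¹ • B - w⁻¹ • B.bar - ((w - 1) ^ 2)⁻¹ • A + (w ^ 2)⁻¹ • A := by
  have h1' : w - 1 ≠ 0 := sub_ne_zero.2 h1
  have h2 : w⁻¹ - 1 ≠ 0 := by rw [sub_ne_zero, ne_eq, inv_eq_one]; exact h1
  have e1 : w⁻¹ - 1 = -(w - 1) / w := by field_simp; ring
  simp only [singularPart, hA, sub_add_cancel, inv_inv]
  rw [e1]
  match_scalars
  all_goals first | (field_simp; done) | (field_simp; ring)

theorem exists_bound_Icc_ball {E : Type*} [NormedAddCommGroup E] {f : ℝ × ℂ → E}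
    (hf : Continuous f) : ∃ K : ℝ, 0 ≤ K ∧ ∀ s ∈ Set.Icc (0 : ℝ) 1,
      ∀ h ∈ Metric.ball (0 : ℂ) 1, ‖f (s, h)‖ ≤ K := by
  obtain ⟨K, hK⟩ := ((isCompact_Icc (a := (0 : ℝ)) (b := 1)).prod
    (isCompact_closedBall (0 : ℂ) 1)).exists_bound_of_continuousOn hf.continuousOn
  have h1 := fun s hs h (hh : h ∈ Metric.ball (0 : ℂ) 1) =>
    hK (s, h) ⟨hs, Metric.ball_subset_closedBall hh⟩
  exact ⟨K, (norm_nonneg _).trans (h1 0 (by simp) 0 (Metric.mem_ball_self one_pos)), h1⟩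

variable {Ω : Set (OnePoint ℂ)} {p : X → puncture Ω} {δ' : C(unitInterval, X)}

namespace Tube

/-- The coordinate on the thickened curve. -/
def c (τ : Tube Ω p δ') (y : ℝ × ℂ) : ℂ := τ.C (circ y.1, y.2)

theorem continuous_c (τ : Tube Ω p δ') : Continuous τ.c := by
  have h1 := continuous_circ
  have h2 := τ.continuous_C
  unfold c
  fun_prop

theorem c_one (τ : Tube Ω p δ') : τ.c (1, 0) = τ.c (0, 0) := by simp only [c, circ_one]

theorem c_ne_zero (τ : Tube Ω p δ') (y : ℝ × ℂ) : τ.c y ≠ 0 := τ.ne_zero y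

theorem c_sub_one_ne_zero (τ : Tube Ω p δ') (y : ℝ × ℂ) : τ.c y - 1 ≠ 0 :=
  sub_ne_zero.2 (τ.ne_one y)

/-- Primitives along the curve of rational functions with double poles at `0` and `1`. -/
theorem exists_primitive (τ : Tube Ω p δ') (a₁ b₁ a₀ b₀ p₀ p₁ : W ρ) : ∃ q : ℝ × ℂ → W ρ,
    HasDerivAlong τ.c q (fun y => (τ.c y - 1)⁻¹ • b₁ + (τ.c y)⁻¹ • b₀ +
      (((τ.c y - 1) ^ 2)⁻¹ • a₁ + (τ.c y ^ 2)⁻¹ • a₀ + p₀ + τ.c y • p₁)) ∧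
    q (1, 0) - q (0, 0) = τ.κ • (b₁ + b₀) := by
  obtain ⟨θ₁, hθ₁, h₁⟩ := exists_continuous_log (g := fun y => τ.c y - 1)
    (τ.continuous_c.sub continuous_const) τ.c_sub_one_ne_zero
  obtain ⟨θ₀, hθ₀, h₀⟩ := exists_continuous_log (g := fun y => τ.c y - 0)
    (τ.continuous_c.sub continuous_const) (fun y => by rw [sub_zero]; exact τ.c_ne_zero y)
  have hd₁ := (hasDerivAlong_log hθ₁ h₁).smul_const b₁
  have hd₀ := (hasDerivAlong_log hθ₀ h₀).smul_const b₀
  have hR := HasDerivAlong.of_hasDerivAt (c := τ.c)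
    (F := fun w : ℂ => (-(w - 1)⁻¹) • a₁ + (-w⁻¹) • a₀ + w • p₀ + (w ^ 2 / 2) • p₁)
    (F' := fun w => ((w - 1) ^ 2)⁻¹ • a₁ + (w ^ 2)⁻¹ • a₀ + p₀ + w • p₁) fun y => by
      have e1 : HasDerivAt (fun w : ℂ => -(w - 1)⁻¹) (((τ.c y - 1) ^ 2)⁻¹) (τ.c y) := by
        have := (((hasDerivAt_id' (τ.c y)).sub_const 1).fun_inv (τ.c_sub_one_ne_zero y)).fun_neg
        exact this.congr_deriv (by rw [neg_div, neg_neg, one_div])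
      have e0 : HasDerivAt (fun w : ℂ => -w⁻¹) ((τ.c y ^ 2)⁻¹) (τ.c y) := by
        have := (hasDerivAt_inv (τ.c_ne_zero y)).fun_neg
        rwa [neg_neg] at this
      have e2 : HasDerivAt (fun w : ℂ => w ^ 2 / 2) (τ.c y) (τ.c y) := by
        have := ((hasDerivAt_id' (τ.c y)).fun_pow 2).div_const 2
        exact this.congr_deriv (by norm_num)
      have e3 : HasDerivAt (fun w : ℂ => w • p₀) p₀ (τ.c y) := by
        simpa using (hasDerivAt_id (τ.c y)).smul_const p₀
      exact (((e1.smul_const a₁).add (e0.smul_const a₀)).add e3).add (e2.smul_const p₁)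
  refine ⟨_, ((hd₁.add hd₀).add hR).congr (fun _ => rfl) fun y => by rw [sub_zero], ?_⟩
  have i₁ := τ.index 1 (Or.inr rfl) θ₁ hθ₁ h₁
  have i₀ := τ.index 0 (Or.inl rfl) θ₀ hθ₀ h₀
  -- The rational terms return to their initial values; only the two logarithms vary, each by `κ`.
  simp only [τ.c_one]
  rw [show θ₁ (1, 0) = θ₁ (0, 0) + τ.κ by rw [← i₁]; ring,
    show θ₀ (1, 0) = θ₀ (0, 0) + τ.κ by rw [← i₀]; ring]
  module

/-- The singular part, in the coordinate `w`, is bounded on the curve by its coefficients. -/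
theorem exists_norm_singularPart_le (τ : Tube Ω p δ') : ∃ K : ℝ, 0 ≤ K ∧ ∀ A B : W ρ,
    A.bar = -A → ∀ s ∈ Set.Icc (0 : ℝ) 1, ∀ h ∈ Metric.ball (0 : ℂ) 1,
      ‖-(τ.c (s, h) ^ 2)⁻¹ • singularPart A B ((τ.c (s, h))⁻¹ - 1)‖ ≤ K * ‖(A, B)‖ := by
  have hc := τ.continuous_c
  have h1 : Continuous fun y => (τ.c y - 1)⁻¹ :=
    (hc.sub continuous_const).inv₀ τ.c_sub_one_ne_zero
  have h0 : Continuous fun y => (τ.c y)⁻¹ := hc.inv₀ τ.c_ne_zero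
  obtain ⟨K₁, hK₁, hb₁⟩ := exists_bound_Icc_ball h1
  obtain ⟨K₀, hK₀, hb₀⟩ := exists_bound_Icc_ball h0
  refine ⟨K₁ + K₀ + K₁ ^ 2 + K₀ ^ 2, by positivity, fun A B hA s hs h hh => ?_⟩
  rw [neg_smul_singularPart hA (τ.c_ne_zero _) (sub_ne_zero.1 (τ.c_sub_one_ne_zero _))]
  have hA' : ‖A‖ ≤ ‖(A, B)‖ := le_max_left _ _
  have hB' : ‖B‖ ≤ ‖(A, B)‖ := le_max_right _ _
  have n1 := hb₁ s hs h hh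
  have n0 := hb₀ s hs h hh
  have hn := norm_nonneg (A, B)
  have e1 : ‖(τ.c (s, h) - 1)⁻¹ • B‖ ≤ K₁ * ‖(A, B)‖ := by
    rw [norm_smul]; exact mul_le_mul n1 hB' (norm_nonneg _) hK₁
  have e2 : ‖(τ.c (s, h))⁻¹ • B.bar‖ ≤ K₀ * ‖(A, B)‖ := by
    rw [norm_smul, W.norm_bar]; exact mul_le_mul n0 hB' (norm_nonneg _) hK₀
  have e3 : ‖((τ.c (s, h) - 1) ^ 2)⁻¹ • A‖ ≤ K₁ ^ 2 * ‖(A, B)‖ := by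
    rw [norm_smul, ← inv_pow, norm_pow]
    exact mul_le_mul (pow_le_pow_left₀ (norm_nonneg _) n1 2) hA' (norm_nonneg _) (by positivity)
  have e4 : ‖(τ.c (s, h) ^ 2)⁻¹ • A‖ ≤ K₀ ^ 2 * ‖(A, B)‖ := by
    rw [norm_smul, ← inv_pow, norm_pow]
    exact mul_le_mul (pow_le_pow_left₀ (norm_nonneg _) n0 2) hA' (norm_nonneg _) (by positivity)
  have t1 := norm_add_le ((τ.c (s, h) - 1)⁻¹ • B - (τ.c (s, h))⁻¹ • B.bar -
    ((τ.c (s, h) - 1) ^ 2)⁻¹ • A) ((τ.c (s, h) ^ 2)⁻¹ • A)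
  have t2 := norm_sub_le ((τ.c (s, h) - 1)⁻¹ • B - (τ.c (s, h))⁻¹ • B.bar)
    (((τ.c (s, h) - 1) ^ 2)⁻¹ • A)
  have t3 := norm_sub_le ((τ.c (s, h) - 1)⁻¹ • B) ((τ.c (s, h))⁻¹ • B.bar)
  linarith

/-- The primitive of the linearized equation, and its variation. -/
theorem exists_matrix_primitive (τ : Tube Ω p δ') (k : ℂ) {d e : W ρ} (hde : d * e = 1)
    {A B : W ρ} (hA : A.bar = -A) : ∃ Q : ℝ × ℂ → Matrix (Fin 2) (Fin 2) (W ρ),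
    HasDerivAlong τ.c Q (fun y => (-(τ.c y ^ 2)⁻¹ • singularPart A B ((τ.c y)⁻¹ - 1)) •
      nilConj (d * ((k * (1 / 2 - τ.c y)) • W.monomial (-1))) e) ∧
    Q (1, 0) - Q (0, 0) = τ.κ • !![W.monomial (-1) * ((-k / 2) • (B + B.bar)),
      -(d ^ 2 * (W.monomial (-2) * ((k ^ 2 / 4) • (B - B.bar) - (2 * k ^ 2) • A)));
      e ^ 2 * (B - B.bar), -(W.monomial (-1) * ((-k / 2) • (B + B.bar)))] := by
  -- The arguments are the partial fraction coefficients of `G`, `uG` and `u²G`, where `u = k(1/2 -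
  -- w)` and `G = B/(w-1) - B̄/w - A/(w-1)² + A/w²`.
  obtain ⟨q₀, hq₀, i₀⟩ := τ.exists_primitive (-A) B A (-B.bar) 0 0
  obtain ⟨q₁, hq₁, i₁⟩ := τ.exists_primitive ((k / 2) • A) (k • A - (k / 2) • B) ((k / 2) • A)
    (-(k • A) - (k / 2) • B.bar) (k • (B.bar - B)) 0
  obtain ⟨q₂, hq₂, i₂⟩ := τ.exists_primitive (-(k ^ 2 / 4) • A) ((k ^ 2 / 4) • B - k ^ 2 • A)
    ((k ^ 2 / 4) • A) (-((k ^ 2 / 4) • B.bar) - k ^ 2 • A) (k ^ 2 • B.bar) (k ^ 2 • (B - B.bar))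
  set G : ℝ × ℂ → W ρ := fun y => -(τ.c y ^ 2)⁻¹ • singularPart A B ((τ.c y)⁻¹ - 1) with hG
  have hGe : ∀ y, G y = (τ.c y - 1)⁻¹ • B - (τ.c y)⁻¹ • B.bar - ((τ.c y - 1) ^ 2)⁻¹ • A +
      (τ.c y ^ 2)⁻¹ • A := fun y =>
    neg_smul_singularPart hA (τ.c_ne_zero _) (sub_ne_zero.1 (τ.c_sub_one_ne_zero _))
  have hq₀' : HasDerivAlong τ.c q₀ G := hq₀.congr (fun _ => rfl) fun y => by
    rw [hGe]; module
  have hq₁' : HasDerivAlong τ.c q₁ fun y => (k * (1 / 2 - τ.c y)) • G y :=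
    hq₁.congr (fun _ => rfl) fun y => by
      rw [hGe]
      have h0 := τ.c_ne_zero y
      have h1 := τ.c_sub_one_ne_zero y
      match_scalars
      all_goals (field_simp; ring)
  have hq₂' : HasDerivAlong τ.c q₂ fun y => (k * (1 / 2 - τ.c y)) ^ 2 • G y :=
    hq₂.congr (fun _ => rfl) fun y => by
      rw [hGe]
      have h0 := τ.c_ne_zero y
      have h1 := τ.c_sub_one_ne_zero y
      match_scalars
      all_goals (field_simp; ring)
  have hmul : ∀ (a : W ρ) {q q' : ℝ × ℂ → W ρ}, HasDerivAlong τ.c q q' →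
      HasDerivAlong τ.c (fun y => a * q y) fun y => a * q' y := fun a q q' h =>
    h.clm (ContinuousLinearMap.mul ℂ (W ρ) a)
  have hmm : (W.monomial (-1) : W ρ) ^ 2 = W.monomial (-2) := by
    rw [pow_two, W.monomial_mul_monomial]; norm_num
  have hu : ∀ y, nilConj (d * ((k * (1 / 2 - τ.c y)) • W.monomial (-1))) e =
      !![(k * (1 / 2 - τ.c y)) • W.monomial (-1),
        -((k * (1 / 2 - τ.c y)) ^ 2 • (d ^ 2 * W.monomial (-2)));
        e ^ 2, -((k * (1 / 2 - τ.c y)) • W.monomial (-1))] := fun y => by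
    have e1 : d * ((k * (1 / 2 - τ.c y)) • W.monomial (-1)) * e =
        (k * (1 / 2 - τ.c y)) • W.monomial (-1) := by
      rw [mul_right_comm, hde, one_mul]
    rw [nilConj, e1, mul_pow, smul_pow, hmm, mul_smul_comm]
  have hΘ : ∀ y, G y • nilConj (d * ((k * (1 / 2 - τ.c y)) • W.monomial (-1))) e =
      !![W.monomial (-1) * ((k * (1 / 2 - τ.c y)) • G y),
        -(d ^ 2) * (W.monomial (-2) * ((k * (1 / 2 - τ.c y)) ^ 2 • G y));
        e ^ 2 * G y, -1 * (W.monomial (-1) * ((k * (1 / 2 - τ.c y)) • G y))] := fun y => by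
    rw [hu]
    simp only [Matrix.smul_of, Matrix.smul_cons, smul_eq_mul, Matrix.smul_empty, mul_smul_comm,
      smul_mul_assoc, mul_neg, neg_mul, one_mul, smul_neg, mul_comm, mul_left_comm]
  refine ⟨fun y => !![W.monomial (-1) * q₁ y, -(d ^ 2 * (W.monomial (-2) * q₂ y));
      e ^ 2 * q₀ y, -(W.monomial (-1) * q₁ y)], HasDerivAlong.matrix fun i j => ?_, ?_⟩
  · have h00 := hmul (W.monomial (-1)) hq₁'
    have h01 := hmul (-(d ^ 2)) (hmul (W.monomial (-2)) hq₂')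
    have h10 := hmul (e ^ 2) hq₀'
    have h11 := hmul (-1) h00
    have hent : ∀ y i j, (G y • nilConj (d * ((k * (1 / 2 - τ.c y)) • W.monomial (-1))) e) i j =
      !![W.monomial (-1) * ((k * (1 / 2 - τ.c y)) • G y),
        -(d ^ 2) * (W.monomial (-2) * ((k * (1 / 2 - τ.c y)) ^ 2 • G y));
        e ^ 2 * G y, -1 * (W.monomial (-1) * ((k * (1 / 2 - τ.c y)) • G y))] i j :=
      fun y i j => by rw [hΘ]
    fin_cases i <;> fin_cases j
    · exact h00.congr (fun y => rfl) fun y => hent y 0 0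
    · exact h01.congr (fun y => neg_mul_eq_neg_mul _ _) fun y => hent y 0 1
    · exact h10.congr (fun y => rfl) fun y => hent y 1 0
    · exact h11.congr (fun y => (neg_one_mul _).symm) fun y => hent y 1 1
  · refine Matrix.ext fun i j => ?_
    have j₀ : q₀ (1, 0) = q₀ (0, 0) + τ.κ • (B - B.bar) := by
      rw [sub_eq_add_neg B, ← i₀]; abel
    have j₁ : q₁ (1, 0) = q₁ (0, 0) + τ.κ • ((-k / 2) • (B + B.bar)) := by
      rw [show (-k / 2) • (B + B.bar) = k • A - (k / 2) • B + (-(k • A) - (k / 2) • B.bar) by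
        module, ← i₁]; abel
    have j₂ : q₂ (1, 0) = q₂ (0, 0) + τ.κ • ((k ^ 2 / 4) • (B - B.bar) - (2 * k ^ 2) • A) := by
      rw [show (k ^ 2 / 4) • (B - B.bar) - (2 * k ^ 2) • A = (k ^ 2 / 4) • B - k ^ 2 • A +
        (-((k ^ 2 / 4) • B.bar) - k ^ 2 • A) by module, ← i₂]; abel
    have key : ∀ a b f : W ρ, a * (b + τ.κ • f) - a * b = τ.κ • (a * f) := fun a b f => by
      rw [mul_add, add_sub_cancel_left, mul_smul_comm]
    have key' : ∀ a b f : W ρ, -(a * (b + τ.κ • f)) - -(a * b) = τ.κ • -(a * f) := fun a b f => by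
      rw [mul_add, mul_smul_comm, smul_neg]; abel
    fin_cases i <;> fin_cases j
    · change W.monomial (-1) * q₁ (1, 0) - W.monomial (-1) * q₁ (0, 0) = τ.κ • _
      rw [j₁]; exact key _ _ _
    · change -(d ^ 2 * (W.monomial (-2) * q₂ (1, 0))) - -(d ^ 2 * (W.monomial (-2) * q₂ (0, 0))) =
        τ.κ • _
      rw [j₂, mul_add, mul_smul_comm]; exact key' _ _ _
    · change e ^ 2 * q₀ (1, 0) - e ^ 2 * q₀ (0, 0) = τ.κ • _
      rw [j₀]; exact key _ _ _
    · change -(W.monomial (-1) * q₁ (1, 0)) - -(W.monomial (-1) * q₁ (0, 0)) = τ.κ • _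
      rw [j₁]; exact key' _ _ _

end Tube

end MonodromyLinearization

/-! ### The monodromy to first order -/

section FirstOrder

open scoped Matrix.Norms.Operator

variable {ρ : ℝ} [hρ : Fact (1 < ρ)] {X : Type*} [TopologicalSpace X]

theorem Matrix.continuous_of_entry {Y : Type*} [TopologicalSpace Y]
    {F : Y → Matrix (Fin 2) (Fin 2) (W ρ)} (h : ∀ i j, Continuous fun y => F y i j) :
    Continuous F := by
  have h1 : Continuous fun y => ∑ i, ∑ j, Matrix.singleCLM i j (F y i j) :=
    continuous_finsetSum _ fun i _ => continuous_finsetSum _ fun j _ =>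
      (Matrix.singleCLM (ρ := ρ) i j).continuous.comp (h i j)
  exact h1.congr fun y => (Matrix.sum_singleCLM (F y)).symm

theorem continuous_nilConj {Y : Type*} [TopologicalSpace Y] {b d : Y → W ρ} (hb : Continuous b)
    (hd : Continuous d) (i j : Fin 2) : Continuous fun y => nilConj (b y) (d y) i j := by
  fin_cases i <;> fin_cases j
  · exact hb.mul hd
  · exact (hb.pow 2).neg
  · exact hd.pow 2
  · exact (hb.mul hd).neg

variable {Ω : Set (OnePoint ℂ)} {p : X → puncture Ω} {δ' : C(unitInterval, X)}

/-- The coefficient of the first order term of the inverse monodromy. -/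
def firstOrder (k : ℂ) (d e A B : W ρ) : Matrix (Fin 2) (Fin 2) (W ρ) :=
  !![W.monomial (-1) * ((-k / 2) • (B + B.bar)),
    -(d ^ 2 * (W.monomial (-2) * ((k ^ 2 / 4) • (B - B.bar) - (2 * k ^ 2) • A)));
    e ^ 2 * (B - B.bar), -(W.monomial (-1) * ((-k / 2) • (B + B.bar)))]

/-- The singular part is `O(A, B)` on the tube, while the factor `P` that replaces `nilConj` tends
uniformly to its value at `t = 0`. Freezing it there costs only `o(A, B)`, and the frozen equation
has the explicit primitive `Q`. -/
theorem Tube.isLittleO (τ : Tube Ω p δ') {ι : Type*} {l : Filter ι} (k : ℂ) {d e : W ρ}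
    (hde : d * e = 1) {A B : ι → W ρ} (hA : ∀ᶠ t in l, (A t).bar = -A t)
    (hY : Tendsto (fun t => (A t, B t)) l (𝓝 0))
    {Z P : ι → ℝ × ℂ → Matrix (Fin 2) (Fin 2) (W ρ)}
    (hZ : ∀ᶠ t in l, HasDerivAlong τ.c (Z t) fun y => -(Z t y *
      ((-(τ.c y ^ 2)⁻¹ • singularPart (A t) (B t) ((τ.c y)⁻¹ - 1)) • P t y)))
    (hZ1 : ∀ᶠ t in l, Z t (0, 0) = 1)
    (hP : ∀ η > 0, ∀ᶠ t in l, ∀ s ∈ Set.Icc (0 : ℝ) 1, ∀ h ∈ Metric.ball (0 : ℂ) 1,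
      ‖P t (s, h) - nilConj (d * ((k * (1 / 2 - τ.c (s, h))) • W.monomial (-1))) e‖ ≤ η) :
    (fun t => Z t (1, 0) - 1 + τ.κ • firstOrder k d e (A t) (B t)) =o[l] fun t => (A t, B t) := by
  have hQ : ∀ t, ∃ Q : ℝ × ℂ → Matrix (Fin 2) (Fin 2) (W ρ), (A t).bar = -A t →
      HasDerivAlong τ.c Q (fun y =>
        (-(τ.c y ^ 2)⁻¹ • singularPart (A t) (B t) ((τ.c y)⁻¹ - 1)) •
        nilConj (d * ((k * (1 / 2 - τ.c y)) • W.monomial (-1))) e) ∧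
      Q (1, 0) - Q (0, 0) = τ.κ • firstOrder k d e (A t) (B t) := fun t => by
    by_cases h : (A t).bar = -A t
    · obtain ⟨Q, hQ⟩ := τ.exists_matrix_primitive k hde (B := B t) h
      exact ⟨Q, fun _ => hQ⟩
    · exact ⟨0, fun h' => absurd h' h⟩
  choose Q hQ using hQ
  obtain ⟨K, hK, hg⟩ := τ.exists_norm_singularPart_le (ρ := ρ)
  have hc := τ.continuous_c
  have hP₀ : Continuous fun y => nilConj (d * ((k * (1 / 2 - τ.c y)) • W.monomial (-1))) e :=
    Matrix.continuous_of_entry fun i j => continuous_nilConj (by fun_prop) continuous_const i j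
  obtain ⟨K', hK', hP₀b⟩ := exists_bound_Icc_ball hP₀
  have hsmul : ∀ (g : W ρ) (M : Matrix (Fin 2) (Fin 2) (W ρ)), ‖g • M‖ ≤ ‖g‖ * ‖M‖ :=
    fun g M => norm_smul_le g M
  refine (isLittleO_of_hasDerivAlong τ.continuous_δ τ.r_pos hc τ.apply_circ
    (C := K * (K' + 1)) hY hZ hZ1 (hA.mono fun t ht => (hQ t ht).1) ?_ ?_).congr' ?_
    EventuallyEq.rfl
  · filter_upwards [hA, hP 1 one_pos] with t hAt hPt s hs h hh
    have h1 : ‖P t (s, h)‖ ≤ K' + 1 := by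
      have := norm_add_le (P t (s, h) - nilConj (d * ((k * (1 / 2 - τ.c (s, h))) •
        W.monomial (-1))) e) (nilConj (d * ((k * (1 / 2 - τ.c (s, h))) • W.monomial (-1))) e)
      rw [sub_add_cancel] at this
      linarith [hPt s hs h hh, hP₀b s hs h hh]
    refine (hsmul _ _).trans ((mul_le_mul (hg (A t) (B t) hAt s hs h hh) h1 (norm_nonneg _)
      (by positivity)).trans (le_of_eq (by ring)))
  · intro η hη
    filter_upwards [hA, hP (η / (K + 1)) (by positivity)] with t hAt hPt s hs h hh
    rw [← smul_sub]
    refine (hsmul _ _).trans ((mul_le_mul (hg (A t) (B t) hAt s hs h hh) (hPt s hs h hh)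
      (norm_nonneg _) (by positivity)).trans ?_)
    have h1 : K * ‖(A t, B t)‖ * (η / (K + 1)) = K / (K + 1) * (η * ‖(A t, B t)‖) := by ring
    rw [h1]
    refine mul_le_of_le_one_left (by positivity) ?_
    rw [div_le_one (by positivity)]
    linarith
  · filter_upwards [hA] with t ht
    rw [(hQ t ht).2]

/-- A continuous family vanishing at the parameter `0` is uniformly small on compact sets. -/
theorem eventually_forall_norm_le {Y E : Type*} [TopologicalSpace Y] [NormedAddCommGroup E]
    {f : ℝ × Y → E} {ε : ℝ} (hε : 0 < ε) {S K : Set Y} (hS : IsOpen S)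
    (hf : ContinuousOn f (Set.Ioo (-ε) ε ×ˢ S)) (hK : IsCompact K) (hKS : K ⊆ S)
    (h0 : ∀ y ∈ K, f (0, y) = 0) {η : ℝ} (hη : 0 < η) :
    ∀ᶠ t in 𝓝 (0 : ℝ), ∀ y ∈ K, ‖f (t, y)‖ ≤ η := by
  refine hK.eventually_forall_of_forall_eventually fun y hy => ?_
  have h1 : ContinuousAt f (0, y) := hf.continuousAt
    ((isOpen_Ioo.prod hS).mem_nhds ⟨⟨by simpa using hε, hε⟩, hKS hy⟩)
  have h2 := h1.norm.eventually_lt (continuousAt_const (y := η)) (by simpa [h0 y hy] using hη)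
  exact h2.mono fun q hq => hq.le

end FirstOrder

/-! ### Vanishing of the singular coefficients. -/

section Core

open scoped Matrix.Norms.Operator

variable {ρ : ℝ} [hρ : Fact (1 < ρ)] {X : Type*} [TopologicalSpace X]

theorem MonodromyProblem.isUnitaryLoop {S : SpaceForm ρ} {M : SL(2, W ρ)}
    (h : MonodromyProblem S M) : IsUnitaryLoop M := by
  cases S <;> exact h.1

theorem star_eq_adjugate {U : Matrix (Fin 2) (Fin 2) ℂ}
    (h : U ∈ Matrix.specialUnitaryGroup (Fin 2) ℂ) : star U = U.adjugate := by
  rw [Matrix.mem_specialUnitaryGroup_iff, Matrix.mem_unitaryGroup_iff'] at h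
  refine left_inv_eq_right_inv h.1 ?_
  rw [Matrix.mul_adjugate, h.2, one_smul]

/-- On the circle `U^* = U⁻¹ = adj U` entrywise. An element of `𝒲` is determined by its values
there, so these become identities in `𝒲`. -/
theorem IsUnitaryLoop.adj_entries {M : SL(2, W ρ)} (h : IsUnitaryLoop M) :
    M.1 0 0 = (M.1 1 1).adj ∧ M.1 1 0 = -(M.1 0 1).adj := by
  have key : ∀ μ : ℂ, ‖μ‖ = 1 → ∀ i j, conj ((M.1 j i).eval μ) =
      (evalMatrix M.1 μ).adjugate i j := fun μ hμ i j => by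
    rw [← star_eq_adjugate (h μ hμ), Matrix.star_apply]
    rfl
  constructor
  · refine W.eq_of_eval fun μ hμ => ?_
    rw [W.eval_adj hμ, key μ hμ 1 1, Matrix.adjugate_fin_two]
    rfl
  · refine W.eq_of_eval fun μ hμ => ?_
    have h1 := key μ hμ 1 0
    rw [Matrix.adjugate_fin_two] at h1
    have h2 : ((-(M.1 0 1).adj : W ρ)).eval μ = -((M.1 0 1).adj).eval μ := by
      rw [← W.evalCLM_apply μ (W.inAnnulus_of_norm_eq_one hμ), map_neg, W.evalCLM_apply]
    rw [h2, W.eval_adj hμ, h1]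
    simp [evalMatrix]

theorem SL_inv_apply (M : SL(2, W ρ)) :
    (M⁻¹).1 0 0 = M.1 1 1 ∧ (M⁻¹).1 0 1 = -M.1 0 1 ∧ (M⁻¹).1 1 0 = -M.1 1 0 ∧
      (M⁻¹).1 1 1 = M.1 0 0 := by
  rw [Matrix.SpecialLinearGroup.coe_inv, Matrix.adjugate_fin_two]
  exact ⟨rfl, rfl, rfl, rfl⟩

theorem matD_inv : (matD : Matrix (Fin 2) (Fin 2) (W ρ))⁻¹ =
    !![algebraMap ℂ (W ρ) (-Complex.I), 0; 0, algebraMap ℂ (W ρ) Complex.I] := by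
  refine Matrix.inv_eq_right_inv ?_
  have h1 : algebraMap ℂ (W ρ) Complex.I * algebraMap ℂ (W ρ) (-Complex.I) = 1 := by
    rw [← map_mul]; simp
  have h2 : algebraMap ℂ (W ρ) (-Complex.I) * algebraMap ℂ (W ρ) Complex.I = 1 := by
    rw [← map_mul]; simp
  rw [matD, Matrix.mul_fin_two, h1, h2, Matrix.one_fin_two]
  simp

theorem matD_conj (M : Matrix (Fin 2) (Fin 2) (W ρ)) :
    matD * M * matD⁻¹ = !![M 0 0, -M 0 1; -M 1 0, M 1 1] := by
  have h1 : ∀ f : W ρ, algebraMap ℂ (W ρ) Complex.I * f * algebraMap ℂ (W ρ) Complex.I = -f :=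
    fun f => by rw [mul_right_comm, ← map_mul]; simp
  have h2 : ∀ f : W ρ, algebraMap ℂ (W ρ) Complex.I * f * algebraMap ℂ (W ρ) (-Complex.I) = f :=
    fun f => by rw [mul_right_comm, ← map_mul]; simp
  have h3 : ∀ f : W ρ, algebraMap ℂ (W ρ) (-Complex.I) * f * algebraMap ℂ (W ρ) Complex.I = f :=
    fun f => by rw [mul_right_comm, ← map_mul]; simp
  have h4 : ∀ f : W ρ,
      algebraMap ℂ (W ρ) (-Complex.I) * f * algebraMap ℂ (W ρ) (-Complex.I) = -f :=
    fun f => by rw [mul_right_comm, ← map_mul]; simp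
  rw [matD_inv, matD, Matrix.eta_fin_two M, Matrix.mul_fin_two, Matrix.mul_fin_two]
  simp only [zero_mul, mul_zero, add_zero, zero_add, h1, h2, h3, h4, Matrix.of_apply,
    Matrix.cons_val', Matrix.cons_val_zero, Matrix.cons_val_one, Matrix.cons_val_fin_one]

/-- The sign from pulling back `dz` by `σ` cancels the sign from conjugating an off-diagonal entry
by `D`. -/
theorem DPWPotential.IsSigmaSymmetricOn.gamma {ξ : DPWPotential ρ} {U : Set ℂ}
    (h : ξ.IsSigmaSymmetricOn U) {z : ℂ} (hz : z ∈ U) :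
    ξ.γ z = (z ^ 2)⁻¹ • (ξ.γ (conj z)⁻¹).bar := by
  have h1 := congrFun₂ (h z hz) 1 0
  rw [matD_conj] at h1
  simp only [toMatrix, Matrix.smul_apply, Matrix.map_apply, Matrix.of_apply, Matrix.cons_val',
    Matrix.cons_val_zero, Matrix.cons_val_one, Matrix.cons_val_fin_one, neg_smul, neg_inj] at h1
  exact h1.symm

theorem DPWPotential.IsSigmaSymmetricOn.beta {ξ : DPWPotential ρ} {U : Set ℂ}
    (h : ξ.IsSigmaSymmetricOn U) {z : ℂ} (hz : z ∈ U) :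
    ξ.β z = (z ^ 2)⁻¹ • (ξ.β (conj z)⁻¹).bar := by
  have h1 := congrFun₂ (h z hz) 0 1
  rw [matD_conj] at h1
  simp only [toMatrix, Matrix.smul_apply, Matrix.map_apply, Matrix.of_apply, Matrix.cons_val',
    Matrix.cons_val_zero, Matrix.cons_val_one, Matrix.cons_val_fin_one, neg_smul,
    W.bar_mul, W.bar_monomial, ← mul_smul_comm] at h1
  have h2 := congrArg (fun f => W.monomial 1 * f) h1
  have h3 : ∀ f : W ρ, W.monomial 1 * (W.monomial (-1) * f) = f := fun f => by
    simpa using W.monomial_mul_cancel (-1) f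
  simp only [mul_neg, h3, neg_inj] at h2
  exact h2.symm

theorem differentiableAt_singularPart (A B : W ρ) {z : ℂ} (h0 : z ≠ 0) (h1 : z + 1 ≠ 0) :
    DifferentiableAt ℂ (singularPart A B) z := by
  have d1 : DifferentiableAt ℂ (fun z : ℂ => z ^ 2) z := by fun_prop
  have d2 : DifferentiableAt ℂ (fun z : ℂ => z * (z + 1)) z := by fun_prop
  have d3 : DifferentiableAt ℂ (fun z : ℂ => z + 1) z := by fun_prop
  exact ((((d1.fun_inv (pow_ne_zero 2 h0)).smul_const A).add
    ((d2.fun_inv (mul_ne_zero h0 h1)).smul_const B)).add_const _).add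
    ((d3.fun_inv h1).smul_const B.bar)

@[simp] theorem singularPart_zero (z : ℂ) : singularPart (0 : W ρ) 0 z = 0 := by
  simp [singularPart]

theorem add_one_ne_zero_of_mem_puncture {Ω : Set (OnePoint ℂ)}
    (hΩ1 : ((-1 : ℂ) : OnePoint ℂ) ∉ Ω) {z : ℂ} (hz : z ∈ puncture Ω) : z + 1 ≠ 0 := fun h => by
  rw [eq_neg_of_add_eq_zero_left h] at hz
  exact hΩ1 hz.2

/-- The regular part of a potential, in the coordinate `w = 1 / (z + 1)`. -/
theorem exists_regularPart {Ω : Set (OnePoint ℂ)} (hΩo : IsOpen Ω)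
    (hΩ1 : ((-1 : ℂ) : OnePoint ℂ) ∉ Ω) {ξ : DPWPotential ρ} (hξ : ξ.IsPotentialOn (puncture Ω))
    (hα : HolomorphicAtZeroInfty ξ.α) (hβ : HolomorphicAtZeroInfty ξ.β) {A B : W ρ}
    (hγ : HolomorphicAtZeroInfty fun z => ξ.γ z - singularPart A B z) :
    ∃ F : ℂ → Matrix (Fin 2) (Fin 2) (W ρ), DifferentiableOn ℂ F (wplane Ω) ∧
      ∀ w ≠ 0, w ≠ 1 → -(w ^ 2)⁻¹ • ξ.toMatrix (w⁻¹ - 1) =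
        F w + Matrix.single 1 0 (-(w ^ 2)⁻¹ • singularPart A B (w⁻¹ - 1)) := by
  obtain ⟨Fα, hFα, eα⟩ := exists_extension hΩo hξ.1.1 hα
  obtain ⟨Fβ, hFβ, eβ⟩ := exists_extension hΩo hξ.1.2.1 hβ
  obtain ⟨Fγ, hFγ, eγ⟩ := exists_extension hΩo (hξ.1.2.2.sub fun z hz =>
    (differentiableAt_singularPart A B hz.1
      (add_one_ne_zero_of_mem_puncture hΩ1 hz)).differentiableWithinAt) hγ
  refine ⟨fun w => !![Fα w, W.monomial (-1) * Fβ w; Fγ w, -Fα w],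
    Matrix.differentiableOn_of_entry fun i j => ?_, fun w h0 h1 => Matrix.ext fun i j => ?_⟩
  · fin_cases i <;> fin_cases j
    · exact hFα
    · exact hFβ.const_mul _
    · exact hFγ
    · exact hFα.neg
  · fin_cases i <;> fin_cases j
    · simp [DPWPotential.toMatrix, eα w h0 h1]
    · simp [DPWPotential.toMatrix, eβ w h0 h1]
    · simp [DPWPotential.toMatrix, eγ w h0 h1, smul_sub]
    · simp [DPWPotential.toMatrix, eα w h0 h1]

/-- The singular entry `γ_t` is regular for small `t`. -/
theorem eventually_holomorphicAtZeroInfty_gamma (S : SpaceForm ρ) {Ω : Set (OnePoint ℂ)}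
    (hΩo : IsOpen Ω) (hΩ0 : ((0 : ℂ) : OnePoint ℂ) ∈ Ω) (hΩ1 : ((-1 : ℂ) : OnePoint ℂ) ∉ Ω)
    [SimplyConnectedSpace X] {p : X → puncture Ω} (hp : IsCoveringMap p) {δ' : C(unitInterval, X)}
    (hδ : BoundsDisk Ω fun s => ((p (δ' s) : ℂ) : OnePoint ℂ)) {ε : ℝ} (hε : 0 < ε)
    {ξ : ℝ → DPWPotential ρ} (hξ : ∀ t ∈ Set.Ioo (-ε) ε, (ξ t).IsPotentialOn (puncture Ω))
    (hγσ : ∀ t ∈ Set.Ioo (-ε) ε, ∀ z ∈ puncture Ω,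
      (ξ t).γ z = (z ^ 2)⁻¹ • ((ξ t).γ (conj z)⁻¹).bar)
    (hγc : ContinuousOn (fun q : ℝ × ℂ => (ξ q.1).γ q.2) (Set.Ioo (-ε) ε ×ˢ puncture Ω))
    {Φ : ℝ → X → SL(2, W ρ)} (hΦ : ∀ t ∈ Set.Ioo (-ε) ε, IsSolution p (ξ t) (Φ t))
    (hΦc : ∀ i j, ContinuousOn (fun q : ℝ × X => (Φ q.1 q.2).1 i j)
      (Set.Ioo (-ε) ε ×ˢ Set.univ))
    (hM : ∀ t ∈ Set.Ioo (-ε) ε, MonodromyProblem S (monodromy (Φ t) δ'))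
    {x₁ : X} (hx₁ : (p x₁ : ℂ) = 1) (hdiag : (Φ 0 x₁).1.IsDiag) {k : ℂ} (hk : k ≠ 0)
    (hreg : ∀ t ∈ Set.Ioo (-ε) ε, HolomorphicAtZeroInfty (ξ t).α ∧
      HolomorphicAtZeroInfty (ξ t).β ∧ SingularEntry (ξ t).γ)
    (hξ0 : ∀ z ∈ puncture Ω, (ξ 0).toMatrix z =
      (k / (z + 1) ^ 2) • !![0, W.monomial (-1); 0, 0]) :
    ∀ᶠ t in 𝓝 (0 : ℝ), HolomorphicAtZeroInfty (ξ t).γ := by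
  obtain ⟨τ⟩ := exists_tube hΩo hΩ1 hp hδ
  have hI : ∀ᶠ t in 𝓝 (0 : ℝ), t ∈ Set.Ioo (-ε) ε := Ioo_mem_nhds (by linarith) hε
  have h0I : (0 : ℝ) ∈ Set.Ioo (-ε) ε := hI.self_of_nhds
  obtain ⟨d, e, hde, hΦ0⟩ := (hΦ 0 h0I).eq_of_nilpotent (isOpen_puncture hΩo)
    (fun z hz => add_one_ne_zero_of_mem_puncture hΩ1 hz) hp hξ0 hx₁ hdiag
  -- the coefficients of the singular part
  have hAB : ∀ t, ∃ A B : W ρ, t ∈ Set.Ioo (-ε) ε → A ∈ W.nonneg ρ ∧ B ∈ W.nonneg ρ ∧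
      A.bar = -A ∧ B.coeff 0 = 0 ∧
      HolomorphicAtZeroInfty (fun z => (ξ t).γ z - singularPart A B z) ∧
      ∀ r C : ℝ, 0 < r → Metric.closedBall (0 : ℂ) r \ {0} ⊆ puncture Ω →
        (∀ z ∈ Metric.sphere (0 : ℂ) r, ‖(ξ t).γ z‖ ≤ C) → ‖A‖ ≤ r ^ 2 * C ∧ ‖B‖ ≤ r * C := by
    intro t
    by_cases ht : t ∈ Set.Ioo (-ε) ε
    · obtain ⟨A, B, h⟩ := exists_singularPart hΩo hΩ0 (hξ t ht).1.2.2
        (fun z hz => ((hξ t ht).2 z hz).2.2) (hγσ t ht) (hreg t ht).2.2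
      exact ⟨A, B, fun _ => h⟩
    · exact ⟨0, 0, fun h => absurd h ht⟩
  choose A B hAB using hAB
  have hγ0 : ∀ z ∈ puncture Ω, (ξ 0).γ z = 0 := fun z hz => by
    simpa [DPWPotential.toMatrix] using congrFun₂ (hξ0 z hz) 1 0
  -- `γ_0 = 0`, so `γ_t` is uniformly small on a fixed circle around `0`, and this bounds `A_t` and
  -- `B_t`.
  have hY : Tendsto (fun t => (A t, B t)) (𝓝 0) (𝓝 0) := by
    have hn : {z : ℂ | (z : OnePoint ℂ) ∈ Ω} ∈ 𝓝 (0 : ℂ) :=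
      (hΩo.preimage OnePoint.continuous_coe).mem_nhds hΩ0
    obtain ⟨r, hr, hsub⟩ := Metric.nhds_basis_closedBall.mem_iff.1 hn
    have hsub' : Metric.closedBall (0 : ℂ) r \ {0} ⊆ puncture Ω := fun z hz =>
      ⟨hz.2, hsub hz.1⟩
    have hsph : Metric.sphere (0 : ℂ) r ⊆ puncture Ω := fun z hz =>
      hsub' ⟨Metric.sphere_subset_closedBall hz, fun h => by
        rw [Set.mem_singleton_iff.1 h, mem_sphere_zero_iff_norm, norm_zero] at hz
        exact hr.ne hz⟩
    refine Metric.tendsto_nhds.2 fun η hη => ?_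
    have hη' : 0 < η / (2 * (r ^ 2 + r + 1)) := by positivity
    filter_upwards [hI, eventually_forall_norm_le hε (isOpen_puncture hΩo) hγc
      (isCompact_sphere (0 : ℂ) r) hsph (fun z hz => hγ0 z (hsph hz)) hη'] with t ht h1
    obtain ⟨hA, hB⟩ := (hAB t ht).2.2.2.2.2 r _ hr hsub' h1
    have h2 : (r ^ 2 + r + 1) * (η / (2 * (r ^ 2 + r + 1))) = η / 2 := by field_simp
    rw [dist_zero_right]
    refine max_lt ?_ ?_ <;> nlinarith
  -- the quotient of the two solutions
  have hZ : ∀ t, ∃ Z : ℝ × ℂ → Matrix (Fin 2) (Fin 2) (W ρ), t ∈ Set.Ioo (-ε) ε →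
      Z (0, 0) = 1 ∧ Z (1, 0) = ((monodromy (Φ t) δ')⁻¹).1 ∧
      HasDerivAlong τ.c Z fun y => -(Z y *
        ((-(τ.c y ^ 2)⁻¹ • singularPart (A t) (B t) ((τ.c y)⁻¹ - 1)) •
          nilConj ((Φ t (τ.x y)).1 0 1) ((Φ t (τ.x y)).1 1 1))) := by
    intro t
    by_cases ht : t ∈ Set.Ioo (-ε) ε
    · obtain ⟨F, hF, hFg⟩ := exists_regularPart hΩo hΩ1 (hξ t ht) (hreg t ht).1 (hreg t ht).2.1
        (hAB t ht).2.2.2.2.1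
      obtain ⟨Z, h⟩ := τ.exists_quotient hΩo hp (hΦ t ht) hF hFg
      exact ⟨Z, fun _ => h⟩
    · exact ⟨0, fun h => absurd h ht⟩
  choose Z hZ using hZ
  have hlim : ∀ y, nilConj ((Φ 0 (τ.x y)).1 0 1) ((Φ 0 (τ.x y)).1 1 1) =
      nilConj (d * ((k * (1 / 2 - τ.c y)) • W.monomial (-1))) e := fun y => by
    rw [(hΦ0 _).1, (hΦ0 _).2, τ.apply_x, sub_add_cancel, inv_inv]
    rfl
  have hPij : ∀ i j, ContinuousOn (fun q : ℝ × (ℝ × ℂ) =>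
      nilConj ((Φ q.1 (τ.x q.2)).1 0 1) ((Φ q.1 (τ.x q.2)).1 1 1) i j)
      (Set.Ioo (-ε) ε ×ˢ Set.univ) := by
    have hx := τ.continuous_x
    have h1 : ∀ i j, ContinuousOn (fun q : ℝ × (ℝ × ℂ) => (Φ q.1 (τ.x q.2)).1 i j)
        (Set.Ioo (-ε) ε ×ˢ Set.univ) := fun i j =>
      (hΦc i j).comp (f := fun q : ℝ × (ℝ × ℂ) => (q.1, τ.x q.2))
        (by fun_prop) fun q hq => ⟨hq.1, trivial⟩
    intro i j
    fin_cases i <;> fin_cases j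
    · exact (h1 0 1).mul (h1 1 1)
    · exact ((h1 0 1).pow 2).neg
    · exact (h1 1 1).pow 2
    · exact ((h1 0 1).mul (h1 1 1)).neg
  -- Continuity of `(t, x) ↦ Φ_t(x)` is uniform over the compact closure of the tube parameters.
  have hP : ∀ η > 0, ∀ᶠ t in 𝓝 (0 : ℝ), ∀ s ∈ Set.Icc (0 : ℝ) 1, ∀ h ∈ Metric.ball (0 : ℂ) 1,
      ‖nilConj ((Φ t (τ.x (s, h))).1 0 1) ((Φ t (τ.x (s, h))).1 1 1) -
        nilConj (d * ((k * (1 / 2 - τ.c (s, h))) • W.monomial (-1))) e‖ ≤ η := by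
    intro η hη
    have hc := τ.continuous_c
    have key : ∀ i j, ∀ᶠ t in 𝓝 (0 : ℝ), ∀ y ∈ Set.Icc (0 : ℝ) 1 ×ˢ Metric.closedBall (0 : ℂ) 1,
        ‖nilConj ((Φ t (τ.x y)).1 0 1) ((Φ t (τ.x y)).1 1 1) i j -
          nilConj (d * ((k * (1 / 2 - τ.c y)) • W.monomial (-1))) e i j‖ ≤ η / 2 := fun i j =>
      eventually_forall_norm_le (f := fun q : ℝ × (ℝ × ℂ) =>
          nilConj ((Φ q.1 (τ.x q.2)).1 0 1) ((Φ q.1 (τ.x q.2)).1 1 1) i j -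
          nilConj (d * ((k * (1 / 2 - τ.c q.2)) • W.monomial (-1))) e i j) hε isOpen_univ
        ((hPij i j).sub (continuous_nilConj (by fun_prop) continuous_const i j).continuousOn)
        (isCompact_Icc.prod (isCompact_closedBall (0 : ℂ) 1)) (Set.subset_univ _)
        (fun y _ => by simp only [hlim, sub_self]) (half_pos hη)
    filter_upwards [eventually_all.2 fun i => eventually_all.2 (key i)] with t ht s hs h hh
    refine (Matrix.norm_le_of_entry (C := η / 2) fun i j => ?_).trans (le_of_eq (by ring))
    exact ht i j (s, h) ⟨hs, Metric.ball_subset_closedBall hh⟩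
  have lin := τ.isLittleO k hde (hI.mono fun t ht => (hAB t ht).2.2.1) hY
    (hI.mono fun t ht => (hZ t ht).2.2) (hI.mono fun t ht => (hZ t ht).1) hP
  have lin' : ∀ i j, (fun t => (Z t (1, 0) - 1 + τ.κ • firstOrder k d e (A t) (B t)) i j)
      =o[𝓝 0] fun t => (A t, B t) := fun i j =>
    ((Matrix.entryCLM (ρ := ρ) i j).isBigO_comp _ _).trans_isLittleO lin
  obtain ⟨E, hE, hEM⟩ := W.exists_symFunctional S
  have hB : Tendsto B (𝓝 0) (𝓝 0) := (continuous_snd.tendsto (0 : W ρ × W ρ)).comp hY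
  have hBbar : Tendsto (fun t => (B t).bar) (𝓝 0) (𝓝 0) := by
    rw [tendsto_zero_iff_norm_tendsto_zero] at hB ⊢
    simpa only [W.norm_bar] using hB
  -- This fixes the sign in the Monodromy Problem: the inverse monodromy tends to the identity,
  -- which excludes `-I₂` at the Sym-points for small `t`.
  have hN11 : Tendsto (fun t => Z t (1, 0) 1 1) (𝓝 0) (𝓝 1) := by
    have h1 : Tendsto (fun t => Z t (1, 0) 1 1 - 1 +
        τ.κ • -(W.monomial (-1) * ((-k / 2) • (B t + (B t).bar)))) (𝓝 0) (𝓝 0) :=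
      (lin' 1 1).trans_tendsto hY
    have h2 : Tendsto (fun t => τ.κ • -(W.monomial (-1) * ((-k / 2) • (B t + (B t).bar))))
        (𝓝 0) (𝓝 0) := by
      simpa using ((((hB.add hBbar).const_smul (-k / 2)).const_mul
        (W.monomial (ρ := ρ) (-1))).neg).const_smul τ.κ
    simpa using (h1.sub h2).add_const (1 : W ρ)
  have hsign : ∀ᶠ t in 𝓝 (0 : ℝ), ∀ i j, E ((monodromy (Φ t) δ').1 i j) =
      E ((1 : Matrix (Fin 2) (Fin 2) (W ρ)) i j) := by
    have h1 : Tendsto (fun t => E (Z t (1, 0) 1 1)) (𝓝 0) (𝓝 (E 1)) :=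
      (E.continuous.tendsto 1).comp hN11
    have h2 : E 1 ≠ -E 1 := fun h => hE.apply_one_ne_zero (self_eq_neg.1 h)
    filter_upwards [hI, h1.eventually_ne h2] with t ht hne
    refine (hEM _ (hM t ht)).resolve_right fun h => hne ?_
    rw [(hZ t ht).2.1, (SL_inv_apply _).2.2.2, h 0 0]
    simp
  have hzero := W.eventually_eq_zero_of_linearization (l := 𝓝 (0 : ℝ)) hE hk τ.κ_ne_zero τ.conj_κ
    hde (A := A) (B := B) (N := fun t => Z t (1, 0)) (hI.mono fun t ht => (hAB t ht).1)
    (hI.mono fun t ht => (hAB t ht).2.1) (hI.mono fun t ht => (hAB t ht).2.2.2.1)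
    (hI.mono fun t ht => by
      simp only [(hZ t ht).2.1]
      rw [(SL_inv_apply _).2.2.2, (SL_inv_apply _).1]
      exact (hM t ht).isUnitaryLoop.adj_entries.1)
    (hI.mono fun t ht => by
      simp only [(hZ t ht).2.1]
      rw [(SL_inv_apply _).2.2.1, (SL_inv_apply _).2.1, W.adj_neg,
        (hM t ht).isUnitaryLoop.adj_entries.2])
    ((hI.and hsign).mono fun t ht => by
      simp only [(hZ t ht.1).2.1]
      rw [(SL_inv_apply _).1, ht.2 1 1, Matrix.one_apply_eq])
    ((hI.and hsign).mono fun t ht => by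
      simp only [(hZ t ht.1).2.1]
      rw [(SL_inv_apply _).2.2.1, map_neg, ht.2 1 0]
      simp)
    (lin' 0 0)
    ((lin' 0 1).congr_left fun t => by
      change Z t (1, 0) 0 1 - (1 : Matrix (Fin 2) (Fin 2) (W ρ)) 0 1 + τ.κ • -_ = _
      rw [Matrix.one_apply_ne zero_ne_one, sub_zero, smul_neg, ← sub_eq_add_neg])
    ((lin' 1 0).congr_left fun t => by
      change Z t (1, 0) 1 0 - (1 : Matrix (Fin 2) (Fin 2) (W ρ)) 1 0 + τ.κ • _ = _
      rw [Matrix.one_apply_ne one_ne_zero, sub_zero]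
      rfl)
    ((lin' 1 1).congr_left fun t => by
      change Z t (1, 0) 1 1 - (1 : Matrix (Fin 2) (Fin 2) (W ρ)) 1 1 + τ.κ • -_ = _
      rw [Matrix.one_apply_eq, smul_neg, ← sub_eq_add_neg])
  filter_upwards [hI, hzero] with t ht h0
  have := (hAB t ht).2.2.2.2.1
  simpa [h0.1, h0.2] using this

end Core

/-! ### Exchanging the off-diagonal entries -/

section Swap

variable {ρ : ℝ} [hρ : Fact (1 < ρ)] {X : Type*} [TopologicalSpace X]

theorem W.monomial_one_mul_neg_one : (W.monomial 1 : W ρ) * W.monomial (-1) = 1 := by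
  rw [W.monomial_mul_monomial, add_neg_cancel, W.monomial_zero]

/-- Conjugation by `[[0, λ⁻¹], [1, 0]]`. -/
def swapMatrix (M : Matrix (Fin 2) (Fin 2) (W ρ)) : Matrix (Fin 2) (Fin 2) (W ρ) :=
  !![M 1 1, W.monomial (-1) * M 1 0; W.monomial 1 * M 0 1, M 0 0]

theorem swapMatrix_mul (M N : Matrix (Fin 2) (Fin 2) (W ρ)) :
    swapMatrix (M * N) = swapMatrix M * swapMatrix N := by
  have h := W.monomial_one_mul_neg_one (ρ := ρ)
  refine Matrix.ext fun i j => ?_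
  fin_cases i <;> fin_cases j <;>
    simp only [swapMatrix, Matrix.mul_apply, Fin.sum_univ_two, Fin.zero_eta, Fin.mk_one,
      Matrix.of_apply, Matrix.cons_val', Matrix.cons_val_zero, Matrix.cons_val_one,
      Matrix.cons_val_fin_one]
  · linear_combination (-(M 1 0 * N 0 1)) * h
  · ring
  · ring
  · linear_combination (-(M 0 1 * N 1 0)) * h

/-- Conjugation by `[[0, λ⁻¹], [1, 0]]` as an automorphism of `ΛSL(2,ℂ)`. -/
def swapHom : SL(2, W ρ) →* SL(2, W ρ) where
  toFun M := ⟨swapMatrix M.1, by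
    have h := W.monomial_one_mul_neg_one (ρ := ρ)
    have h1 := M.2
    rw [Matrix.det_fin_two] at h1
    rw [swapMatrix, Matrix.det_fin_two_of]
    linear_combination h1 - (M.1 0 1 * M.1 1 0) * h⟩
  map_one' := Subtype.ext <| Matrix.ext fun i j => by
    fin_cases i <;> fin_cases j <;> simp [swapMatrix]
  map_mul' M N := Subtype.ext (swapMatrix_mul M.1 N.1)

theorem swapHom_coe (M : SL(2, W ρ)) : (swapHom M).1 = swapMatrix M.1 := rfl

theorem W.eval_monomial_mul {μ : ℂ} (hμ : W.InAnnulus ρ μ) (n : ℤ) (f : W ρ) :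
    (W.monomial n * f).eval μ = μ ^ n * f.eval μ := by
  rw [W.eval_mul hμ, W.eval_monomial]

theorem evalMatrix_swapHom {μ : ℂ} (hμ : W.InAnnulus ρ μ) (M : SL(2, W ρ)) :
    evalMatrix (swapHom M).1 μ =
      !![0, μ⁻¹; 1, 0] * evalMatrix M.1 μ * !![0, 1; μ, 0] := by
  have h0 : μ ≠ 0 := hμ.2.2
  have h01 : evalMatrix (swapHom M).1 μ 0 1 = μ⁻¹ * evalMatrix M.1 μ 1 0 := by
    rw [← zpow_neg_one]
    exact W.eval_monomial_mul hμ (-1) _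
  have h10 : evalMatrix (swapHom M).1 μ 1 0 = μ * evalMatrix M.1 μ 0 1 := by
    have := W.eval_monomial_mul hμ 1 (M.1 0 1)
    rw [zpow_one] at this
    exact this
  have h00 : evalMatrix (swapHom M).1 μ 0 0 = evalMatrix M.1 μ 1 1 := rfl
  have h11 : evalMatrix (swapHom M).1 μ 1 1 = evalMatrix M.1 μ 0 0 := rfl
  rw [Matrix.eta_fin_two (evalMatrix (swapHom M).1 μ), h00, h01, h10, h11,
    Matrix.eta_fin_two (evalMatrix M.1 μ), Matrix.mul_fin_two, Matrix.mul_fin_two]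
  simp only [zero_mul, mul_zero, zero_add, add_zero, one_mul, mul_one, Matrix.of_apply,
    Matrix.cons_val', Matrix.cons_val_zero, Matrix.cons_val_one, Matrix.cons_val_fin_one]
  rw [mul_right_comm, inv_mul_cancel₀ h0, one_mul, mul_comm μ]

/-- The conjugating matrix `[[0, μ⁻¹], [1, 0]]` is itself unitary when `|μ| = 1`. -/
theorem IsUnitaryLoop.swap {M : SL(2, W ρ)} (h : IsUnitaryLoop M) : IsUnitaryLoop (swapHom M) := by
  intro μ hμ
  have h0 : μ ≠ 0 := by rintro rfl; simp at hμ
  have h1 := h μ hμ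
  rw [evalMatrix_swapHom (W.inAnnulus_of_norm_eq_one hμ)]
  rw [Matrix.mem_specialUnitaryGroup_iff] at h1 ⊢
  have hc : conj μ = μ⁻¹ := (Complex.inv_eq_conj hμ).symm
  have hK : !![0, μ⁻¹; 1, 0] ∈ Matrix.unitaryGroup (Fin 2) ℂ := by
    rw [Matrix.mem_unitaryGroup_iff]
    refine Matrix.ext fun i j => ?_
    fin_cases i <;> fin_cases j <;>
      simp [Matrix.mul_apply, Fin.sum_univ_two, Matrix.star_apply, hc, h0]
  have hK' : !![0, 1; μ, 0] ∈ Matrix.unitaryGroup (Fin 2) ℂ := by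
    rw [Matrix.mem_unitaryGroup_iff]
    refine Matrix.ext fun i j => ?_
    fin_cases i <;> fin_cases j <;>
      simp [Matrix.mul_apply, Fin.sum_univ_two, Matrix.star_apply, hc, h0]
  refine ⟨mul_mem (mul_mem hK h1.1) hK', ?_⟩
  rw [Matrix.det_mul, Matrix.det_mul, h1.2, Matrix.det_fin_two_of, Matrix.det_fin_two_of]
  field_simp
  ring

theorem swap_one_aux {μ : ℂ} (h0 : μ ≠ 0) :
    !![0, μ⁻¹; 1, 0] * !![0, 1; μ, 0] = (1 : Matrix (Fin 2) (Fin 2) ℂ) := by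
  rw [Matrix.mul_fin_two, Matrix.one_fin_two]
  simp [h0]

theorem evalMatrix_swapHom_eq_one {μ : ℂ} (hμ : W.InAnnulus ρ μ) {M : SL(2, W ρ)}
    (h : evalMatrix M.1 μ = 1) : evalMatrix (swapHom M).1 μ = 1 := by
  rw [evalMatrix_swapHom hμ, h, mul_one, swap_one_aux hμ.2.2]

theorem evalMatrix_swapHom_eq_neg_one {μ : ℂ} (hμ : W.InAnnulus ρ μ) {M : SL(2, W ρ)}
    (h : evalMatrix M.1 μ = -1) : evalMatrix (swapHom M).1 μ = -1 := by
  rw [evalMatrix_swapHom hμ, h, mul_neg, mul_one, neg_mul, swap_one_aux hμ.2.2]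

theorem W.deriv_eval_monomial_mul (n : ℤ) {f : W ρ} (h0 : f.eval 1 = 0)
    (h1 : deriv (fun μ => f.eval μ) 1 = 0) : deriv (fun μ => (W.monomial n * f).eval μ) 1 = 0 := by
  have h2 : (fun μ => (W.monomial n * f).eval μ) =ᶠ[𝓝 1]
      fun μ => (W.monomial n : W ρ).eval μ * f.eval μ := by
    filter_upwards [W.eventually_inAnnulus (ρ := ρ)] with μ hμ
    exact W.eval_mul hμ _ _
  rw [h2.deriv_eq, deriv_fun_mul (W.differentiableAt_eval_one _) f.differentiableAt_eval_one, h0,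
    h1]
  simp

theorem MonodromyProblemSym.swap {a b : ℂ} (ha : W.InAnnulus ρ a) (hb : W.InAnnulus ρ b)
    {M : SL(2, W ρ)} (h : MonodromyProblemSym a b M) : MonodromyProblemSym a b (swapHom M) :=
  ⟨h.1.swap, h.2.imp
    (fun h => ⟨evalMatrix_swapHom_eq_one ha h.1, evalMatrix_swapHom_eq_one hb h.2⟩)
    (fun h => ⟨evalMatrix_swapHom_eq_neg_one ha h.1, evalMatrix_swapHom_eq_neg_one hb h.2⟩)⟩

theorem MonodromyProblem.swap {S : SpaceForm ρ} {M : SL(2, W ρ)} (h : MonodromyProblem S M) :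
    MonodromyProblem S (swapHom M) := by
  cases S with
  | euclidean =>
    obtain ⟨hu, h1, hd⟩ := h
    have h1a : W.InAnnulus ρ 1 := W.inAnnulus_of_norm_eq_one norm_one
    refine ⟨hu.swap, h1.imp (evalMatrix_swapHom_eq_one h1a) (evalMatrix_swapHom_eq_neg_one h1a),
      fun i j => ?_⟩
    -- The off-diagonal entries vanish at `λ = 1`, so multiplying them by `λ^{±1}` does not create a
    -- derivative there.
    have hoff : ∀ i j : Fin 2, i ≠ j → (M.1 i j).eval 1 = 0 := fun i j hij => by
      rcases h1 with h1 | h1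
      · simpa [evalMatrix, hij] using congrFun₂ h1 i j
      · simpa [evalMatrix, hij] using congrFun₂ h1 i j
    fin_cases i <;> fin_cases j
    · exact hd 1 1
    · exact W.deriv_eval_monomial_mul (-1) (hoff 1 0 one_ne_zero) (hd 1 0)
    · exact W.deriv_eval_monomial_mul 1 (hoff 0 1 zero_ne_one) (hd 0 1)
    · exact hd 0 0
  | spherical θ h0 hπ =>
    refine MonodromyProblemSym.swap (W.inAnnulus_of_norm_eq_one ?_)
      (W.inAnnulus_of_norm_eq_one ?_) h
    · exact Complex.norm_exp_ofReal_mul_I θ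
    · rw [Complex.norm_exp]; simp
  | hyperbolic q h0 hq =>
    have hlt : ρ⁻¹ < Real.exp (-q) := by
      rw [Real.exp_neg]
      exact inv_strictAnti₀ (Real.exp_pos q) hq
    have h1 : Real.exp (-q) < Real.exp q := Real.exp_lt_exp.2 (by linarith)
    refine MonodromyProblemSym.swap (W.inAnnulus_of_mem ?_ ?_) (W.inAnnulus_of_mem ?_ ?_) h <;>
      rw [Complex.norm_exp]
    · simpa using hlt.trans h1
    · simpa using hq
    · simpa using hlt
    · simpa using h1.trans hq

/-- The potential with `β` and `γ` exchanged. -/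
def DPWPotential.swap (ξ : DPWPotential ρ) : DPWPotential ρ := ⟨fun z => -ξ.α z, ξ.γ, ξ.β⟩

theorem DPWPotential.swap_toMatrix (ξ : DPWPotential ρ) (z : ℂ) :
    ξ.swap.toMatrix z = swapMatrix (ξ.toMatrix z) := by
  refine Matrix.ext fun i j => ?_
  fin_cases i <;> fin_cases j
  · rfl
  · rfl
  · change ξ.β z = W.monomial 1 * (W.monomial (-1) * ξ.β z)
    rw [← mul_assoc, W.monomial_one_mul_neg_one, one_mul]
  · exact neg_neg _

theorem IsSolution.swap {U : Set ℂ} {p : X → U} {ξ : DPWPotential ρ} {Φ : X → SL(2, W ρ)}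
    (h : IsSolution p ξ Φ) : IsSolution p ξ.swap fun x => swapHom (Φ x) := by
  intro x s hs hsc hsp i j
  have h1 := h x s hs hsc hsp
  rw [DPWPotential.swap_toMatrix, swapHom_coe, ← swapMatrix_mul]
  fin_cases i <;> fin_cases j
  · exact h1 1 1
  · exact (h1 1 0).const_mul _
  · exact (h1 0 1).const_mul _
  · exact h1 0 0

theorem monodromy_swap (Φ : X → SL(2, W ρ)) (δ' : unitInterval → X) :
    monodromy (fun x => swapHom (Φ x)) δ' = swapHom (monodromy Φ δ') := by
  simp only [monodromy, map_mul, map_inv]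

theorem HolomorphicAtZeroInfty.neg {E : Type*} [NormedAddCommGroup E] [NormedSpace ℂ E]
    {f : ℂ → E} (h : HolomorphicAtZeroInfty f) : HolomorphicAtZeroInfty fun z => -f z := by
  obtain ⟨⟨g, hg, hgf⟩, ⟨g', hg', hgf'⟩⟩ := h
  refine ⟨⟨fun z => -g z, hg.neg, hgf.mono fun z hz => by simp only [hz, smul_neg]⟩,
    ⟨fun z => -g' z, hg'.neg, hgf'.mono fun z hz => ?_⟩⟩
  rw [smul_neg, ← hz, atInfinity, atInfinity, smul_neg]

end Swap

end

/-! ### The theorem and its dual. -/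

theorem mainTheorem3 (ρ : ℝ) [Fact (1 < ρ)] (S : SpaceForm ρ)
    -- the domain `Ω`
    (Ω : Set (OnePoint ℂ)) (hΩo : IsOpen Ω) (hΩc : IsConnected Ω) (hΩσ : sigma '' Ω = Ω)
    (hΩ0 : ((0 : ℂ) : OnePoint ℂ) ∈ Ω) (hΩi : ∞ ∈ Ω) (hΩ1 : ((-1 : ℂ) : OnePoint ℂ) ∉ Ω)
    -- the universal covering of `Ω ∖ {0, ∞}`, and a lift of `σ` to it
    {X : Type*} [TopologicalSpace X] [SimplyConnectedSpace X]
    (p : X → puncture Ω) (hp : IsCoveringMap p)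
    (σ' : X → X) (hσ'c : Continuous σ') (hσ' : ∀ x, (p (σ' x) : ℂ) = (conj (p x : ℂ))⁻¹)
    -- the curve `δ`, given through a lift `δ'` to the universal covering
    (δ' : C(unitInterval, X))
    (hδ : BoundsDisk Ω fun s => ((p (δ' s) : ℂ) : OnePoint ℂ))
    (hδσ : (fun z : ℂ => (conj z)⁻¹) '' Set.range (fun s => (p (δ' s) : ℂ)) =
      Set.range fun s => (p (δ' s) : ℂ))
    -- the family of potentials
    (ε : ℝ) (hε : 0 < ε) (ξ : ℝ → DPWPotential ρ)
    (hξ : ∀ t ∈ Set.Ioo (-ε) ε, (ξ t).IsPotentialOn (puncture Ω))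
    (hξσ : ∀ t ∈ Set.Ioo (-ε) ε, (ξ t).IsSigmaSymmetricOn (puncture Ω))
    (hξC1 : DPWPotential.IsC1FamilyOn ξ (Set.Ioo (-ε) ε) (puncture Ω))
    -- the continuous family of symmetric solutions, solving the Monodromy Problem on `δ`
    (Φ : ℝ → X → SL(2, W ρ))
    (hΦ : ∀ t ∈ Set.Ioo (-ε) ε, IsSolution p (ξ t) (Φ t))
    (hΦσ : ∀ t ∈ Set.Ioo (-ε) ε, IsSigmaSymmetric σ' (Φ t))
    (hΦc : ∀ i j, ContinuousOn (fun q : ℝ × X => (Φ q.1 q.2).1 i j)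
      (Set.Ioo (-ε) ε ×ˢ Set.univ))
    (hM : ∀ t ∈ Set.Ioo (-ε) ε, MonodromyProblem S (monodromy (Φ t) δ'))
    -- `Φ_0(1)` is diagonal
    (x₁ : X) (hx₁ : (p x₁ : ℂ) = 1) (hdiag : (Φ 0 x₁).1.IsDiag)
    (k : ℝ) (hk : k ≠ 0) :
    ((∀ t ∈ Set.Ioo (-ε) ε, HolomorphicAtZeroInfty (ξ t).α ∧ HolomorphicAtZeroInfty (ξ t).β ∧
        SingularEntry (ξ t).γ) →
      (∀ z ∈ puncture Ω, (ξ 0).toMatrix z =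
        ((k : ℂ) / (z + 1) ^ 2) • !![0, W.monomial (-1); 0, 0]) →
      ∀ᶠ t in 𝓝 (0 : ℝ), (ξ t).IsHolomorphicAtZeroInfty) ∧
    ((∀ t ∈ Set.Ioo (-ε) ε, HolomorphicAtZeroInfty (ξ t).α ∧ HolomorphicAtZeroInfty (ξ t).γ ∧
        SingularEntry (ξ t).β) →
      (∀ z ∈ puncture Ω, (ξ 0).toMatrix z =
        ((k : ℂ) / (z + 1) ^ 2) • !![0, 0; 1, 0]) →
      ∀ᶠ t in 𝓝 (0 : ℝ), (ξ t).IsHolomorphicAtZeroInfty) := by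
  have hI : ∀ᶠ t in 𝓝 (0 : ℝ), t ∈ Set.Ioo (-ε) ε := Ioo_mem_nhds (by linarith) hε
  have hkc : (k : ℂ) ≠ 0 := by exact_mod_cast hk
  refine ⟨fun hreg hξ0 => ?_, fun hreg hξ0 => ?_⟩
  · filter_upwards [hI, eventually_holomorphicAtZeroInfty_gamma S hΩo hΩ0 hΩ1 hp hδ hε hξ
      (fun t ht z hz => (hξσ t ht).gamma hz) hξC1.2.2.continuousOn hΦ hΦc hM hx₁ hdiag hkc hreg
      hξ0] with t ht hγ
    exact ⟨(hreg t ht).1, (hreg t ht).2.1, hγ⟩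
  -- The dual case is the first one for the swapped potentials and solutions. At `t = 0` the swap
  -- turns `E₁₀` into `λ⁻¹E₀₁`, and it keeps `Φ_0(1)` diagonal.
  · have hmul : ∀ (n : ℤ) (i j : Fin 2), ContinuousOn (fun q : ℝ × X =>
        W.monomial n * (Φ q.1 q.2).1 i j) (Set.Ioo (-ε) ε ×ˢ Set.univ) := fun n i j =>
      continuousOn_const.mul (hΦc i j)
    filter_upwards [hI, eventually_holomorphicAtZeroInfty_gamma S hΩo hΩ0 hΩ1 hp hδ hε
      (ξ := fun t => (ξ t).swap)
      (fun t ht => ⟨⟨(hξ t ht).1.1.neg, (hξ t ht).1.2.2, (hξ t ht).1.2.1⟩, fun z hz =>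
        ⟨fun i hi => by
          change -((ξ t).α z).coeff i = 0
          rw [((hξ t ht).2 z hz).1 i hi, neg_zero],
        ((hξ t ht).2 z hz).2.2, ((hξ t ht).2 z hz).2.1⟩⟩)
      (fun t ht z hz => (hξσ t ht).beta hz) hξC1.2.1.continuousOn
      (Φ := fun t x => swapHom (Φ t x)) (fun t ht => (hΦ t ht).swap)
      (fun i j => by
        fin_cases i <;> fin_cases j
        · exact hΦc 1 1
        · exact hmul (-1) 1 0
        · exact hmul 1 0 1
        · exact hΦc 0 0)
      (fun t ht => by
        rw [monodromy_swap]
        exact (hM t ht).swap) hx₁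
      (fun i j hij => by
        fin_cases i <;> fin_cases j
        · exact absurd rfl hij
        · exact mul_eq_zero_of_right _ (hdiag one_ne_zero)
        · exact mul_eq_zero_of_right _ (hdiag zero_ne_one)
        · exact absurd rfl hij) hkc
      (fun t ht => ⟨(hreg t ht).1.neg, (hreg t ht).2.1, (hreg t ht).2.2⟩)
      (fun z hz => by
        rw [DPWPotential.swap_toMatrix, hξ0 z hz]
        refine Matrix.ext fun i j => ?_
        fin_cases i <;> fin_cases j <;> simp [swapMatrix])] with t ht hβ
    exact ⟨(hreg t ht).1, hβ, (hreg t ht).2.1⟩
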